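/- Setting. Let $G=(V,E)$ be a finite simple graph with $n=|V|$ nodes and weights $w_{ij}>0$ on its edges, and let $W=\max_{(i,j)\in E}w_{ij}$. Write $\partial i$ for the set of neighbours of $i$ and $x_+=\max(x,0)$; a maximum of nonnegative quantities over the empty set is $0$. A Nash bargaining (NB) solution is a pair $(M,\gamma)$ of a matching $M\subseteq E$ and a vector $\gamma\in\mathbb R_{\ge 0}^V$ such that $\gamma_i=0$ for every unmatched node $i$, $\gamma_i+\gamma_j=w_{ij}$ for $(i,j)\in M$, $\gamma_i+\gamma_j\ge w_{ij}$ for $(i,j)\in E\setminus M$ (stability), and $\gamma_i-\max_{k\in\partial i\setminus j}(w_{ik}-\gamma_k)_+=\gamma_j-\max_{l\in\partial j\setminus i}(w_{jl}-\gamma_l)_+$ for $(i,j)\in M$ (balance). Natural dynamics. Fix a damping factor $\kappa\in(0,1)$. Messages $\alpha^t_{i\to j}$ live on the $2|E|$ directed edges. The offers are $m^t_{i\to j}=(w_{ij}-\alpha^t_{i\to j})_+-\tfrac12(w_{ij}-\alpha^t_{i\to j}-\alpha^t_{j\to i})_+$, the earning estimates are $\gamma^t_i=\max_{k\in\partial i}m^t_{k\to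 i}$, and all messages are updated synchronously by $\alpha^{t+1}_{i\to j}=\kappa\max_{k\in\partial i\setminus j}m^t_{k\to i}+(1-\kappa)\alpha^t_{i\to j}$. Gap. Let $(M,\gamma)$ be an NB solution. A Kleinberg–Tardos (KT) sequence of $(M,\gamma)$ consists of structures $\mathcal C_q=(V(\mathcal C_q),E(\mathcal C_q))$ and slacks $\sigma_q$, $1\le q\le k$, as follows. Let $F_q$ be the set of nodes that are unmatched or lie in $V(\mathcal C_r)$ for some $1\le r<q$. Consider the linear program which, over $x\in\mathbb R^V$ with $x_i=\gamma_i$ for $i\in F_q$ and $x_i+x_j=w_{ij}$ for $(i,j)\in M$, maximizes the number $s$ subject to $s\le x_i+x_j-w_{ij}$ for all $(i,j)\in E\setminus M$ not having both ends in $F_q$ and $s\le x_i$ for all $i\notin F_q$. It is required that $(x,s)=(\gamma,\sigma_q)$ is an optimal solution; that $\gamma_i+\gamma_j-w_{ij}=\sigma_q$ for all $(i,j)\in E(\mathcal C_q)\setminus M$; that $V(\mathcal C_q)$ is the set of endpoints of edges of $E(\mathcal C_q)$ that are not in $F_q$; and that $E(\mathcal C_q)\subseteq E$ is the edge set of one of: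 (a) a path alternating between $M$ and $E\setminus M$ and anchored at both ends (the two ends may be the same node of $F_q$, otherwise the nodes are distinct); (b) a blossom: an odd cycle alternating except at one node $u$, both of whose cycle edges are unmatched, together with an alternating path (stem) that starts at $u$ with a matched edge, meets the cycle only in $u$, and is anchored at its other end; (c) a bicycle: two disjoint odd cycles of this kind with exceptional nodes $u,u'$, together with an alternating path from $u$ to $u'$ that starts and ends with matched edges and meets the cycles only in $u,u'$; (d) an alternating cycle of even length. Here an end is anchored if it lies in $F_q$ and its edge on the path is unmatched, or if it does not lie in $F_q$, its edge on the path is matched, and its value $\gamma$ equals $\sigma_q$; all nodes that are not anchored ends lie outside $F_q$. Finally $F_{k+1}=V$. The solution $(M,\gamma)$ has gap $\sigma$ if, for a KT sequence of it, $\sigma\le\min\{\sigma_1,\sigma_2-\sigma_1,\dots,\sigma_k-\sigma_{k-1}\}$ and, for every $q$ and every edge $(i,j)\in E\setminus E(\mathcal C_q)$ whose two ends are both endpoints of edges of $E(\mathcal C_q)$, $\gamma_i+\gamma_j-w_{ij}\ge\sigma_q+\sigma$. Theorem. For every $\kappa\in(0,1)$ there is a constant $C>0$, depending on nothing else, such that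 the following holds. Suppose that the instance $(G,w)$ has exactly one NB solution $(M,\gamma_{\rm NB})$ and that this solution has gap $\sigma>0$. Let $\epsilon>0$ and $$T_*=C\,n^7\left(\frac W\sigma+\log\Big(1+\frac\sigma\epsilon\Big)\right).$$ Then for every initial condition $\alpha^0\in[0,W]^{2|E|}$ and every integer $t\ge T_*$, the natural dynamics yields earning estimates with $|\gamma^t_i-\gamma_{{\rm NB},i}|\le\epsilon$ for all $i\in V$. -/

import Mathlib

namespace Bargaining

noncomputable section

/-- An exchange network: a graph with a positive weight (profit to be shared) on every edge.
The value of `weight` on a pair that is not an edge is never used. -/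
structure ExchangeNetwork (V : Type*) where
  graph : SimpleGraph V
  weight : Sym2 V → ℝ
  weight_pos : ∀ e ∈ graph.edgeSet, 0 < weight e

/-- `W`, the largest edge weight (`0` if there is no edge). -/
def ExchangeNetwork.maxWeight {V : Type*} (N : ExchangeNetwork V) : ℝ :=
  ⨆ e : N.graph.edgeSet, N.weight e

/-- The maximum of `f` over the neighbours of `i`; it is `0` if there are none. -/
def ExchangeNetwork.nbrMax {V : Type*} (N : ExchangeNetwork V) (i : V) (f : V → ℝ) : ℝ :=
  ⨆ k : {k : V // N.graph.Adj i k}, f k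

/-- The maximum of `f` over the neighbours of `i` other than `j`; it is `0` if there are none. -/
def ExchangeNetwork.nbrMaxExcept {V : Type*} (N : ExchangeNetwork V) (i j : V) (f : V → ℝ) : ℝ :=
  ⨆ k : {k : V // N.graph.Adj i k ∧ k ≠ j}, f k

/-- The slack `γ i + γ j - w i j` of the pair `i, j`. -/
def ExchangeNetwork.slack {V : Type*} (N : ExchangeNetwork V) (γ : V → ℝ) (i j : V) : ℝ :=
  γ i + γ j - N.weight s(i, j)

/-! ### Nash bargaining solutions -/

/-- What `i` can earn at best away from `j`, given the earnings `γ` of the others: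
the maximum of `(w i k - γ k)₊` over the neighbours `k ≠ j` of `i`. -/
def bestAlternative {V : Type*} (N : ExchangeNetwork V) (γ : V → ℝ) (i j : V) : ℝ :=
  N.nbrMaxExcept i j (fun k => max (N.weight s(i, k) - γ k) 0)

/-- `(M, γ)` is a Nash bargaining solution (a stable and balanced outcome). -/
structure IsNashBargaining {V : Type*} (N : ExchangeNetwork V) (M : N.graph.Subgraph)
    (γ : V → ℝ) : Prop where
  matching : M.IsMatching
  nonneg : ∀ i, 0 ≤ γ i
  unmatched : ∀ i, i ∉ M.verts → γ i = 0
  traded : ∀ i j, M.Adj i j → γ i + γ j = N.weight s(i, j)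
  stable : ∀ i j, N.graph.Adj i j → ¬ M.Adj i j → N.weight s(i, j) ≤ γ i + γ j
  balanced : ∀ i j, M.Adj i j →
    γ i - bestAlternative N γ i j = γ j - bestAlternative N γ j i

/-! ### The natural dynamics

A message vector is a function `α : V → V → ℝ`; `α i j` is the message from `i` to `j`. Only the
values at adjacent pairs matter. -/

/-- The offer from `i` to `j`: `(w i j - α i j)₊ - (w i j - α i j - α j i)₊ / 2`. -/
def offer {V : Type*} (N : ExchangeNetwork V) (α : V → V → ℝ) (i j : V) : ℝ :=
  max (N.weight s(i, j) - α i j) 0 - 1 / 2 * max (N.weight s(i, j) - α i j - α j i) 0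

/-- One synchronous update of all messages with damping factor `κ`. -/
def step {V : Type*} (N : ExchangeNetwork V) (κ : ℝ) (α : V → V → ℝ) : V → V → ℝ :=
  fun i j => κ * N.nbrMaxExcept i j (fun k => offer N α k i) + (1 - κ) * α i j

/-- The message vector at time `t` of the natural dynamics started at `α₀`. -/
def messages {V : Type*} (N : ExchangeNetwork V) (κ : ℝ) (α₀ : V → V → ℝ) : ℕ → V → V → ℝ
  | 0 => α₀
  | t + 1 => step N κ (messages N κ α₀ t)

/-- The earning estimate of node `i`: the best offer that it receives. -/
def earning {V : Type*} (N : ExchangeNetwork V) (α : V → V → ℝ) (i : V) : ℝ :=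
  N.nbrMax i (fun k => offer N α k i)

/-- Valid message vectors: all messages along edges lie in `[0, W]`. -/
def IsValid {V : Type*} (N : ExchangeNetwork V) (α : V → V → ℝ) : Prop :=
  ∀ i j, N.graph.Adj i j → 0 ≤ α i j ∧ α i j ≤ N.maxWeight

/-! ### The Kleinberg-Tardos linear programs

`F` is the set of nodes whose values have been set already (to those of `γ`). -/

/-- `(x, t)` is feasible for the linear program that maximizes the minimum slack `t` of all unmatched
edges and all nodes that have not been set yet. The slack of a node is its value. -/
structure StageFeasible {V : Type*} (N : ExchangeNetwork V) (M : N.graph.Subgraph) (γ : V → ℝ)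
    (F : Set V) (x : V → ℝ) (t : ℝ) : Prop where
  settled : ∀ i ∈ F, x i = γ i
  matched : ∀ i j, M.Adj i j → x i + x j = N.weight s(i, j)
  edge_slack : ∀ i j, N.graph.Adj i j → ¬ M.Adj i j → ¬ (i ∈ F ∧ j ∈ F) → t ≤ N.slack x i j
  node_slack : ∀ i, i ∉ F → t ≤ x i

/-- `γ` is an optimal solution of the linear program, with optimal value `τ`. -/
def IsStageOptimum {V : Type*} (N : ExchangeNetwork V) (M : N.graph.Subgraph) (γ : V → ℝ)
    (F : Set V) (τ : ℝ) : Prop :=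
  StageFeasible N M γ F γ τ ∧ ∀ x t, StageFeasible N M γ F x t → t ≤ τ

/-! ### The four basic structures -/

/-- The edges of the walk `v 0, v 1, …, v ℓ`. -/
def walkEdges {V : Type*} (v : ℕ → V) (ℓ : ℕ) : Set (Sym2 V) :=
  {e | ∃ i < ℓ, e = s(v i, v (i + 1))}

/-- The endpoints of the edges in `E`. -/
def endpoints {V : Type*} (E : Set (Sym2 V)) : Set V :=
  {i | ∃ e ∈ E, i ∈ e}

/-- The end `x` of an alternating path or of a stem, with neighbour `y` on it, is anchored: either `x`
has been set before and `x y` is an unmatched edge, or `x y` is a matched edge and the node slack of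
`x` equals `τ`. -/
def IsAnchored {V : Type*} (N : ExchangeNetwork V) (M : N.graph.Subgraph) (γ : V → ℝ)
    (F : Set V) (τ : ℝ) (x y : V) : Prop :=
  (x ∈ F ∧ y ∉ F ∧ ¬ M.Adj x y) ∨ (x ∉ F ∧ M.Adj x y ∧ γ x = τ)

/-- `E` is the edge set of an alternating path that is anchored at both ends. The nodes of the path
are distinct, except that both ends may be anchored at the same node of `F`. -/
def IsAlternatingPath {V : Type*} (N : ExchangeNetwork V) (M : N.graph.Subgraph) (γ : V → ℝ)
    (F : Set V) (τ : ℝ) (E : Set (Sym2 V)) : Prop :=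
  ∃ (ℓ : ℕ) (v : ℕ → V),
    1 ≤ ℓ ∧
    (∀ i < ℓ, N.graph.Adj (v i) (v (i + 1))) ∧
    (∀ i, i + 1 < ℓ → (M.Adj (v i) (v (i + 1)) ↔ ¬ M.Adj (v (i + 1)) (v (i + 2)))) ∧
    Set.InjOn v (Set.Iio ℓ) ∧ Set.InjOn v (Set.Ioc 0 ℓ) ∧
    (∀ i, 0 < i → i < ℓ → v i ∉ F) ∧
    IsAnchored N M γ F τ (v 0) (v 1) ∧ IsAnchored N M γ F τ (v ℓ) (v (ℓ - 1)) ∧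
    E = walkEdges v ℓ

/-- `E` is the edge set of an alternating cycle, of even length. -/
def IsAlternatingCycle {V : Type*} (N : ExchangeNetwork V) (M : N.graph.Subgraph)
    (F : Set V) (E : Set (Sym2 V)) : Prop :=
  ∃ (ℓ : ℕ) (c : ℕ → V),
    3 ≤ ℓ ∧ Even ℓ ∧ c ℓ = c 0 ∧
    (∀ i < ℓ, N.graph.Adj (c i) (c (i + 1))) ∧
    (∀ i < ℓ, (M.Adj (c i) (c (i + 1)) ↔ Odd i)) ∧
    Set.InjOn c (Set.Iio ℓ) ∧
    (∀ i < ℓ, c i ∉ F) ∧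
    E = walkEdges c ℓ

/-- `c 0, c 1, …, c ℓ = c 0` is a cycle of odd length, alternating except at `c 0`, where both of its
edges are unmatched. -/
def IsOddLoop {V : Type*} (N : ExchangeNetwork V) (M : N.graph.Subgraph)
    (F : Set V) (ℓ : ℕ) (c : ℕ → V) : Prop :=
  3 ≤ ℓ ∧ Odd ℓ ∧ c ℓ = c 0 ∧
  (∀ i < ℓ, N.graph.Adj (c i) (c (i + 1))) ∧
  (∀ i < ℓ, (M.Adj (c i) (c (i + 1)) ↔ Odd i)) ∧
  Set.InjOn c (Set.Iio ℓ) ∧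
  (∀ i < ℓ, c i ∉ F)

/-- `s 0, s 1, …, s ℓ` is a path with distinct nodes whose edges are alternately matched and unmatched,
the first one `s 0, s 1` being matched. -/
def IsStem {V : Type*} (N : ExchangeNetwork V) (M : N.graph.Subgraph)
    (ℓ : ℕ) (s : ℕ → V) : Prop :=
  1 ≤ ℓ ∧
  (∀ i < ℓ, N.graph.Adj (s i) (s (i + 1))) ∧
  (∀ i < ℓ, (M.Adj (s i) (s (i + 1)) ↔ Even i)) ∧
  Set.InjOn s (Set.Iic ℓ)

/-- `E` is the edge set of a blossom: an odd loop `c` and a stem `s` that share exactly the node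
`s 0 = c 0`, the other end of the stem being anchored. -/
def IsBlossom {V : Type*} (N : ExchangeNetwork V) (M : N.graph.Subgraph) (γ : V → ℝ)
    (F : Set V) (τ : ℝ) (E : Set (Sym2 V)) : Prop :=
  ∃ (ℓs ℓc : ℕ) (s c : ℕ → V),
    IsStem N M ℓs s ∧ IsOddLoop N M F ℓc c ∧ s 0 = c 0 ∧
    (∀ i j, 0 < i → i ≤ ℓs → j < ℓc → s i ≠ c j) ∧
    (∀ i < ℓs, s i ∉ F) ∧
    IsAnchored N M γ F τ (s ℓs) (s (ℓs - 1)) ∧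
    E = walkEdges s ℓs ∪ walkEdges c ℓc

/-- `E` is the edge set of a bicycle: two disjoint odd loops `c` and `d`, joined by a stem `s` from `c 0`
to `d 0` whose first and last edges are matched. -/
def IsBicycle {V : Type*} (N : ExchangeNetwork V) (M : N.graph.Subgraph)
    (F : Set V) (E : Set (Sym2 V)) : Prop :=
  ∃ (ℓs ℓc ℓd : ℕ) (s c d : ℕ → V),
    IsStem N M ℓs s ∧ Odd ℓs ∧ IsOddLoop N M F ℓc c ∧ IsOddLoop N M F ℓd d ∧
    s 0 = c 0 ∧ s ℓs = d 0 ∧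
    (∀ i j, 0 < i → i ≤ ℓs → j < ℓc → s i ≠ c j) ∧
    (∀ i j, i < ℓs → j < ℓd → s i ≠ d j) ∧
    (∀ i j, i < ℓc → j < ℓd → c i ≠ d j) ∧
    (∀ i ≤ ℓs, s i ∉ F) ∧
    E = walkEdges s ℓs ∪ walkEdges c ℓc ∪ walkEdges d ℓd

/-! ### KT sequences and the gap

A KT sequence has structures `(Vs q, Es q)` with slacks `τ q`, for `1 ≤ q ≤ k`. -/

/-- The nodes that are set before stage `q`: the unmatched ones and those of the earlier structures. -/
def settledBefore {V : Type*} (N : ExchangeNetwork V) (M : N.graph.Subgraph) (Vs : ℕ → Set V)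
    (q : ℕ) : Set V :=
  {i | i ∉ M.verts ∨ ∃ r, 1 ≤ r ∧ r < q ∧ i ∈ Vs r}

/-- A Kleinberg-Tardos sequence of the outcome `(M, γ)`. At every stage `γ` solves the linear program,
with optimal value `τ q`, and `(Vs q, Es q)` is one of the basic structures, all of whose unmatched
edges are tight; its new nodes are set. In the end all nodes are set. -/
structure IsKTSequence {V : Type*} (N : ExchangeNetwork V) (M : N.graph.Subgraph) (γ : V → ℝ)
    (k : ℕ) (Vs : ℕ → Set V) (Es : ℕ → Set (Sym2 V)) (τ : ℕ → ℝ) : Prop where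
  optimum : ∀ q, 1 ≤ q → q ≤ k → IsStageOptimum N M γ (settledBefore N M Vs q) (τ q)
  shape : ∀ q, 1 ≤ q → q ≤ k →
    IsAlternatingPath N M γ (settledBefore N M Vs q) (τ q) (Es q) ∨
    IsBlossom N M γ (settledBefore N M Vs q) (τ q) (Es q) ∨
    IsBicycle N M (settledBefore N M Vs q) (Es q) ∨
    IsAlternatingCycle N M (settledBefore N M Vs q) (Es q)
  nodes : ∀ q, 1 ≤ q → q ≤ k → Vs q = endpoints (Es q) \ settledBefore N M Vs q
  tight : ∀ q, 1 ≤ q → q ≤ k → ∀ i j, s(i, j) ∈ Es q → ¬ M.Adj i j → N.slack γ i j = τ q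
  exhaust : ∀ i, i ∈ settledBefore N M Vs (k + 1)

/-- The outcome `(M, γ)` has gap `σ`: for a KT sequence of it, `σ ≤ τ 1`, `σ ≤ τ (q + 1) - τ q`, and every
edge outside `Es q` between two endpoints of edges of `Es q` has slack at least `τ q + σ`. -/
def HasGap {V : Type*} (N : ExchangeNetwork V) (M : N.graph.Subgraph) (γ : V → ℝ) (σ : ℝ) : Prop :=
  ∃ (k : ℕ) (Vs : ℕ → Set V) (Es : ℕ → Set (Sym2 V)) (τ : ℕ → ℝ),
    IsKTSequence N M γ k Vs Es τ ∧
    (1 ≤ k → σ ≤ τ 1) ∧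
    (∀ q, 1 ≤ q → q < k → σ ≤ τ (q + 1) - τ q) ∧
    (∀ q, 1 ≤ q → q ≤ k → ∀ i j, N.graph.Adj i j →
      i ∈ endpoints (Es q) → j ∈ endpoints (Es q) → s(i, j) ∉ Es q →
      τ q + σ ≤ N.slack γ i j)

end

end Bargaining

/-! The messages are compared with those of the solution. The level `lev i` is the stage of the KT
sequence at which node i is set, and it is 0 for unmatched nodes; level q has slack `τ q`. In the
solution, the message of i to its partner is its best alternative, γ_i minus the slack of its level,
and its message to anyone else is γ_i (`target`). One undamped update acts simply on the errors
`err`. Towards a non-partner, the new error of i is essentially half the difference of the errors in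
the two directions of its matched edge. Towards the partner, it is essentially the largest of minus
the errors received along the edges that realize the best alternative. By the gap, all competing
offers are worse by at least σ. Hence a uniform bound D for the errors never grows. Once the levels
below q have errors at most B, where B ≥ D - σ/2, the excess over B on level q can only come from
level q itself.

Inside a level, the edges that matter are those of one basic structure. Passing along a matched or
tight edge changes the sign of the error, so upper bounds for the error and for its negative are
followed together, as two modes. The pairs of a mode and a node are laid out along a line of at most
2c sites, where c is the number of nodes of the level (`IsChart`); odd loops are folded so that
their two directions share sites. The upper bounds then follow a linear averaging chain with
reflecting ends (`chainOp`). An energy estimate shows that a deficit at site 0 spreads over the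
whole chain within order n^5 steps (`chain_lower_bound`), so that the excess of all errors of the
level falls by a fraction of order 1/c (`IsCharted.err_decrease`).

The deficit at site 0 has three sources. At an anchored end of a path or stem, a message receives
nothing from its own level. In a bicycle, the error of a given message is nonpositive in one of the
two modes, and the chart is chosen to start there. For an alternating cycle, uniqueness of the
solution is used: if no node of one parity had an alternative outside the level, then errors of
alternating sign ±δ would be preserved by the nonexpansive update, and a fixed point would give a
second solution (`Layering.exists_exit`).

The levels are treated in increasing order (`sweep`). A level with c nodes takes order n^6 c steps
and spoils the gain of the lower levels by a factor 1 - 1/(4n) only. A sweep of order n^7 steps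
therefore lowers D by half of min(D, σ/2). This gives a linear phase with order W/σ sweeps and a
geometric phase with order log(1 + σ/ε) sweeps. -/

namespace Bargaining

/-! ### Elementary bounds for offers and for the update map. -/

section Operators

variable {V : Type*} (N : ExchangeNetwork V)

theorem ExchangeNetwork.nbrMaxExcept_le {i j : V} {f : V → ℝ} {c : ℝ} (hc : 0 ≤ c)
    (h : ∀ k, N.graph.Adj i k → k ≠ j → f k ≤ c) : N.nbrMaxExcept i j f ≤ c :=
  Real.iSup_le (fun k => h k k.2.1 k.2.2) hc

theorem ExchangeNetwork.nbrMax_le {i : V} {f : V → ℝ} {c : ℝ} (hc : 0 ≤ c)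
    (h : ∀ k, N.graph.Adj i k → f k ≤ c) : N.nbrMax i f ≤ c :=
  Real.iSup_le (fun k => h k k.2) hc

theorem ExchangeNetwork.le_nbrMaxExcept [Finite V] {i j k : V} (f : V → ℝ)
    (hk : N.graph.Adj i k) (hj : k ≠ j) : f k ≤ N.nbrMaxExcept i j f :=
  le_ciSup (f := fun k : {k : V // N.graph.Adj i k ∧ k ≠ j} => f k)
    (Set.finite_range _).bddAbove ⟨k, hk, hj⟩

theorem ExchangeNetwork.le_nbrMax [Finite V] {i k : V} (f : V → ℝ)
    (hk : N.graph.Adj i k) : f k ≤ N.nbrMax i f :=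
  le_ciSup (f := fun k : {k : V // N.graph.Adj i k} => f k)
    (Set.finite_range _).bddAbove ⟨k, hk⟩

theorem ExchangeNetwork.nbrMaxExcept_nonneg {i j : V} {f : V → ℝ}
    (h : ∀ k, N.graph.Adj i k → 0 ≤ f k) : 0 ≤ N.nbrMaxExcept i j f :=
  Real.iSup_nonneg (fun k => h k k.2.1)

theorem ExchangeNetwork.nbrMax_nonneg {i : V} {f : V → ℝ}
    (h : ∀ k, N.graph.Adj i k → 0 ≤ f k) : 0 ≤ N.nbrMax i f :=
  Real.iSup_nonneg (fun k => h k k.2)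

theorem ExchangeNetwork.weight_le_maxWeight [Finite V] {i j : V} (h : N.graph.Adj i j) :
    N.weight s(i, j) ≤ N.maxWeight :=
  le_ciSup (f := fun e : N.graph.edgeSet => N.weight e)
    (Set.finite_range _).bddAbove ⟨s(i, j), h⟩

theorem ExchangeNetwork.slack_comm (γ : V → ℝ) (i j : V) : N.slack γ i j = N.slack γ j i := by
  simp only [ExchangeNetwork.slack, Sym2.eq_swap (a := i)]
  ring

/-- The undamped update of the messages. -/
noncomputable def update (α : V → V → ℝ) (i j : V) : ℝ :=
  N.nbrMaxExcept i j (fun k => offer N α k i)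

theorem step_apply (κ : ℝ) (α : V → V → ℝ) (i j : V) :
    step N κ α i j = κ * update N α i j + (1 - κ) * α i j := rfl

theorem offer_nonneg {α : V → V → ℝ} {i j : V} (h : 0 ≤ α j i) : 0 ≤ offer N α i j := by
  unfold offer
  rcases le_total (N.weight s(i, j) - α i j) 0 with h1 | h1 <;>
  rcases le_total (N.weight s(i, j) - α i j - α j i) 0 with h2 | h2 <;>
  simp only [max_eq_left, max_eq_right, h1, h2] <;> linarith

/-- For a nonnegative message `α j i`, the offer is the smaller of `w - α i j` and `(w - α i j + α j
i) / 2`, cut off at 0. This and the next two lemmas are the parts of this description that the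
analysis uses. -/
theorem offer_le_max_sub (α : V → V → ℝ) (i j : V) :
    offer N α i j ≤ max (N.weight s(i, j) - α i j) 0 := by
  unfold offer
  have := le_max_right (N.weight s(i, j) - α i j - α j i) 0
  linarith

theorem offer_le_max_average {α : V → V → ℝ} (i j : V) :
    offer N α i j ≤ max ((N.weight s(i, j) - α i j + α j i) / 2) 0 := by
  unfold offer
  have h3 := le_max_left ((N.weight s(i, j) - α i j + α j i) / 2) 0
  have h4 := le_max_right ((N.weight s(i, j) - α i j + α j i) / 2) 0
  rcases le_total (N.weight s(i, j) - α i j) 0 with h1 | h1 <;>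
  rcases le_total (N.weight s(i, j) - α i j - α j i) 0 with h2 | h2 <;>
  simp only [max_eq_left, max_eq_right, h1, h2] <;> linarith

theorem le_offer {α : V → V → ℝ} {i j : V} {c : ℝ}
    (h1 : c ≤ N.weight s(i, j) - α i j) (h2 : c ≤ (N.weight s(i, j) - α i j + α j i) / 2) :
    c ≤ offer N α i j := by
  unfold offer
  have h3 := le_max_left (N.weight s(i, j) - α i j) 0
  rcases le_total (N.weight s(i, j) - α i j - α j i) 0 with h2 | h2 <;>
  simp only [max_eq_left, max_eq_right, h2] <;> linarith

theorem update_nonneg {α : V → V → ℝ} (h : ∀ i j, N.graph.Adj i j → 0 ≤ α i j) (i j : V) :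
    0 ≤ update N α i j :=
  N.nbrMaxExcept_nonneg fun k hk => offer_nonneg N (h i k hk)

/-- The offer is piecewise linear in the two messages. On every piece the absolute slopes are 0, 0
or 1, 0 or 1/2, 1/2, so they add up to at most 1 and the map is nonexpansive in the sup norm. -/
theorem offer_sub_le {α β : V → V → ℝ} {i j : V} {d : ℝ} (h1 : |α i j - β i j| ≤ d)
    (h2 : |α j i - β j i| ≤ d) : offer N α i j - offer N β i j ≤ d := by
  rw [abs_le] at h1 h2
  unfold offer
  rcases le_total (N.weight s(i, j) - α i j) 0 with h3 | h3 <;>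
  rcases le_total (N.weight s(i, j) - α i j - α j i) 0 with h4 | h4 <;>
  rcases le_total (N.weight s(i, j) - β i j) 0 with h5 | h5 <;>
  rcases le_total (N.weight s(i, j) - β i j - β j i) 0 with h6 | h6 <;>
  simp only [max_eq_left, max_eq_right, h3, h4, h5, h6] <;> linarith

/-- A maximum of nonexpansive functions is nonexpansive. Nonnegative messages ensure that the bound
is compatible with the value 0 of an empty maximum. -/
theorem update_sub_le [Finite V] {α β : V → V → ℝ} {d : ℝ}
    (hβ : ∀ i j, N.graph.Adj i j → 0 ≤ β i j) (hd : 0 ≤ d)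
    (h : ∀ i j, N.graph.Adj i j → |α i j - β i j| ≤ d) (i j : V) :
    update N α i j - update N β i j ≤ d := by
  rw [sub_le_iff_le_add]
  refine N.nbrMaxExcept_le (add_nonneg hd (update_nonneg N hβ i j)) fun k hk hkj => ?_
  have h1 := offer_sub_le N (h k i hk.symm) (h i k hk)
  have h2 := N.le_nbrMaxExcept (fun k => offer N β k i) hk hkj
  unfold update
  linarith

theorem abs_update_sub_le [Finite V] {α β : V → V → ℝ} {d : ℝ}
    (hα : ∀ i j, N.graph.Adj i j → 0 ≤ α i j)
    (hβ : ∀ i j, N.graph.Adj i j → 0 ≤ β i j) (hd : 0 ≤ d)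
    (h : ∀ i j, N.graph.Adj i j → |α i j - β i j| ≤ d) (i j : V) :
    |update N α i j - update N β i j| ≤ d := by
  rw [abs_sub_le_iff]
  exact ⟨update_sub_le N hβ hd h i j,
    update_sub_le N hα hd (fun i j hij => by rw [abs_sub_comm]; exact h i j hij) i j⟩

theorem messages_nonneg {κ : ℝ} (hκ0 : 0 < κ) (hκ1 : κ < 1) {α₀ : V → V → ℝ}
    (h : ∀ i j, N.graph.Adj i j → 0 ≤ α₀ i j) (t : ℕ) :
    ∀ i j, N.graph.Adj i j → 0 ≤ messages N κ α₀ t i j := by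
  induction t with
  | zero => exact h
  | succ t ih =>
    intro i j hij
    rw [messages, step_apply]
    have h1 := update_nonneg N ih i j
    have h2 := ih i j hij
    have h3 : 0 ≤ 1 - κ := by linarith
    positivity

end Operators

/-! ### Levels, target messages, and one update in terms of errors. -/

/-- The data that the analysis extracts from a Kleinberg-Tardos sequence with gap `σ`: every node `i`
has a level `lev i`, which is `0` for the unmatched nodes, and level `q` has slack `τ q`. -/
structure Layering {V : Type*} (N : ExchangeNetwork V) (M : N.graph.Subgraph) (γ : V → ℝ) (σ : ℝ)
    (lev : V → ℕ) (τ : ℕ → ℝ) : Prop where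
  sigma_pos : 0 < σ
  matching : M.IsMatching
  lev_eq_zero : ∀ i, lev i = 0 ↔ i ∉ M.verts
  lev_partner : ∀ i j, M.Adj i j → lev i = lev j
  gamma_zero : ∀ i, lev i = 0 → γ i = 0
  traded : ∀ i j, M.Adj i j → γ i + γ j = N.weight s(i, j)
  le_gamma : ∀ i, lev i ≠ 0 → τ (lev i) ≤ γ i
  sigma_le : ∀ i, lev i ≠ 0 → σ ≤ τ (lev i)
  lev_ne_zero : ∀ i j, N.graph.Adj i j → lev i ≠ 0 ∨ lev j ≠ 0
  slack_down : ∀ i k, N.graph.Adj i k → ¬ M.Adj i k → lev i ≠ 0 → lev k ≤ lev i →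
    τ (lev i) ≤ N.slack γ i k
  slack_up : ∀ i k, N.graph.Adj i k → lev i ≠ 0 → lev i < lev k → τ (lev i) + σ ≤ N.slack γ i k
  slack_same : ∀ i k, N.graph.Adj i k → ¬ M.Adj i k → lev i ≠ 0 → lev k = lev i →
    N.slack γ i k = τ (lev i) ∨ τ (lev i) + σ ≤ N.slack γ i k
  support : ∀ i, lev i ≠ 0 → γ i = τ (lev i) ∨
    ∃ k, N.graph.Adj i k ∧ ¬ M.Adj i k ∧ lev k ≤ lev i ∧ N.slack γ i k = τ (lev i)

/-- The unmatched edge `i k` joins nodes of the same level, and its slack is that of the level. -/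
def Tight {V : Type*} (N : ExchangeNetwork V) (M : N.graph.Subgraph) (γ : V → ℝ)
    (lev : V → ℕ) (τ : ℕ → ℝ) (i k : V) : Prop :=
  N.graph.Adj i k ∧ ¬ M.Adj i k ∧ lev k = lev i ∧ N.slack γ i k = τ (lev i)

/-- The best alternative of `i` is realized outside of its level. -/
def Exit {V : Type*} (N : ExchangeNetwork V) (M : N.graph.Subgraph) (γ : V → ℝ)
    (lev : V → ℕ) (τ : ℕ → ℝ) (i : V) : Prop :=
  γ i = τ (lev i) ∨
    ∃ k, N.graph.Adj i k ∧ ¬ M.Adj i k ∧ lev k < lev i ∧ N.slack γ i k = τ (lev i)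

open Classical in
/-- The messages of the solution `(M, γ)`. -/
noncomputable def target {V : Type*} (N : ExchangeNetwork V) (M : N.graph.Subgraph) (γ : V → ℝ)
    (lev : V → ℕ) (τ : ℕ → ℝ) (i j : V) : ℝ :=
  if M.Adj i j then γ i - τ (lev i) else γ i

/-- The errors of the messages `α`. -/
noncomputable def err {V : Type*} (N : ExchangeNetwork V) (M : N.graph.Subgraph) (γ : V → ℝ)
    (lev : V → ℕ) (τ : ℕ → ℝ) (α : V → V → ℝ) (i j : V) : ℝ :=
  α i j - target N M γ lev τ i j

section

variable {V : Type*} {N : ExchangeNetwork V} {M : N.graph.Subgraph} {γ : V → ℝ} {σ : ℝ}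
  {lev : V → ℕ} {τ : ℕ → ℝ}

theorem target_of_adj {i j : V} (h : M.Adj i j) : target N M γ lev τ i j = γ i - τ (lev i) :=
  if_pos h

theorem target_of_not_adj {i j : V} (h : ¬ M.Adj i j) : target N M γ lev τ i j = γ i :=
  if_neg h

theorem eq_err_add (α : V → V → ℝ) (i j : V) :
    α i j = err N M γ lev τ α i j + target N M γ lev τ i j := by
  unfold err; ring

theorem weight_eq_slack (N : ExchangeNetwork V) (γ : V → ℝ) (i j : V) :
    N.weight s(i, j) = γ i + γ j - N.slack γ i j := by
  unfold ExchangeNetwork.slack; ring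

/-- The target along an unmatched edge is the full `γ k`, so `w - α k i` is `γ i` minus the slack
minus the error. -/
theorem offer_other_le (α : V → V → ℝ) {i k : V} (h : ¬ M.Adj i k) :
    offer N α k i ≤ max (γ i - N.slack γ i k - err N M γ lev τ α k i) 0 := by
  refine (offer_le_max_sub N α k i).trans_eq ?_
  congr 1
  have e1 := eq_err_add (N := N) (M := M) (γ := γ) (lev := lev) (τ := τ) α k i
  rw [target_of_not_adj (fun h' => h h'.symm)] at e1
  have e2 := weight_eq_slack N γ k i
  rw [N.slack_comm γ i k]
  linarith

theorem le_offer_other {α : V → V → ℝ} {i k : V} {c : ℝ} (h : ¬ M.Adj i k)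
    (h1 : c ≤ - err N M γ lev τ α k i)
    (h2 : c ≤ (N.slack γ i k + err N M γ lev τ α i k - err N M γ lev τ α k i) / 2) :
    γ i - N.slack γ i k + c ≤ offer N α k i := by
  have e1 := eq_err_add (N := N) (M := M) (γ := γ) (lev := lev) (τ := τ) α k i
  have e3 := eq_err_add (N := N) (M := M) (γ := γ) (lev := lev) (τ := τ) α i k
  rw [target_of_not_adj (fun h' => h h'.symm)] at e1
  rw [target_of_not_adj h] at e3
  have e2 := weight_eq_slack N γ k i
  rw [N.slack_comm γ k i] at e2
  apply le_offer <;> linarith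

/-- An edge whose slack is that of the level realizes the best alternative of `i`, and this single
offer bounds the maximum from below. -/
theorem le_update_adj [Finite V] {α : V → V → ℝ} {i p k : V} {c : ℝ} (h : M.Adj i p)
    (hk : N.graph.Adj i k) (hk' : ¬ M.Adj i k) (hs : N.slack γ i k = τ (lev i))
    (h1 : c ≤ - err N M γ lev τ α k i)
    (h2 : c ≤ (τ (lev i) + err N M γ lev τ α i k - err N M γ lev τ α k i) / 2) :
    c ≤ update N α i p - target N M γ lev τ i p := by
  have h3 := le_offer_other hk' h1 (by rw [hs]; exact h2)
  have h4 := N.le_nbrMaxExcept (fun k => offer N α k i) hk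
    (show k ≠ p by rintro rfl; exact hk' h)
  rw [target_of_adj h]
  unfold update
  linarith

namespace Layering

variable (L : Layering N M γ σ lev τ)
include L

theorem partner_unique {i j k : V} (h : M.Adj i j) (h' : M.Adj i k) : j = k :=
  L.matching.eq_of_adj_left h h'

theorem exists_partner {i : V} (h : lev i ≠ 0) : ∃ j, M.Adj i j := by
  have h1 : i ∈ M.verts := by
    by_contra h2
    exact h ((L.lev_eq_zero i).2 h2)
  obtain ⟨j, hj, -⟩ := L.matching h1
  exact ⟨j, hj⟩

theorem lev_ne_zero_of_adj {i j : V} (h : M.Adj i j) : lev i ≠ 0 := fun h0 =>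
  (L.lev_eq_zero i).1 h0 (M.edge_vert h)

theorem not_adj_of_ne {i j k : V} (h : M.Adj i j) (hk : k ≠ j) : ¬ M.Adj i k :=
  fun h' => hk (L.partner_unique h' h)

theorem sigma_le_slack {i k : V} (h : N.graph.Adj i k) (h' : ¬ M.Adj i k) :
    σ ≤ N.slack γ i k := by
  have hs := L.sigma_pos
  by_cases h0 : lev i = 0
  · have hk : lev k ≠ 0 := (L.lev_ne_zero i k h).resolve_left (not_not.2 h0)
    rw [N.slack_comm]
    exact (L.sigma_le k hk).trans
      (L.slack_down k i h.symm (fun h2 => h' h2.symm) hk (by omega))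
  · have h1 := L.sigma_le i h0
    rcases le_or_gt (lev k) (lev i) with h2 | h2
    · exact h1.trans (L.slack_down i k h h' h0 h2)
    · linarith [L.slack_up i k h h0 h2]

theorem gamma_nonneg (i : V) : 0 ≤ γ i := by
  by_cases h0 : lev i = 0
  · exact (L.gamma_zero i h0).ge
  · linarith [L.sigma_le i h0, L.le_gamma i h0, L.sigma_pos]

theorem gamma_le_weight {i j : V} (h : M.Adj i j) : γ i ≤ N.weight s(i, j) := by
  rw [← L.traded i j h]
  linarith [L.gamma_nonneg j]

theorem target_nonneg (i j : V) : 0 ≤ target N M γ lev τ i j := by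
  by_cases h : M.Adj i j
  · rw [target_of_adj h]
    linarith [L.le_gamma i (L.lev_ne_zero_of_adj h)]
  · rw [target_of_not_adj h]
    exact L.gamma_nonneg i

theorem gamma_le_maxWeight [Finite V] (i : V) (hW : 0 ≤ N.maxWeight) : γ i ≤ N.maxWeight := by
  by_cases h0 : lev i = 0
  · rwa [L.gamma_zero i h0]
  · obtain ⟨j, hj⟩ := L.exists_partner h0
    exact (L.gamma_le_weight hj).trans (N.weight_le_maxWeight (M.adj_sub hj))

theorem target_le_maxWeight [Finite V] (i j : V) (hW : 0 ≤ N.maxWeight) :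
    target N M γ lev τ i j ≤ N.maxWeight := by
  have h2 := L.gamma_le_maxWeight i hW
  by_cases h : M.Adj i j
  · rw [target_of_adj h]
    linarith [L.sigma_le i (L.lev_ne_zero_of_adj h), L.sigma_pos]
  · rwa [target_of_not_adj h]

/-- Both ends of a matched edge earn at least the slack of their level, hence at least `σ`. The
bound later absorbs the rounding of the number of sweeps. -/
theorem two_sigma_le_maxWeight [Finite V] {i j : V} (h : N.graph.Adj i j) :
    2 * σ ≤ N.maxWeight := by
  have key : ∀ i, lev i ≠ 0 → 2 * σ ≤ N.maxWeight := by
    intro i h0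
    obtain ⟨j, hj⟩ := L.exists_partner h0
    have h1 := L.traded i j hj
    have h2 := N.weight_le_maxWeight (M.adj_sub hj)
    have h3 := L.lev_ne_zero_of_adj hj.symm
    linarith [L.le_gamma i h0, L.le_gamma j h3, L.sigma_le i h0, L.sigma_le j h3]
  rcases L.lev_ne_zero i j h with h0 | h0
  · exact key _ h0
  · exact key _ h0

/-! Offers in terms of errors. -/

/-- Partners have the same level, so the same `τ` is subtracted from both targets and cancels in the
average. -/
theorem offer_partner_le (α : V → V → ℝ) {i p : V} (h : M.Adj i p) :
    offer N α p i ≤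
      max (γ i + (err N M γ lev τ α i p - err N M γ lev τ α p i) / 2) 0 := by
  refine (offer_le_max_average N p i).trans_eq ?_
  congr 1
  rw [eq_err_add (N := N) (M := M) (γ := γ) (lev := lev) (τ := τ) α p i,
    eq_err_add (N := N) (M := M) (γ := γ) (lev := lev) (τ := τ) α i p, target_of_adj h,
    target_of_adj h.symm, ← L.traded p i h.symm, L.lev_partner i p h]
  ring

theorem le_offer_partner {α : V → V → ℝ} {i p : V} {c : ℝ} (h : M.Adj i p)
    (h1 : c ≤ (err N M γ lev τ α i p - err N M γ lev τ α p i) / 2)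
    (h2 : c ≤ τ (lev i) - err N M γ lev τ α p i) :
    γ i + c ≤ offer N α p i := by
  have e1 := eq_err_add (N := N) (M := M) (γ := γ) (lev := lev) (τ := τ) α p i
  have e2 := eq_err_add (N := N) (M := M) (γ := γ) (lev := lev) (τ := τ) α i p
  rw [target_of_adj h.symm] at e1
  rw [target_of_adj h] at e2
  have e3 := L.traded p i h.symm
  have e4 := L.lev_partner i p h
  rw [← e4] at e1
  apply le_offer <;> linarith

/-! One undamped update, in terms of errors. -/

/-- `h0` covers the value 0 of truncated offers and of an empty maximum. The partner's own offer
does not enter, since the maximum omits its recipient. -/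
theorem update_adj_le {α : V → V → ℝ} {i p : V} {C : ℝ} (h : M.Adj i p)
    (h0 : - (γ i - τ (lev i)) ≤ C)
    (h1 : ∀ k, N.graph.Adj i k → ¬ M.Adj i k →
      τ (lev i) - N.slack γ i k - err N M γ lev τ α k i ≤ C) :
    update N α i p - target N M γ lev τ i p ≤ C := by
  rw [target_of_adj h, sub_le_iff_le_add]
  refine N.nbrMaxExcept_le (by linarith) fun k hk hkp => ?_
  have hk' := L.not_adj_of_ne h hkp
  refine (offer_other_le (γ := γ) (lev := lev) (τ := τ) α hk').trans (max_le ?_ (by linarith))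
  linarith [h1 k hk hk']

theorem update_not_adj_le {α : V → V → ℝ} {i p j : V} {C : ℝ} (h : M.Adj i p)
    (hj : ¬ M.Adj i j) (h0 : - γ i ≤ C)
    (h1 : (err N M γ lev τ α i p - err N M γ lev τ α p i) / 2 ≤ C)
    (h2 : ∀ k, N.graph.Adj i k → ¬ M.Adj i k →
      - N.slack γ i k - err N M γ lev τ α k i ≤ C) :
    update N α i j - target N M γ lev τ i j ≤ C := by
  rw [target_of_not_adj hj, sub_le_iff_le_add]
  refine N.nbrMaxExcept_le (by linarith) fun k hk _ => ?_
  by_cases hk' : M.Adj i k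
  · obtain rfl := L.partner_unique h hk'
    exact (L.offer_partner_le α h).trans (max_le (by linarith) (by linarith))
  · refine (offer_other_le (γ := γ) (lev := lev) (τ := τ) α hk').trans (max_le ?_ (by linarith))
    linarith [h2 k hk hk']

theorem le_update_not_adj [Finite V] {α : V → V → ℝ} {i p j : V} {c : ℝ} (h : M.Adj i p)
    (hj : ¬ M.Adj i j)
    (h1 : c ≤ (err N M γ lev τ α i p - err N M γ lev τ α p i) / 2)
    (h2 : c ≤ τ (lev i) - err N M γ lev τ α p i) :
    c ≤ update N α i j - target N M γ lev τ i j := by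
  have h3 := L.le_offer_partner h h1 h2
  have h4 := N.le_nbrMaxExcept (fun k => offer N α k i) (M.adj_sub h)
    (show p ≠ j by rintro rfl; exact hj h)
  rw [target_of_not_adj hj]
  unfold update
  linarith

theorem update_zero_le {α : V → V → ℝ} {i j : V} {C : ℝ} (h : lev i = 0) (h0 : 0 ≤ C)
    (h2 : ∀ k, N.graph.Adj i k → - N.slack γ i k - err N M γ lev τ α k i ≤ C) :
    update N α i j - target N M γ lev τ i j ≤ C := by
  have hM : ∀ k, ¬ M.Adj i k := fun k hk => L.lev_ne_zero_of_adj hk h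
  rw [target_of_not_adj (hM j), sub_le_iff_le_add, L.gamma_zero i h]
  refine N.nbrMaxExcept_le (by linarith) fun k hk _ => ?_
  refine (offer_other_le (γ := γ) (lev := lev) (τ := τ) α (hM k)).trans (max_le ?_ (by linarith))
  linarith [h2 k hk, L.gamma_zero i h]

theorem target_zero {i j : V} (h : lev i = 0) : target N M γ lev τ i j = 0 := by
  rw [target_of_not_adj (fun hk => L.lev_ne_zero_of_adj hk h), L.gamma_zero i h]

end Layering

end

/-! ### Mixing of an averaging chain with reflecting ends. -/

/-- The involution of `{0, …, n - 1}` that exchanges the neighbours `y, y + 1` with `y + e` even, and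
fixes the ends that remain. -/
def pairing (e n y : ℕ) : ℕ :=
  -- For `y = 0` and `e` odd, truncated subtraction makes 0 a fixed point.
  if (y + e) % 2 = 0 then (if y + 1 < n then y + 1 else y) else y - 1

theorem pairing_lt {e n y : ℕ} (h : y < n) : pairing e n y < n := by
  unfold pairing; split_ifs <;> omega

theorem pairing_pairing {e n y : ℕ} (h : y < n) : pairing e n (pairing e n y) = y := by
  unfold pairing; split_ifs <;> omega

/-- Reindexing by an involution. It is behind both the conservation of mass and the decrease of
energy. -/
theorem sum_pairing (e n : ℕ) (f : ℕ → ℝ) :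
    ∑ y ∈ Finset.range n, f (pairing e n y) = ∑ y ∈ Finset.range n, f y := by
  refine Finset.sum_nbij' (pairing e n) (pairing e n) ?_ ?_ ?_ ?_ ?_ <;>
  simp +contextual [pairing_lt, pairing_pairing]

/-- The averaging operator of the chain with `n` sites. The two components of a state are the values
of the messages along matched and along unmatched edges. -/
noncomputable def chainOp (e n : ℕ) (p : (ℕ → ℝ) × (ℕ → ℝ)) : (ℕ → ℝ) × (ℕ → ℝ) :=
  (fun y => p.2 (pairing (e + 1) n y), fun y => (p.1 y + p.1 (pairing e n y)) / 2)

/-- The damped averaging operator of the chain. -/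
noncomputable def chainStep (κ : ℝ) (e n : ℕ) (p : (ℕ → ℝ) × (ℕ → ℝ)) : (ℕ → ℝ) × (ℕ → ℝ) :=
  (fun y => κ * (chainOp e n p).1 y + (1 - κ) * p.1 y,
    fun y => κ * (chainOp e n p).2 y + (1 - κ) * p.2 y)

/-- The damped chain started with a unit mass at the end. -/
noncomputable def chain (κ : ℝ) (e n : ℕ) : ℕ → (ℕ → ℝ) × (ℕ → ℝ)
  | 0 => (fun _ => 0, fun y => if y = 0 then 1 else 0)
  | t + 1 => chainStep κ e n (chain κ e n t)

/-- The squared norm of a state. -/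
def chainEnergy (n : ℕ) (p : (ℕ → ℝ) × (ℕ → ℝ)) : ℝ :=
  ∑ y ∈ Finset.range n, (p.1 y ^ 2 + p.2 y ^ 2)

/-- The defect `p - Q p` of a state, where `Q` is the averaging operator. -/
noncomputable def chainDefect (e n : ℕ) (p : (ℕ → ℝ) × (ℕ → ℝ)) : (ℕ → ℝ) × (ℕ → ℝ) :=
  (fun y => p.1 y - (chainOp e n p).1 y, fun y => p.2 y - (chainOp e n p).2 y)

theorem chainEnergy_nonneg (n : ℕ) (p : (ℕ → ℝ) × (ℕ → ℝ)) : 0 ≤ chainEnergy n p :=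
  Finset.sum_nonneg fun _ _ => by positivity

/-- One component of the image is a permutation of the other component of the state; the second is
the mean of the identity and a permutation, to which the convexity of the square applies. -/
theorem chainEnergy_op_le (e n : ℕ) (p : (ℕ → ℝ) × (ℕ → ℝ)) :
    chainEnergy n (chainOp e n p) ≤ chainEnergy n p := by
  have h1 := sum_pairing (e + 1) n (fun y => p.2 y ^ 2)
  have h2 := sum_pairing e n (fun y => p.1 y ^ 2)
  have h3 : ∑ y ∈ Finset.range n, ((p.1 y + p.1 (pairing e n y)) / 2) ^ 2 ≤
      ∑ y ∈ Finset.range n, (p.1 y ^ 2 / 2 + p.1 (pairing e n y) ^ 2 / 2) :=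
    Finset.sum_le_sum fun y _ => by nlinarith [sq_nonneg (p.1 y - p.1 (pairing e n y))]
  rw [Finset.sum_add_distrib, ← Finset.sum_div, ← Finset.sum_div, h2] at h3
  simp only [chainEnergy, chainOp, Finset.sum_add_distrib]
  rw [h1]
  linarith

/-- This is ‖κu + (1-κ)v‖² = κ‖u‖² + (1-κ)‖v‖² - κ(1-κ)‖u-v‖². Damping makes the energy drop in
proportion to the energy of the defect. -/
theorem chainEnergy_step (κ : ℝ) (e n : ℕ) (p : (ℕ → ℝ) × (ℕ → ℝ)) :
    chainEnergy n (chainStep κ e n p) = κ * chainEnergy n (chainOp e n p) +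
      (1 - κ) * chainEnergy n p - κ * (1 - κ) * chainEnergy n (chainDefect e n p) := by
  simp only [chainEnergy, Finset.mul_sum, ← Finset.sum_add_distrib, ← Finset.sum_sub_distrib]
  refine Finset.sum_congr rfl fun y _ => ?_
  simp only [chainStep, chainDefect]
  ring

theorem chainEnergy_step_le {κ : ℝ} (h0 : 0 ≤ κ) (e n : ℕ)
    (p : (ℕ → ℝ) × (ℕ → ℝ)) :
    chainEnergy n (chainStep κ e n p) ≤
      chainEnergy n p - κ * (1 - κ) * chainEnergy n (chainDefect e n p) := by
  rw [chainEnergy_step]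
  nlinarith [mul_le_mul_of_nonneg_left (chainEnergy_op_le e n p) h0]

/-- The defect and the step are polynomials in the same linear operator, so they commute; the defect
thus runs through the same chain, and its energy decreases as well. -/
theorem chainDefect_step (κ : ℝ) (e n : ℕ) (p : (ℕ → ℝ) × (ℕ → ℝ)) :
    chainDefect e n (chainStep κ e n p) = chainStep κ e n (chainDefect e n p) := by
  simp only [chainDefect, chainStep, chainOp]
  ext y <;> simp only <;> ring

/-- Every step costs at least `κ (1 - κ)` times the energy of the current defect, and these costs
never increase. So `T` times the last of them is at most the initial energy, which is at most 1. -/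
theorem chain_defect_le {κ : ℝ} (h0 : 0 ≤ κ) (h1 : κ ≤ 1) (e n T : ℕ) :
    T * (κ * (1 - κ)) * chainEnergy n (chainDefect e n (chain κ e n T)) ≤ 1 := by
  have h2 : 0 ≤ κ * (1 - κ) := mul_nonneg h0 (by linarith)
  have anti : ∀ t, chainEnergy n (chainDefect e n (chain κ e n (t + 1))) ≤
      chainEnergy n (chainDefect e n (chain κ e n t)) := fun t => by
    rw [chain, chainDefect_step]
    have := chainEnergy_step_le h0 e n (chainDefect e n (chain κ e n t))
    nlinarith [mul_nonneg h2 (chainEnergy_nonneg n (chainDefect e n (chainDefect e n (chain κ e n t))))]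
  have key : ∀ T : ℕ, T * (κ * (1 - κ)) * chainEnergy n (chainDefect e n (chain κ e n T)) +
      chainEnergy n (chain κ e n T) ≤ 1 := by
    intro T
    induction T with
    | zero =>
      simp only [chainEnergy, chain]
      have : ∀ y ∈ Finset.range n, ((0:ℝ) ^ 2 + (if y = 0 then (1:ℝ) else 0) ^ 2) =
        if y = 0 then 1 else 0 := fun y _ => by split_ifs <;> norm_num
      rw [Finset.sum_congr rfl this, Finset.sum_ite_eq']
      split_ifs <;> simp
    | succ t ih =>
      have h3 := chainEnergy_step_le h0 e n (chain κ e n t)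
      have h4 := mul_le_mul_of_nonneg_left (anti t) (mul_nonneg (Nat.cast_nonneg (t + 1)) h2)
      push_cast at h4 ⊢
      rw [chain] at h4 ⊢
      linarith
  have := chainEnergy_nonneg n (chain κ e n T)
  linarith [key T]

theorem chain_mem_Icc {κ : ℝ} (h0 : 0 ≤ κ) (h1 : κ ≤ 1) (e n t : ℕ) (y : ℕ) :
    (0 ≤ (chain κ e n t).1 y ∧ (chain κ e n t).1 y ≤ 1) ∧
      0 ≤ (chain κ e n t).2 y ∧ (chain κ e n t).2 y ≤ 1 := by
  induction t generalizing y with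
  | zero => simp only [chain]; split_ifs <;> norm_num
  | succ t ih =>
    have h2 : 0 ≤ 1 - κ := by linarith
    simp only [chain, chainStep, chainOp]
    obtain ⟨⟨a1, a2⟩, b1, b2⟩ := ih y
    obtain ⟨⟨c1, c2⟩, -⟩ := ih (pairing e n y)
    obtain ⟨-, d1, d2⟩ := ih (pairing (e + 1) n y)
    refine ⟨⟨by positivity, ?_⟩, by positivity, ?_⟩
    · nlinarith
    · nlinarith

theorem chain_sum {κ : ℝ} {e n : ℕ} (hn : 0 < n) (t : ℕ) :
    ∑ y ∈ Finset.range n, ((chain κ e n t).1 y + (chain κ e n t).2 y) = 1 := by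
  induction t with
  | zero => simp [chain, Finset.sum_ite_eq', hn]
  | succ t ih =>
    have h1 := sum_pairing (e + 1) n (chain κ e n t).2
    have h2 := sum_pairing e n (chain κ e n t).1
    rw [Finset.sum_add_distrib] at ih
    simp only [chain, chainStep, chainOp, Finset.sum_add_distrib, ← Finset.mul_sum,
      ← Finset.sum_div, h1, h2]
    linear_combination ih

/-- A state with small defect is nearly constant. Links of the pairing `e` join sites with the same
average of the first component. For the other links, the jumps of the second component across
successive links nearly cancel in pairs, because its value is nearly the mean of two values one link
further out; this is followed down to the left end, where the reflection makes the jump vanish. -/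
theorem abs_sub_succ_le_of_defect {e n : ℕ} (he : e ≤ 1) (p : (ℕ → ℝ) × (ℕ → ℝ)) {y : ℕ} (hy : y < n) :
    |p.2 (pairing e n y) - p.2 y| ≤ 4 * ∑ z ∈ Finset.range n,
      (|(chainDefect e n p).1 z| + |(chainDefect e n p).2 z|) ∧
    ((y + (e + 1)) % 2 = 0 →
      |p.2 (pairing (e + 1) n y) - p.2 y| ≤ 4 * ∑ z ∈ Finset.range (y + 1),
        (|(chainDefect e n p).1 z| + |(chainDefect e n p).2 z|)) := by
  set r := (chainDefect e n p).1 with hr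
  set s := (chainDefect e n p).2 with hs
  have r_def : ∀ z, p.1 z = p.2 (pairing (e + 1) n z) + r z := fun z => by
    simp only [hr, chainDefect, chainOp]; ring
  have s_def : ∀ z, 2 * p.2 z = p.1 z + p.1 (pairing e n z) + 2 * s z := fun z => by
    simp only [hs, chainDefect, chainOp]; ring
  have matched : ∀ z, z < n → p.2 (pairing e n z) - p.2 z = s (pairing e n z) - s z := by
    intro z hz
    have h1 := s_def z
    have h2 := s_def (pairing e n z)
    rw [pairing_pairing hz] at h2
    linarith
  have nonneg : ∀ z, 0 ≤ |r z| + |s z| := fun z => by positivity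
  constructor
  · rw [matched y hy]
    have h1 := Finset.single_le_sum (f := fun z => |r z| + |s z|) (fun z _ => nonneg z)
      (Finset.mem_range.2 hy)
    have h2 := Finset.single_le_sum (f := fun z => |r z| + |s z|) (fun z _ => nonneg z)
      (Finset.mem_range.2 (pairing_lt (e := e) hy))

    have h3 := abs_sub (s (pairing e n y)) (s y)
    linarith [abs_nonneg (r y), abs_nonneg (r (pairing e n y)), abs_nonneg (s y),
      abs_nonneg (s (pairing e n y))]
  · induction y using Nat.strong_induction_on with
    | _ y ih =>
      intro hpar
      have e1 := r_def y
      have e2 := s_def y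
      have e3 := r_def (pairing e n y)
      rcases Nat.eq_zero_or_pos y with rfl | hpos
      · have hp : pairing e n 0 = 0 := by unfold pairing; split_ifs <;> omega
        rw [hp] at e2 e3
        have : p.2 (pairing (e + 1) n 0) - p.2 0 = - r 0 - s 0 := by linarith
        rw [this, zero_add, Finset.sum_range_one, abs_le]
        constructor <;> linarith [le_abs_self (r 0), le_abs_self (s 0), neg_abs_le (r 0),
          neg_abs_le (s 0), abs_nonneg (r 0), abs_nonneg (s 0)]
      · obtain ⟨x, rfl⟩ : ∃ x, y = x + 1 := ⟨y - 1, by omega⟩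
        have hp : pairing e n (x + 1) = x := by unfold pairing; split_ifs <;> omega
        have hm := matched (x + 1) hy
        rw [hp] at e2 e3 hm
        have bound : |p.2 (pairing (e + 1) n x) - p.2 x| ≤
            4 * ∑ z ∈ Finset.range x, (|r z| + |s z|) := by
          rcases Nat.eq_zero_or_pos x with rfl | hx
          · have : pairing (e + 1) n 0 = 0 := by unfold pairing; split_ifs <;> omega
            simp [this]
          · obtain ⟨w, rfl⟩ : ∃ w, x = w + 1 := ⟨x - 1, by omega⟩
            have h1 : pairing (e + 1) n (w + 1) = w := by unfold pairing; split_ifs <;> omega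
            have h2 : pairing (e + 1) n w = w + 1 := by unfold pairing; split_ifs <;> omega
            have h3 := ih w (by omega) (by omega) (by omega)
            rw [h2] at h3
            rw [h1, abs_sub_comm]
            exact h3
        -- Up to defects, the jump to the right of `x + 1` is minus the jump at `x` under the same
        -- pairing, which `bound` controls.
        have eq : p.2 (pairing (e + 1) n (x + 1)) - p.2 (x + 1) =
            - (p.2 (pairing (e + 1) n x) - p.2 x)
              - (s x - s (x + 1)) - 2 * s (x + 1) - r (x + 1) - r x := by linarith
        rw [eq, Finset.sum_range_succ, Finset.sum_range_succ]
        rw [abs_le] at bound ⊢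
        constructor <;> linarith [le_abs_self (r x), le_abs_self (s x), neg_abs_le (r x),
          neg_abs_le (s x), abs_nonneg (r x), abs_nonneg (s x), le_abs_self (r (x + 1)),
          le_abs_self (s (x + 1)), neg_abs_le (r (x + 1)),
          neg_abs_le (s (x + 1)), abs_nonneg (r (x + 1)), abs_nonneg (s (x + 1)),
          bound.1, bound.2]

theorem abs_sub_le_of_defect {e n : ℕ} (he : e ≤ 1) (p : (ℕ → ℝ) × (ℕ → ℝ)) {x y : ℕ} (hx : x < n)
    (hy : y < n) : |p.2 y - p.2 x| ≤ 4 * n * ∑ z ∈ Finset.range n,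
      (|(chainDefect e n p).1 z| + |(chainDefect e n p).2 z|) := by
  set R := ∑ z ∈ Finset.range n, (|(chainDefect e n p).1 z| + |(chainDefect e n p).2 z|) with hR
  have hR0 : 0 ≤ R := Finset.sum_nonneg fun _ _ => by positivity
  have one : ∀ y, y + 1 < n → |p.2 (y + 1) - p.2 y| ≤ 4 * R := by
    intro y hy
    obtain ⟨h1, h2⟩ := abs_sub_succ_le_of_defect he p (show y < n by omega)
    by_cases hpar : (y + e) % 2 = 0
    · have : pairing e n y = y + 1 := by unfold pairing; split_ifs; rfl
      rw [this] at h1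
      exact h1
    · have hpar' : (y + (e + 1)) % 2 = 0 := by omega
      have : pairing (e + 1) n y = y + 1 := by unfold pairing; split_ifs; rfl
      have h3 := h2 hpar'
      rw [this] at h3
      refine h3.trans (mul_le_mul_of_nonneg_left ?_ (by norm_num))
      exact Finset.sum_le_sum_of_subset_of_nonneg (Finset.range_mono (by omega))
        fun _ _ _ => by positivity
  have many : ∀ d y, y + d < n → |p.2 (y + d) - p.2 y| ≤ 4 * d * R := by
    intro d
    induction d with
    | zero => intro y _; simp
    | succ d ih =>
      intro y hy
      have h1 := ih y (by omega)
      have h2 := one (y + d) (by omega)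
      have h3 := abs_sub_le (p.2 (y + d + 1)) (p.2 (y + d)) (p.2 y)
      push_cast
      rw [← add_assoc]
      linarith
  have wlog : ∀ x y, x ≤ y → y < n → |p.2 y - p.2 x| ≤ 4 * n * R := by
    intro x y hxy hy
    have h1 := many (y - x) x (by omega)
    rw [show x + (y - x) = y by omega] at h1
    refine h1.trans ?_
    have : ((y - x : ℕ) : ℝ) ≤ n := by exact_mod_cast (by omega : y - x ≤ n)
    nlinarith
  rcases le_total x y with h | h
  · exact wlog x y h hy
  · rw [abs_sub_comm]
    exact wlog y x h hx

/-- After order `n ^ 5` steps the mass of the chain is spread out. -/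
theorem chain_lower_bound {κ : ℝ} (h0 : 0 < κ) (h1 : κ < 1) {e n T : ℕ} (he : e ≤ 1) (hn : 0 < n)
    (hT : 1152 * (n : ℝ) ^ 5 ≤ T * (κ * (1 - κ))) {y : ℕ} (hy : y < n) :
    1 / (4 * n) ≤ (chain κ e n T).1 y ∧ 1 / (4 * n) ≤ (chain κ e n T).2 y := by
  set p := chain κ e n T with hp
  set R := ∑ z ∈ Finset.range n, (|(chainDefect e n p).1 z| + |(chainDefect e n p).2 z|) with hR
  have hR0 : 0 ≤ R := Finset.sum_nonneg fun _ _ => by positivity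
  have hn' : (1 : ℝ) ≤ n := by exact_mod_cast hn
  -- Cauchy-Schwarz gives `R ^ 2 ≤ 2 n E` for the energy `E` of the defect, and `1152 n ^ 5 E ≤ 1`;
  -- note that `24 ^ 2 * 2 = 1152`.
  have hsmall : 24 * R * (n : ℝ) ^ 2 ≤ 1 := by
    have h2 := chain_defect_le h0.le h1.le e n T
    rw [← hp] at h2
    have h3 : R ^ 2 ≤ n * (2 * chainEnergy n (chainDefect e n p)) := by
      have := sq_sum_le_card_mul_sum_sq (s := Finset.range n)
        (f := fun z => |(chainDefect e n p).1 z| + |(chainDefect e n p).2 z|)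
      rw [Finset.card_range] at this
      refine this.trans (mul_le_mul_of_nonneg_left ?_ (by linarith))
      rw [chainEnergy, Finset.mul_sum]
      refine Finset.sum_le_sum fun z _ => ?_
      rw [← sq_abs ((chainDefect e n p).1 z), ← sq_abs ((chainDefect e n p).2 z)]
      nlinarith [sq_nonneg (|(chainDefect e n p).1 z| - |(chainDefect e n p).2 z|)]
    set E := chainEnergy n (chainDefect e n p)
    have hE : 0 ≤ E := chainEnergy_nonneg _ _
    have h4 : 1152 * (n : ℝ) ^ 5 * E ≤ 1 :=
      (mul_le_mul_of_nonneg_right hT hE).trans h2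
    have h5 : (24 * R * (n : ℝ) ^ 2) ^ 2 ≤ 1 := by
      calc (24 * R * (n : ℝ) ^ 2) ^ 2 = 576 * (n : ℝ) ^ 4 * R ^ 2 := by ring
        _ ≤ 576 * (n : ℝ) ^ 4 * (n * (2 * E)) := mul_le_mul_of_nonneg_left h3 (by positivity)
        _ = 1152 * (n : ℝ) ^ 5 * E := by ring
        _ ≤ 1 := h4
    exact (sq_le_one_iff₀ (by positivity)).1 h5
  have hb : ∀ x z, x < n → z < n → |p.2 z - p.2 x| ≤ 4 * n * R := fun x z hx hz =>
    abs_sub_le_of_defect he p hx hz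
  have ha : ∀ x, x < n → |p.1 x - p.2 (pairing (e + 1) n x)| ≤ R := by
    intro x hx
    refine le_trans ?_ (Finset.single_le_sum (fun z _ => by positivity) (Finset.mem_range.2 hx))
    exact le_add_of_nonneg_right (abs_nonneg _)
  have hab : ∀ x z, x < n → z < n → |p.1 z - p.2 x| ≤ 4 * n * R + R := by
    intro x z hx hz
    have h2 := ha z hz
    have h3 := hb x _ hx (pairing_lt (e := e + 1) hz)
    have h4 := abs_sub_le (p.1 z) (p.2 (pairing (e + 1) n z)) (p.2 x)
    linarith
  have haa : ∀ x z, x < n → z < n → |p.1 z - p.1 x| ≤ 4 * n * R + 2 * R := by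
    intro x z hx hz
    have h2 := ha x hx
    have h3 := hab _ z (pairing_lt (e := e + 1) hx) hz
    have h4 := abs_sub_le (p.1 z) (p.2 (pairing (e + 1) n x)) (p.1 x)
    rw [abs_sub_comm] at h2
    linarith
  have hsum := chain_sum (κ := κ) (e := e) hn T
  rw [← hp] at hsum
  have hnR : R ≤ n * R := by nlinarith
  -- The `2 n` entries have sum 1, so `1 ≤ 2 n (v + 6 n R)`, and `6 n R ≤ 1 / (4 n)` by `hsmall`.
  have key : ∀ v : ℝ, (∀ z, z < n → p.1 z ≤ v + 6 * n * R ∧ p.2 z ≤ v + 6 * n * R) →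
      1 / (4 * n) ≤ v := by
    intro v hv
    have h2 : ∑ z ∈ Finset.range n, (p.1 z + p.2 z) ≤
        ∑ _z ∈ Finset.range n, 2 * (v + 6 * n * R) :=
      Finset.sum_le_sum fun z hz => by
        have := hv z (Finset.mem_range.1 hz)
        linarith [this.1, this.2]
    rw [hsum, Finset.sum_const, Finset.card_range, nsmul_eq_mul] at h2
    rw [div_le_iff₀ (by positivity)]
    nlinarith
  constructor
  · refine key _ fun z hz => ⟨?_, ?_⟩
    · have := (abs_le.1 (haa y z hy hz)).2
      linarith
    · have := (abs_le.1 (hab z y hz hy)).1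
      linarith
  · refine key _ fun z hz => ⟨?_, ?_⟩
    · have := (abs_le.1 (hab y z hy hz)).2
      linarith
    · have := (abs_le.1 (hb y z hy hz)).2
      nlinarith

/-! ### Signed errors of one level and their comparison with the chain. -/

/-- `x` or `-x`, depending on the mode `m`. -/
def signed (m : Bool) (x : ℝ) : ℝ := if m then x else -x

theorem signed_le_abs (m : Bool) (x : ℝ) : signed m x ≤ |x| := by
  cases m
  · exact neg_le_abs x
  · exact le_abs_self x

theorem abs_le_of_signed {x c : ℝ} (h : ∀ m, signed m x ≤ c) : |x| ≤ c :=
  abs_le.2 ⟨by have := h false; simp only [signed] at this; simp at this; linarith,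
    by simpa [signed] using h true⟩

theorem signed_combination (m : Bool) (κ x y : ℝ) :
    signed m (κ * x + (1 - κ) * y) = κ * signed m x + (1 - κ) * signed m y := by
  cases m <;> simp only [signed] <;> simp <;> ring

section

variable {V : Type*} {N : ExchangeNetwork V} {M : N.graph.Subgraph} {γ : V → ℝ} {σ : ℝ}
  {lev : V → ℕ} {τ : ℕ → ℝ}

local notation "Err" => err N M γ lev τ
local notation "Tgt" => target N M γ lev τ

theorem err_step (κ : ℝ) (α : V → V → ℝ) (i j : V) :
    Err (step N κ α) i j = κ * (update N α i j - Tgt i j) + (1 - κ) * Err α i j := by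
  simp only [err, step_apply]
  ring

/-- The errors of `α` are at most `D`, and at most `B` on the levels below `q`. -/
structure ErrBound (N : ExchangeNetwork V) (M : N.graph.Subgraph) (γ : V → ℝ)
    (σ : ℝ) (lev : V → ℕ) (τ : ℕ → ℝ) (D B : ℝ) (q : ℕ) (α : V → V → ℝ) : Prop where
  nonneg : ∀ i j, N.graph.Adj i j → 0 ≤ α i j
  all : ∀ i j, N.graph.Adj i j → |err N M γ lev τ α i j| ≤ D
  below : ∀ i j, lev i < q → N.graph.Adj i j → |err N M γ lev τ α i j| ≤ B
  bound_nonneg : 0 ≤ B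
  gap_le : D - σ / 2 ≤ B

namespace Layering

variable (L : Layering N M γ σ lev τ) {D B : ℝ} {α : V → V → ℝ}
include L

/-- An upper bound for a maximum has to cope with every offer. Lower levels contribute at most `B`.
Edges to higher levels and non-tight edges in the level lose at least `σ`, which makes up for an
error as large as `D`. Only tight edges remain. -/
theorem signed_update_true_adj {i p : V} {C : ℝ} (h : M.Adj i p)
    (hα : ErrBound N M γ σ lev τ D B (lev i) α) (hBC : B ≤ C)
    (ht : ∀ k, Tight N M γ lev τ i k → - Err α k i ≤ C) :
    update N α i p - Tgt i p ≤ C := by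
  have h0 := L.lev_ne_zero_of_adj h
  have hσ := L.sigma_pos
  have := L.le_gamma i h0
  have hB := hα.bound_nonneg
  have hg := hα.gap_le
  refine L.update_adj_le h (by linarith) fun k hk hk' => ?_
  have hD := neg_le_of_abs_le (hα.all k i hk.symm)
  rcases lt_trichotomy (lev k) (lev i) with h1 | h1 | h1
  · have h2 := L.slack_down i k hk hk' h0 h1.le
    have h3 := neg_le_of_abs_le (hα.below k i h1 hk.symm)
    linarith
  · rcases L.slack_same i k hk hk' h0 h1 with h2 | h2
    · have := ht k ⟨hk, hk', h1, h2⟩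
      linarith
    · linarith
  · have h2 := L.slack_up i k hk h0 h1
    linarith

/-- An exit keeps the message from falling. Either its target is 0, and updates are nonnegative, or
a neighbour on a lower level, with error at most `B`, realizes the best alternative. -/
theorem signed_update_exit [Finite V] {i p : V} (h : M.Adj i p)
    (hα : ErrBound N M γ σ lev τ D B (lev i) α) (he : Exit N M γ lev τ i) :
    - (update N α i p - Tgt i p) ≤ B := by
  have h0 := L.lev_ne_zero_of_adj h
  have hσ := L.sigma_pos
  have hB := hα.bound_nonneg
  have hg := hα.gap_le
  rcases he with he | ⟨k, hk, hk', hl, hs⟩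
  · rw [target_of_adj h, he]
    linarith [update_nonneg N hα.nonneg i p]
  · have h1 := le_of_abs_le (hα.below k i hl hk.symm)
    have h2 := neg_le_of_abs_le (hα.all i k hk)
    have h3 := L.sigma_le i h0
    have := le_update_adj (α := α) (c := - B) h hk hk' hs (by linarith) (by linarith)
    linarith

/-- A lower bound for a maximum needs one offer only, so a single tight neighbour suffices. -/
theorem signed_update_false_adj [Finite V] {i p k : V} {C : ℝ} (h : M.Adj i p)
    (hα : ErrBound N M γ σ lev τ D B (lev i) α) (hBC : B ≤ C)
    (ht : Tight N M γ lev τ i k) (hk : Err α k i ≤ C) :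
    - (update N α i p - Tgt i p) ≤ C := by
  have h0 := L.lev_ne_zero_of_adj h
  have hσ := L.sigma_pos
  have hB := hα.bound_nonneg
  have hg := hα.gap_le
  obtain ⟨hk1, hk2, hl, hs⟩ := ht
  have h2 := neg_le_of_abs_le (hα.all i k hk1)
  have h3 := L.sigma_le i h0
  have := le_update_adj (α := α) (c := - C) h hk1 hk2 hs (by linarith) (by linarith)
  linarith

/-- Half the difference of the two errors on the matched edge is the mean of their signed values in
opposite modes. The offers on unmatched edges are too low by `σ` to matter for the upper bound. -/
theorem signed_update_not_adj [Finite V] {i p j : V} {C : ℝ} (m : Bool) (h : M.Adj i p)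
    (hj : ¬ M.Adj i j) (hα : ErrBound N M γ σ lev τ D B (lev i) α) (hBC : B ≤ C)
    (hC : (signed m (Err α i p) + signed (!m) (Err α p i)) / 2 ≤ C) :
    signed m (update N α i j - Tgt i j) ≤ C := by
  have h0 := L.lev_ne_zero_of_adj h
  have hσ := L.sigma_pos
  have hB := hα.bound_nonneg
  have hg := hα.gap_le
  have h3 := L.sigma_le i h0
  cases m
  · simp only [signed] at hC ⊢
    simp only [Bool.not_false, if_true, Bool.false_eq_true, if_false] at hC ⊢
    have h4 := le_of_abs_le (hα.all p i (M.adj_sub h).symm)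
    have := L.le_update_not_adj (α := α) (c := - C) h hj (by linarith) (by linarith)
    linarith
  · simp only [signed] at hC ⊢
    simp only [Bool.not_true, if_true, Bool.false_eq_true, if_false] at hC ⊢
    refine L.update_not_adj_le h hj ?_ (by linarith) fun k hk hk' => ?_
    · linarith [L.gamma_nonneg i]
    · have h1 := neg_le_of_abs_le (hα.all k i hk.symm)
      have h2 := L.sigma_le_slack hk hk'
      linarith

theorem abs_update_zero {i j : V} (h : lev i = 0) (hα : ErrBound N M γ σ lev τ D B 0 α) :
    |update N α i j - Tgt i j| ≤ B := by
  have hσ := L.sigma_pos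
  have hB := hα.bound_nonneg
  have hg := hα.gap_le
  rw [abs_le]
  constructor
  · rw [L.target_zero h]
    linarith [update_nonneg N hα.nonneg i j]
  · refine L.update_zero_le h hB fun k hk => ?_
    have h1 := neg_le_of_abs_le (hα.all k i hk.symm)
    have h2 := L.sigma_le_slack hk (fun hM => L.lev_ne_zero_of_adj hM h)
    linarith

/-- A bound for the errors of a level persists. -/
theorem abs_update_level [Finite V] {i j : V} {C : ℝ} (h0 : lev i ≠ 0)
    (hα : ErrBound N M γ σ lev τ D B (lev i) α) (hBC : B ≤ C)
    (hC : ∀ k l, lev k = lev i → N.graph.Adj k l → |Err α k l| ≤ C) :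
    |update N α i j - Tgt i j| ≤ C := by
  refine abs_le_of_signed fun m => ?_
  obtain ⟨p, hp⟩ := L.exists_partner h0
  have hlp := L.lev_partner i p hp
  by_cases hj : M.Adj i j
  · cases m
    · simp only [signed, Bool.false_eq_true, if_false]
      rcases L.support i h0 with h1 | ⟨k, hk, hk', hl, hs⟩
      · exact (L.signed_update_exit hj hα (Or.inl h1)).trans hBC
      · rcases hl.lt_or_eq with hl | hl
        · exact (L.signed_update_exit hj hα (Or.inr ⟨k, hk, hk', hl, hs⟩)).trans hBC
        · exact L.signed_update_false_adj hj hα hBC ⟨hk, hk', hl, hs⟩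
            (le_of_abs_le (hC k i hl hk.symm))
    · simp only [signed, if_true]
      refine L.signed_update_true_adj hj hα hBC fun k hk => ?_
      exact neg_le.1 (neg_le_of_abs_le (hC k i hk.2.2.1 hk.1.symm))
  · refine L.signed_update_not_adj m hp hj hα hBC ?_
    have h1 := (signed_le_abs m _).trans (hC i p rfl (M.adj_sub hp))
    have h2 := (signed_le_abs (!m) _).trans (hC p i hlp.symm (M.adj_sub hp).symm)
    linarith

/-- The case `B = D`, in which the levels play no role: a uniform bound never grows. -/
theorem abs_update_all [Finite V] (hα : ∀ i j, N.graph.Adj i j → 0 ≤ α i j)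
    (hD0 : 0 ≤ D) (hD : ∀ i j, N.graph.Adj i j → |Err α i j| ≤ D) (i j : V) :
    |update N α i j - Tgt i j| ≤ D := by
  have hσ := L.sigma_pos
  have hα' : ∀ q, ErrBound N M γ σ lev τ D D q α := fun q =>
    ⟨hα, hD, fun i j _ h => hD i j h, hD0, by linarith⟩
  by_cases h0 : lev i = 0
  · exact L.abs_update_zero h0 (hα' 0)
  · exact L.abs_update_level h0 (hα' _) le_rfl fun k l _ hkl => hD k l hkl

end Layering

theorem abs_damped_le {κ x y c : ℝ} (h0 : 0 ≤ κ) (h1 : κ ≤ 1) (hx : |x| ≤ c) (hy : |y| ≤ c) :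
    |κ * x + (1 - κ) * y| ≤ c := by
  have h2 : 0 ≤ 1 - κ := by linarith
  rw [abs_le] at *
  constructor <;> nlinarith

/-- A chart of level `q`: it assigns sites `0, …, n - 1` of a chain to the pairs of a mode and a node,
in such a way that tight edges and matched edges follow the edges of the chain. -/
structure IsChart (N : ExchangeNetwork V) (M : N.graph.Subgraph) (γ : V → ℝ)
    (lev : V → ℕ) (τ : ℕ → ℝ) (q e n : ℕ) (ρ : Bool → V → ℕ → Prop) : Prop where
  parity : e ≤ 1
  mem : ∀ m i y, ρ m i y → lev i = q ∧ y < n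
  partner : ∀ m i y p, ρ m i y → M.Adj i p → ρ (!m) p (pairing e n y)
  -- Upper bounds for a maximum need all tight neighbours, whereas lower bounds need one neighbour
  -- or an exit; hence the asymmetry between `upper` and `lower`.
  upper : ∀ i y k, ρ true i y → Tight N M γ lev τ i k → ρ false k (pairing (e + 1) n y)
  lower : ∀ i y, ρ false i y → Exit N M γ lev τ i ∨
    ∃ k, Tight N M γ lev τ i k ∧ ρ true k (pairing (e + 1) n y)

/-- An upper bound for the errors of the level follows the chain. -/
theorem IsChart.signed_err_le [Finite V] (L : Layering N M γ σ lev τ) {κ : ℝ} (h0 : 0 < κ)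
    (h1 : κ < 1) {q e n : ℕ} (hq : q ≠ 0) {ρ : Bool → V → ℕ → Prop}
    (hρ : IsChart N M γ lev τ q e n ρ) {D B H c : ℝ} (hH : 0 ≤ H) (hc0 : 0 ≤ c) (hc1 : c ≤ 1)
    {a : ℕ → V → V → ℝ} (ha : ∀ t, a (t + 1) = step N κ (a t))
    (hα : ∀ t, ErrBound N M γ σ lev τ D B q (a t))
    (hlev : ∀ i j, lev i = q → N.graph.Adj i j → |Err (a 0) i j| ≤ B + H)
    (hstart : ∀ m i j, ρ m i 0 → N.graph.Adj i j → ¬ M.Adj i j →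
      signed m (Err (a 0) i j) ≤ B + H * (1 - c)) (t : ℕ) :
    ∀ m i y j, ρ m i y → N.graph.Adj i j →
      (M.Adj i j → signed m (Err (a t) i j) ≤ B + H * (1 - c * (chain κ e n t).1 y)) ∧
      (¬ M.Adj i j → signed m (Err (a t) i j) ≤ B + H * (1 - c * (chain κ e n t).2 y)) := by
  have h2 : 0 ≤ 1 - κ := by linarith
  induction t with
  | zero =>
    intro m i y j hm hij
    have h3 := (signed_le_abs m _).trans (hlev i j (hρ.mem m i y hm).1 hij)
    refine ⟨fun _ => by simpa [chain] using h3, fun hM => ?_⟩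
    simp only [chain]
    split_ifs with hy
    · subst hy
      simpa using hstart m i j hm hij hM
    · simpa using h3
  | succ t ih =>
    intro m i y j hm hij
    have hi := (hρ.mem m i y hm).1
    have hα' : ErrBound N M γ σ lev τ D B (lev i) (a t) := hi ▸ hα t
    have h0' : lev i ≠ 0 := hi ▸ hq
    have hB : ∀ w, w ≤ 1 → B ≤ B + H * (1 - c * w) := fun w hw => by
      have : 0 ≤ 1 - c * w := by nlinarith
      nlinarith
    have damp : ∀ {x y w v : ℝ}, x ≤ B + H * (1 - c * w) → y ≤ B + H * (1 - c * v) →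
        κ * x + (1 - κ) * y ≤ B + H * (1 - c * (κ * w + (1 - κ) * v)) := by
      intro x y w v hx hy
      have := mul_le_mul_of_nonneg_left hx h0.le
      have := mul_le_mul_of_nonneg_left hy h2
      linarith
    rw [ha, err_step, signed_combination]
    refine ⟨fun hM => ?_, fun hM => ?_⟩
    · refine damp ?_ ((ih m i y j hm hij).1 hM)
      have hw := (chain_mem_Icc h0.le h1.le e n t (pairing (e + 1) n y)).2.2
      simp only [chainOp]
      cases m
      · simp only [signed, Bool.false_eq_true, if_false]
        rcases hρ.lower i y hm with he | ⟨k, hk, hk'⟩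
        · exact (L.signed_update_exit hM hα' he).trans (hB _ hw)
        · refine L.signed_update_false_adj hM hα' (hB _ hw) hk ?_
          have := (ih true k _ i hk' hk.1.symm).2 (fun h => hk.2.1 h.symm)
          simpa [signed] using this
      · simp only [signed, if_true]
        refine L.signed_update_true_adj hM hα' (hB _ hw) fun k hk => ?_
        have := (ih false k _ i (hρ.upper i y k hm hk) hk.1.symm).2 (fun h => hk.2.1 h.symm)
        simpa [signed] using this
    · refine damp ?_ ((ih m i y j hm hij).2 hM)
      obtain ⟨p, hp⟩ := L.exists_partner h0'
      have h3 := (chain_mem_Icc h0.le h1.le e n t y).1.2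
      have h4 := (chain_mem_Icc h0.le h1.le e n t (pairing e n y)).1.2
      simp only [chainOp]
      refine L.signed_update_not_adj m hp hM hα' (hB _ (by linarith)) ?_
      have h5 := (ih m i y p hm (M.adj_sub hp)).1 hp
      have h6 := (ih (!m) p _ i (hρ.partner m i y p hm hp) (M.adj_sub hp).symm).1 hp.symm
      linarith

/-- In mode `m`, the message from `i` to its partner depends on other levels only. -/
def Dead (N : ExchangeNetwork V) (M : N.graph.Subgraph) (γ : V → ℝ)
    (lev : V → ℕ) (τ : ℕ → ℝ) (m : Bool) (i : V) : Prop :=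
  if m then ∀ k, ¬ Tight N M γ lev τ i k else Exit N M γ lev τ i

/-- The level `q` is covered by charts with at most `n` sites, in which the error decays at the site
`0`: either because a message there depends on other levels only, or because the signs of the errors of
one message are opposite in the two modes. -/
def IsCharted (N : ExchangeNetwork V) (M : N.graph.Subgraph) (γ : V → ℝ)
    (lev : V → ℕ) (τ : ℕ → ℝ) (q n : ℕ) : Prop :=
  (∀ m i, lev i = q → ∃ e n' ρ y, 0 < n' ∧ n' ≤ n ∧ IsChart N M γ lev τ q e n' ρ ∧ ρ m i y ∧
    ∀ m' i' p, ρ m' i' 0 → M.Adj i' p →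
      Dead N M γ lev τ m' i' ∨ Dead N M γ lev τ (!m') p) ∨
  (∃ i₀ p₀, M.Adj i₀ p₀ ∧ lev i₀ = q ∧ ∀ m₀, ∀ m i, lev i = q → ∃ e n' ρ y, 0 < n' ∧ n' ≤ n ∧
    IsChart N M γ lev τ q e n' ρ ∧ ρ m i y ∧
    ∀ m' i', ρ m' i' 0 → (m' = m₀ ∧ i' = i₀) ∨ (m' = !m₀ ∧ i' = p₀))

theorem Layering.signed_update_dead [Finite V] (L : Layering N M γ σ lev τ) {D B : ℝ}
    {α : V → V → ℝ} {m : Bool} {i p : V} (h : M.Adj i p)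
    (hα : ErrBound N M γ σ lev τ D B (lev i) α) (hd : Dead N M γ lev τ m i) :
    signed m (update N α i p - Tgt i p) ≤ B := by
  cases m
  · simp only [Dead, Bool.false_eq_true, if_false] at hd
    simp only [signed, Bool.false_eq_true, if_false]
    exact L.signed_update_exit h hα hd
  · simp only [Dead, if_true] at hd
    simp only [signed, if_true]
    exact L.signed_update_true_adj h hα le_rfl fun k hk => absurd hk (hd k)

/-- Within order `n ^ 5` steps, the excess of the errors of a charted level decreases by a factor
`1 - c / n`. -/
theorem IsCharted.err_decrease [Finite V] (L : Layering N M γ σ lev τ) {κ : ℝ} (h0 : 0 < κ)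
    (h1 : κ < 1) {q n : ℕ} (hq : q ≠ 0) (hch : IsCharted N M γ lev τ q n)
    {D B H : ℝ} (hH : 0 ≤ H)
    {a : ℕ → V → V → ℝ} (ha : ∀ t, a (t + 1) = step N κ (a t))
    (hα : ∀ t, ErrBound N M γ σ lev τ D B q (a t))
    (hlev : ∀ i j, lev i = q → N.graph.Adj i j → |Err (a 0) i j| ≤ B + H)
    {T : ℕ} (hT : 1152 * (n : ℝ) ^ 5 ≤ T * (κ * (1 - κ))) :
    ∀ i j, lev i = q → N.graph.Adj i j →
      |Err (a (T + 2)) i j| ≤ B + H * (1 - κ ^ 2 * (1 - κ) / (8 * n)) := by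
  have h2 : 0 < 1 - κ := by linarith
  have persist : ∀ t, ∀ i j, lev i = q → N.graph.Adj i j → |Err (a t) i j| ≤ B + H := by
    intro t
    induction t with
    | zero => exact hlev
    | succ t ih =>
      intro i j hi hij
      rw [ha, err_step]
      refine abs_damped_le h0.le h1.le ?_ (ih i j hi hij)
      exact L.abs_update_level (hi ▸ hq) (hi ▸ hα t) (by linarith)
        (fun k l hk hkl => ih k l (hk.trans hi) hkl)
  -- A gain of `κ (1 - κ)` in one matched message at time 1 is halved by the averaging over the
  -- matched edge and multiplied by `κ` through damping, before it reaches the unmatched messages at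
  -- time 2.
  set c : ℝ := κ ^ 2 * (1 - κ) / 2 with hc
  have hc0 : 0 ≤ c := by positivity
  have hc1 : c ≤ 1 := by
    rw [hc]
    have : κ ^ 2 * (1 - κ) ≤ 1 := mul_le_one₀ (pow_le_one₀ h0.le h1.le) h2.le (by linarith)
    linarith
  -- the conclusion from a chart with a low message at the site `0`
  have main : ∀ m i, lev i = q → ∀ e n' ρ y, 0 < n' → n' ≤ n → IsChart N M γ lev τ q e n' ρ →
      ρ m i y → (∀ m' i' p, ρ m' i' 0 → M.Adj i' p →
        signed m' (Err (a 1) i' p) ≤ B + H * (1 - κ * (1 - κ)) ∨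
        signed (!m') (Err (a 1) p i') ≤ B + H * (1 - κ * (1 - κ))) →
      ∀ j, N.graph.Adj i j → signed m (Err (a (T + 2)) i j) ≤
        B + H * (1 - κ ^ 2 * (1 - κ) / (8 * n)) := by
    intro m i hi e n' ρ y hn' hn hρ hy hdead j hij
    have hstart : ∀ m i j, ρ m i 0 → N.graph.Adj i j → ¬ M.Adj i j →
        signed m (Err (a 2) i j) ≤ B + H * (1 - c) := by
      intro m i j hm hij hM
      have hi := (hρ.mem m i 0 hm).1
      obtain ⟨p, hp⟩ := L.exists_partner (i := i) (hi ▸ hq)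
      have hp' : lev p = q := (L.lev_partner i p hp).symm.trans hi
      rw [ha, err_step, signed_combination]
      have h3 := (signed_le_abs m _).trans (persist 1 i j hi hij)
      have h4 := (signed_le_abs m _).trans (persist 1 i p hi (M.adj_sub hp))
      have h5 := (signed_le_abs (!m) _).trans (persist 1 p i hp' (M.adj_sub hp).symm)
      have h6 : signed m (update N (a 1) i j - Tgt i j) ≤ B + H * (1 - κ * (1 - κ) / 2) := by
        have hk : 0 ≤ 1 - κ * (1 - κ) / 2 := by nlinarith
        refine L.signed_update_not_adj m hp hM (hi ▸ hα 1) (by nlinarith) ?_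
        rcases hdead m i p hm hp with h | h <;> linarith
      have := mul_le_mul_of_nonneg_left h6 h0.le
      have := mul_le_mul_of_nonneg_left h3 h2.le
      rw [hc]
      linarith
    have key := hρ.signed_err_le L h0 h1 hq hH hc0 hc1 (a := fun t => a (t + 2))
      (fun t => ha (t + 2)) (fun t => hα (t + 2)) (persist 2) hstart T m i y j hy hij
    have hn1 : (1 : ℝ) ≤ n' := by exact_mod_cast hn'
    have hnn : (n' : ℝ) ≤ n := by exact_mod_cast hn
    have hT' : 1152 * (n' : ℝ) ^ 5 ≤ T * (κ * (1 - κ)) :=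
      le_trans (by gcongr) hT
    obtain ⟨b1, b2⟩ := chain_lower_bound h0 h1 hρ.parity hn' hT' (hρ.mem m i y hy).2
    have fin : ∀ w, 1 / (4 * (n' : ℝ)) ≤ w →
        B + H * (1 - c * w) ≤ B + H * (1 - κ ^ 2 * (1 - κ) / (8 * n)) := by
      intro w hw
      have h3 : κ ^ 2 * (1 - κ) / (8 * n) ≤ c * w := by
        calc κ ^ 2 * (1 - κ) / (8 * n) ≤ κ ^ 2 * (1 - κ) / (8 * n') := by gcongr
          _ = c * (1 / (4 * n')) := by rw [hc]; field_simp; ring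
          _ ≤ c * w := mul_le_mul_of_nonneg_left hw hc0
      have := mul_le_mul_of_nonneg_left h3 hH
      linarith
    by_cases hM : M.Adj i j
    · exact (key.1 hM).trans (fin _ b1)
    · exact (key.2 hM).trans (fin _ b2)
  intro i j hi hij
  refine abs_le_of_signed fun m => ?_
  rcases hch with hch | ⟨i₀, p₀, h₀, hi₀, hch⟩
  · obtain ⟨e, n', ρ, y, hn', hn, hρ, hy, hdead⟩ := hch m i hi
    refine main m i hi e n' ρ y hn' hn hρ hy ?_ j hij
    have one : ∀ m i p, lev i = q → M.Adj i p → Dead N M γ lev τ m i →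
        signed m (Err (a 1) i p) ≤ B + H * (1 - κ * (1 - κ)) := by
      intro m i p hi hp hd
      have h3 := L.signed_update_dead hp (hi ▸ hα 0) hd
      have h4 := (signed_le_abs m _).trans (persist 0 i p hi (M.adj_sub hp))
      rw [ha, err_step, signed_combination]
      have h5 := mul_le_mul_of_nonneg_left h3 h0.le
      have h6 := mul_le_mul_of_nonneg_left h4 h2.le
      nlinarith [mul_nonneg hH (mul_nonneg h0.le h0.le)]
    intro m' i' p hm' hp
    have hi' := (hρ.mem _ _ _ hm').1
    rcases hdead m' i' p hm' hp with hd | hd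
    · exact Or.inl (one m' i' p hi' hp hd)
    · exact Or.inr (one (!m') p i' ((L.lev_partner i' p hp).symm.trans hi') hp.symm hd)
  -- One error is nonpositive in at least one of the two modes. The chart whose site 0 carries this
  -- mode is used, and damping keeps part of the advantage for one step.
  · obtain ⟨m₀, hm₀⟩ : ∃ m₀, signed m₀ (Err (a 0) i₀ p₀) ≤ 0 := by
      rcases le_total (Err (a 0) i₀ p₀) 0 with h | h
      · exact ⟨true, by simpa [signed] using h⟩
      · exact ⟨false, by simpa [signed] using h⟩
    have low : signed m₀ (Err (a 1) i₀ p₀) ≤ B + H * (1 - κ * (1 - κ)) := by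
      have h3 := L.abs_update_level (j := p₀) (hi₀ ▸ hq) (hi₀ ▸ hα 0) (C := B + H) (by linarith)
        (fun k l hk hkl => hlev k l (hk.trans hi₀) hkl)
      have h3 := (signed_le_abs m₀ _).trans h3
      rw [ha, err_step, signed_combination]
      have h5 := mul_le_mul_of_nonneg_left h3 h0.le
      have h6 := mul_le_mul_of_nonneg_left hm₀ h2.le
      have h7 := mul_nonneg h2.le (hα 0).bound_nonneg
      nlinarith [mul_nonneg hH (mul_nonneg h2.le h2.le)]
    obtain ⟨e, n', ρ, y, hn', hn, hρ, hy, hsite⟩ := hch m₀ m i hi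
    refine main m i hi e n' ρ y hn' hn hρ hy ?_ j hij
    intro m' i' p hm' hp
    rcases hsite m' i' hm' with ⟨rfl, rfl⟩ | ⟨rfl, rfl⟩
    · obtain rfl := L.partner_unique h₀ hp
      exact Or.inl low
    · obtain rfl := L.partner_unique h₀.symm hp
      rw [Bool.not_not]
      exact Or.inr low

end

/-! ### From one level to all levels, and the number of sweeps. -/

/-- Bernoulli's inequality for `(1 + x) ^ k`, combined with `(1 - x) * (1 + x) ≤ 1`. -/
theorem pow_one_sub_le {x y : ℝ} (hx0 : 0 ≤ x) (hx1 : x ≤ 1) (hy : 0 < y) {k : ℕ}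
    (hk : y ≤ k * x) : (1 - x) ^ k ≤ 1 / y := by
  have h1 : 1 + k * x ≤ (1 + x) ^ k := one_add_mul_le_pow (by linarith) k
  have h2 : (1 - x) ^ k * (1 + x) ^ k ≤ 1 := by
    rw [← mul_pow]
    exact pow_le_one₀ (mul_nonneg (by linarith) (by linarith)) (by nlinarith)
  rw [le_div_iff₀ hy]
  refine le_trans (mul_le_mul_of_nonneg_left ?_ (pow_nonneg (by linarith) k)) h2
  linarith

section

variable {V : Type*} {N : ExchangeNetwork V} {M : N.graph.Subgraph} {γ : V → ℝ} {σ : ℝ}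
  {lev : V → ℕ} {τ : ℕ → ℝ}

local notation "Err" => err N M γ lev τ

theorem ErrBound.of_all {D B : ℝ} {q : ℕ} {α : V → V → ℝ} (hα : ∀ i j, N.graph.Adj i j → 0 ≤ α i j)
    (hD : ∀ i j, N.graph.Adj i j → |Err α i j| ≤ D) (hB0 : 0 ≤ B) (hB : D - σ / 2 ≤ B)
    (hq : ∀ i j, lev i < q → N.graph.Adj i j → |Err α i j| ≤ B) :
    ErrBound N M γ σ lev τ D B q α :=
  ⟨hα, hD, hq, hB0, hB⟩

/-- The constant for which `A ^ 2 n ^ 6` steps per node suffice. -/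
structure IsRate (κ : ℝ) (A : ℕ) : Prop where
  two_le : 2 ≤ A
  -- `36864 = 1152 * 2 ^ 5` belongs to a chain of `2 * c` sites; the subtracted 2 pays for the two
  -- steps before the chain starts.
  window : 36864 ≤ ((A : ℝ) - 2) * (κ * (1 - κ))
  -- A window gains the fraction `κ ^ 2 (1 - κ) / (16 c)`; after `A n c` windows, the value `64 = 16
  -- * 4` yields the factor `1 / (4 n)`.
  number : 64 ≤ A * (κ ^ 2 * (1 - κ))

theorem exists_isRate {κ : ℝ} (h0 : 0 < κ) (h1 : κ < 1) : ∃ A, IsRate κ A := by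
  have h2 : 0 < 1 - κ := by linarith
  obtain ⟨A, hA⟩ := exists_nat_ge (36864 / (κ ^ 2 * (1 - κ)) + 2)
  have h3 : 0 < κ ^ 2 * (1 - κ) := by positivity
  have h4 : 36864 / (κ ^ 2 * (1 - κ)) ≤ (A : ℝ) - 2 := by linarith
  rw [div_le_iff₀ h3] at h4
  have h5 : κ ^ 2 * (1 - κ) ≤ κ * (1 - κ) := by nlinarith
  have h6 : 0 ≤ (A : ℝ) - 2 := by
    by_contra h
    nlinarith
  refine ⟨A, ?_, ?_, ?_⟩
  · exact_mod_cast (by linarith : (2 : ℝ) ≤ A)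
  · exact h4.trans (mul_le_mul_of_nonneg_left h5 h6)
  · nlinarith

/-- Each window of `A n ^ 5` steps multiplies the excess over `B` by `1 - x` with `x` of order `1 /
c`, and `A n c` windows are used. The resulting bound is kept at all later times by
`abs_update_level`, as the next levels require. -/
theorem level_converges [Finite V] (L : Layering N M γ σ lev τ) {κ : ℝ} (h0 : 0 < κ)
    (h1 : κ < 1) {A : ℕ} (hA : IsRate κ A) {n c q : ℕ} (hc : 0 < c) (hcn : c ≤ n)
    (hq : q ≠ 0) (hch : IsCharted N M γ lev τ q (2 * c)) {D B : ℝ} (hBD : B ≤ D)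
    {a : ℕ → V → V → ℝ} (ha : ∀ t, a (t + 1) = step N κ (a t))
    (hα : ∀ t, ErrBound N M γ σ lev τ D B q (a t)) {t : ℕ} (ht : A ^ 2 * n ^ 6 * c ≤ t) :
    ∀ i j, lev i = q → N.graph.Adj i j → |Err (a t) i j| ≤ B + (D - B) / (4 * n) := by
  have h2 : 0 < 1 - κ := by linarith
  have hc' : (1 : ℝ) ≤ c := by exact_mod_cast hc
  have hcn' : (c : ℝ) ≤ n := by exact_mod_cast hcn
  have hA2 : (2 : ℝ) ≤ A := by exact_mod_cast hA.two_le
  set x : ℝ := κ ^ 2 * (1 - κ) / (8 * (2 * c : ℕ)) with hx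
  have hx0 : 0 ≤ x := by positivity
  have hx1 : x ≤ 1 := by
    rw [hx, div_le_one (by positivity)]
    have : κ ^ 2 * (1 - κ) ≤ 1 := mul_le_one₀ (pow_le_one₀ h0.le h1.le) h2.le (by linarith)
    push_cast
    linarith
  have hP : 2 ≤ A * n ^ 5 := by
    have : 0 < n ^ 5 := by have : 0 < n := hc.trans_le hcn; positivity
    nlinarith [hA.two_le]
  have hT : 1152 * ((2 * c : ℕ) : ℝ) ^ 5 ≤ ((A * n ^ 5 - 2 : ℕ) : ℝ) * (κ * (1 - κ)) := by
    rw [Nat.cast_sub hP]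
    push_cast
    have e1 : (1 : ℝ) ≤ (n : ℝ) ^ 5 := one_le_pow₀ (by linarith)
    have e2 : ((A : ℝ) - 2) * (n : ℝ) ^ 5 ≤ (A : ℝ) * (n : ℝ) ^ 5 - 2 := by linarith
    have e3 : (c : ℝ) ^ 5 ≤ (n : ℝ) ^ 5 := by gcongr
    have e4 := mul_le_mul_of_nonneg_right e2 (mul_pos h0 h2).le
    have e5 := mul_le_mul_of_nonneg_right hA.window (by linarith : (0 : ℝ) ≤ (n : ℝ) ^ 5)
    calc 1152 * (2 * (c : ℝ)) ^ 5 = 36864 * (c : ℝ) ^ 5 := by ring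
      _ ≤ 36864 * (n : ℝ) ^ 5 := by linarith
      _ ≤ _ := by linarith
  have hH : 0 ≤ D - B := by linarith
  have windows : ∀ k : ℕ, ∀ i j, lev i = q → N.graph.Adj i j →
      |Err (a (k * (A * n ^ 5))) i j| ≤ B + (D - B) * (1 - x) ^ k := by
    intro k
    induction k with
    | zero =>
      intro i j _ hij
      have := (hα (0 * (A * n ^ 5))).all i j hij
      simpa using this
    | succ k ih =>
      have := hch.err_decrease L h0 h1 hq (H := (D - B) * (1 - x) ^ k)
        (mul_nonneg hH (pow_nonneg (by linarith) k))
        (a := fun t => a (k * (A * n ^ 5) + t)) (fun t => ha _) (fun t => hα _) ih hT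
      intro i j hi hij
      have h3 := this i j hi hij
      rw [show (k + 1) * (A * n ^ 5) = k * (A * n ^ 5) + (A * n ^ 5 - 2 + 2) by
        rw [Nat.sub_add_cancel hP]; ring, pow_succ (1 - x), ← mul_assoc (D - B)]
      exact h3
  set k := A * n * c with hk
  have hpow : (1 - x) ^ k ≤ 1 / (4 * n) := by
    refine pow_one_sub_le hx0 hx1 (by linarith) ?_
    have : (k : ℝ) * x = A * (κ ^ 2 * (1 - κ)) / 16 * n := by
      rw [hk, hx]; push_cast; field_simp; ring
    rw [this]
    have := mul_le_mul_of_nonneg_right hA.number (by linarith : (0 : ℝ) ≤ n)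
    linarith
  have hend : ∀ i j, lev i = q → N.graph.Adj i j →
      |Err (a (A ^ 2 * n ^ 6 * c)) i j| ≤ B + (D - B) / (4 * n) := by
    intro i j hi hij
    have h3 := windows k i j hi hij
    rw [show k * (A * n ^ 5) = A ^ 2 * n ^ 6 * c by rw [hk]; ring] at h3
    refine h3.trans ?_
    have := mul_le_mul_of_nonneg_left hpow hH
    rw [mul_one_div] at this
    linarith
  induction t, ht using Nat.le_induction with
  | base => exact hend
  | succ t ht ih =>
    intro i j hi hij
    rw [ha, err_step]
    refine abs_damped_le h0.le h1.le ?_ (ih i j hi hij)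
    have : 0 ≤ (D - B) / (4 * n) := by positivity
    exact L.abs_update_level (hi ▸ hq) (hi ▸ hα t) (by linarith)
      (fun k l hk hkl => ih k l (hk.trans hi) hkl)

/-- Updates at unmatched nodes have errors at most `B` at once, so only the damping remembers the
excess, which decays like `(1 - κ) ^ t`. -/
theorem level_zero_converges (L : Layering N M γ σ lev τ) {κ : ℝ} (h0 : 0 < κ)
    (h1 : κ < 1) {n : ℕ} (hn : 0 < n) {D B : ℝ} (hBD : B ≤ D)
    {a : ℕ → V → V → ℝ} (ha : ∀ t, a (t + 1) = step N κ (a t))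
    (hα : ∀ t, ErrBound N M γ σ lev τ D B 0 (a t)) {t : ℕ} (ht : 4 * n ≤ t * κ) :
    ∀ i j, lev i = 0 → N.graph.Adj i j → |Err (a t) i j| ≤ B + (D - B) / (4 * n) := by
  have h2 : 0 < 1 - κ := by linarith
  have key : ∀ t, ∀ i j, lev i = 0 → N.graph.Adj i j →
      |Err (a t) i j| ≤ B + (D - B) * (1 - κ) ^ t := by
    intro t
    induction t with
    | zero =>
      intro i j _ hij
      simpa using (hα 0).all i j hij
    | succ t ih =>
      intro i j hi hij
      rw [ha, err_step]
      have h3 := L.abs_update_zero (j := j) hi (hα t)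
      have h4 := ih i j hi hij
      rw [abs_le] at *
      have := mul_le_mul_of_nonneg_left h3.1 h0.le
      have := mul_le_mul_of_nonneg_left h3.2 h0.le
      have := mul_le_mul_of_nonneg_left h4.1 h2.le
      have := mul_le_mul_of_nonneg_left h4.2 h2.le
      rw [pow_succ]
      constructor <;> linarith
  intro i j hi hij
  refine (key t i j hi hij).trans ?_
  have hn' : (0 : ℝ) < 4 * n := by positivity
  have := mul_le_mul_of_nonneg_left (pow_one_sub_le h0.le h1.le hn' ht)
    (by linarith : 0 ≤ D - B)
  rw [mul_one_div] at this
  linarith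

open Finset in
/-- After a sweep over all levels, the error has decreased. -/
theorem sweep [Fintype V] (L : Layering N M γ σ lev τ) {κ : ℝ} (h0 : 0 < κ)
    (h1 : κ < 1) {A : ℕ} (hA : IsRate κ A)
    (hch : ∀ q, q ≠ 0 → (∃ i, lev i = q) →
      IsCharted N M γ lev τ q (2 * Fintype.card {i // lev i = q}))
    {D : ℝ} (hD : 0 ≤ D) {a : ℕ → V → V → ℝ} (ha : ∀ t, a (t + 1) = step N κ (a t))
    (hα : ∀ t i j, N.graph.Adj i j → 0 ≤ a t i j)
    (hall : ∀ t i j, N.graph.Adj i j → |Err (a t) i j| ≤ D)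
    {t : ℕ} (ht : A ^ 2 * Fintype.card V ^ 6 * (Fintype.card V + 1) ≤ t) :
    ∀ i j, N.graph.Adj i j → |Err (a t) i j| ≤ D - min D (σ / 2) / 2 := by
  classical
  intro i₁ j₁ hij₁
  have hσ := L.sigma_pos
  set n := Fintype.card V with hn
  have hn0 : 0 < n := Fintype.card_pos_iff.2 ⟨i₁⟩
  have hn1 : (1 : ℝ) ≤ n := by exact_mod_cast hn0
  -- `D - h` is the smallest bound `B` that `ErrBound` admits.
  set h := min D (σ / 2) with hh
  have hh0 : 0 ≤ h := le_min hD (by linarith)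
  have hhD : h ≤ D := min_le_left _ _
  have hhσ : h ≤ σ / 2 := min_le_right _ _
  set η : ℝ := 1 - 1 / (4 * n) with hη
  have hη1 : η ≤ 1 := by rw [hη]; have : (0:ℝ) ≤ 1 / (4 * n) := by positivity
                         linarith
  have hη0 : 0 ≤ η := by
    rw [hη, sub_nonneg, div_le_one (by linarith)]
    linarith
  let f : ℕ → ℕ := fun q => Fintype.card {i // lev i ≠ 0 ∧ lev i < q}
  have hf : ∀ q, f q ≤ n := fun q => Fintype.card_subtype_le _
  have pow_mono : ∀ {k l : ℕ}, k ≤ l → h * η ^ l ≤ h * η ^ k := fun hkl =>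
    mul_le_mul_of_nonneg_left (pow_le_pow_of_le_one hη0 hη1 hkl) hh0
  have pow_le : ∀ k : ℕ, h * η ^ k ≤ h := fun k =>
    mul_le_of_le_one_right hh0 (pow_le_one₀ hη0 hη1)
  -- `f (q + 1)` counts the matched nodes on the levels up to `q`. Time and lost factors `η` are
  -- both charged to nodes, with one more unit for level 0, so empty levels cost nothing and the
  -- total is at most `n + 1`.
  have claim : ∀ q, ∀ t, A ^ 2 * n ^ 6 * (1 + f (q + 1)) ≤ t → ∀ i j, lev i < q + 1 →
      N.graph.Adj i j → |Err (a t) i j| ≤ D - h * η ^ (1 + f (q + 1)) := by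
    intro q
    induction q with
    | zero =>
      intro t ht i j hi hij
      have hf1 : f 1 = 0 := by
        simp only [f]
        rw [Fintype.card_eq_zero_iff]
        exact ⟨fun x => by omega⟩
      rw [zero_add, hf1] at ht ⊢
      have hB : ∀ t, ErrBound N M γ σ lev τ D (D - h) 0 (a t) := fun t =>
        ErrBound.of_all (hα t) (hall t) (by linarith) (by linarith) (fun i j hi => by omega)
      have := level_zero_converges L h0 h1 hn0 (by linarith) ha hB (t := t) (by
        have e1 : ((A ^ 2 * n ^ 6 * (1 + 0) : ℕ) : ℝ) ≤ t := by exact_mod_cast ht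
        push_cast at e1
        have e2 := hA.number
        have e3 : (2 : ℝ) ≤ A := by exact_mod_cast hA.two_le
        have e4 : κ ^ 2 * (1 - κ) ≤ κ := by nlinarith
        have e5 : 64 ≤ A * κ := e2.trans (mul_le_mul_of_nonneg_left e4 (by linarith))
        have e6 : (n : ℝ) ≤ (n : ℝ) ^ 6 := le_self_pow₀ hn1 (by norm_num)
        have e7 : (A : ℝ) * n ^ 6 ≤ t := by
          refine le_trans ?_ e1
          nlinarith [mul_nonneg (by linarith : (0:ℝ) ≤ A) (by positivity : (0:ℝ) ≤ (n:ℝ)^6)]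
        calc (4 * n : ℝ) ≤ 64 * n ^ 6 := by linarith
          _ ≤ (A * κ) * n ^ 6 := mul_le_mul_of_nonneg_right e5 (by positivity)
          _ = (A * n ^ 6) * κ := by ring
          _ ≤ t * κ := mul_le_mul_of_nonneg_right e7 h0.le) i j (by omega) hij
      refine this.trans_eq ?_
      rw [hη]; ring
    | succ q ih =>
      by_cases hex : ∃ i, lev i = q + 1
      · set c := Fintype.card {i // lev i = q + 1} with hc
        have hc0 : 0 < c := Fintype.card_pos_iff.2 ⟨⟨hex.choose, hex.choose_spec⟩⟩
        have hcn : c ≤ n := Fintype.card_subtype_le _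
        have hfc : f (q + 1 + 1) = f (q + 1) + c := by
          simp only [f, hc, Fintype.card_subtype]
          rw [← Finset.card_union_of_disjoint]
          · congr 1
            ext i
            simp only [mem_filter, mem_univ, true_and, mem_union]
            omega
          · rw [Finset.disjoint_filter]
            intro i _ hi
            omega
        intro t ht i j hi hij
        set t₀ := A ^ 2 * n ^ 6 * (1 + f (q + 1)) with ht₀
        set B := D - h * η ^ (1 + f (q + 1)) with hB
        have hBD : B ≤ D := by
          have : 0 ≤ h * η ^ (1 + f (q + 1)) := by positivity
          linarith
        have hBe : ∀ t, ErrBound N M γ σ lev τ D B (q + 1) (a (t₀ + t)) := fun t =>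
          ErrBound.of_all (hα _) (hall _) (by linarith [pow_le (1 + f (q + 1))])
            (by linarith [pow_le (1 + f (q + 1))]) (fun i j hi hij => ih _ (by omega) i j hi hij)
        have ht' : t₀ + A ^ 2 * n ^ 6 * c ≤ t := by
          refine le_trans (le_of_eq ?_) ht
          rw [hfc, ht₀]; ring
        rcases Nat.lt_succ_iff_lt_or_eq.1 hi with hi' | hi'
        · refine (ih t (by omega) i j hi' hij).trans ?_
          have := pow_mono (show 1 + f (q + 1) ≤ 1 + f (q + 1 + 1) by omega)
          linarith
        · have := level_converges L h0 h1 hA hc0 hcn (by omega) (hch (q + 1) (by omega) hex)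
            hBD (a := fun t => a (t₀ + t)) (fun t => ha _) hBe (t := t - t₀) (by omega) i j hi' hij
          rw [show t₀ + (t - t₀) = t by omega] at this
          refine this.trans ?_
          have e1 := pow_mono (show 1 + f (q + 1) + 1 ≤ 1 + f (q + 1 + 1) by omega)
          have e2 : B + (D - B) / (4 * n) = D - h * η ^ (1 + f (q + 1) + 1) := by
            rw [hB, pow_succ, hη]; ring
          linarith
      · have hff : f (q + 1 + 1) = f (q + 1) := by
          simp only [f]
          refine Fintype.card_congr (Equiv.subtypeEquivRight fun i => ?_)
          have : lev i ≠ q + 1 := fun h => hex ⟨i, h⟩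
          omega
        rw [hff]
        intro t ht i j hi hij
        have : lev i ≠ q + 1 := fun h => hex ⟨i, h⟩
        exact ih t ht i j (by omega) hij
  have hfin := claim (lev i₁) t (le_trans (by
    refine Nat.mul_le_mul_left _ ?_
    have := hf (lev i₁ + 1)
    omega) ht) i₁ j₁ (by omega) hij₁
  refine hfin.trans ?_
  have e1 := pow_mono (show 1 + f (lev i₁ + 1) ≤ n + 1 by have := hf (lev i₁ + 1); omega)
  -- By Bernoulli, `η ^ (n + 1) ≥ 1 - (n + 1) / (4 n) ≥ 1 / 2`: half of the gain `h` survives all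
  -- levels.
  have e2 : 1 / 2 ≤ η ^ (n + 1) := by
    have := one_add_mul_le_pow (show (-2 : ℝ) ≤ -(1 / (4 * n)) by
      have : 1 / (4 * (n : ℝ)) ≤ 1 := by rw [div_le_one (by linarith)]; linarith
      linarith) (n + 1)
    rw [show 1 + -(1 / (4 * (n : ℝ))) = η by rw [hη]; ring] at this
    refine le_trans ?_ this
    push_cast
    have : ((n : ℝ) + 1) * (1 / (4 * n)) ≤ 1 / 2 := by
      rw [mul_one_div, div_le_iff₀ (by linarith)]
      linarith
    linarith
  have e3 := mul_le_mul_of_nonneg_left e2 hh0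
  linarith

/-- The partner's offer bounds the earning from below. From above, it is the largest candidate,
since on unmatched edges the slack only helps. -/
theorem Layering.abs_earning_sub_le [Finite V] (L : Layering N M γ σ lev τ) {α : V → V → ℝ} {D : ℝ}
    (hα : ∀ i j, N.graph.Adj i j → 0 ≤ α i j) (hD0 : 0 ≤ D)
    (hD : ∀ i j, N.graph.Adj i j → |Err α i j| ≤ D) (i : V) : |earning N α i - γ i| ≤ D := by
  have hσ := L.sigma_pos
  have hγ := L.gamma_nonneg i
  rw [abs_le]
  constructor
  · by_cases h0 : lev i = 0
    · rw [L.gamma_zero i h0]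
      have : 0 ≤ earning N α i := N.nbrMax_nonneg fun k hk => offer_nonneg N (hα i k hk)
      linarith
    · obtain ⟨p, hp⟩ := L.exists_partner h0
      have h1 := abs_le.1 (hD i p (M.adj_sub hp))
      have h2 := abs_le.1 (hD p i (M.adj_sub hp).symm)
      have h3 := L.sigma_le i h0
      have h4 := L.le_offer_partner (α := α) (c := - D) hp (by linarith) (by linarith)
      have h5 : offer N α p i ≤ earning N α i :=
        N.le_nbrMax (fun k => offer N α k i) (M.adj_sub hp)
      linarith
  · rw [sub_le_iff_le_add]
    refine N.nbrMax_le (by linarith) fun k hk => ?_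
    have h2 := abs_le.1 (hD k i hk.symm)
    by_cases hk' : M.Adj i k
    · have h1 := abs_le.1 (hD i k hk)
      exact (L.offer_partner_le α hk').trans (max_le (by linarith) (by linarith))
    · have := L.sigma_le_slack hk hk'
      exact (offer_other_le (γ := γ) (lev := lev) (τ := τ) α hk').trans
        (max_le (by linarith) (by linarith))

/-- The bound for the error after `s` sweeps. -/
noncomputable def sweepBound (W σ : ℝ) : ℕ → ℝ
  | 0 => W
  | s + 1 => sweepBound W σ s - min (sweepBound W σ s) (σ / 2) / 2

theorem sweepBound_nonneg {W σ : ℝ} (hW : 0 ≤ W) (s : ℕ) : 0 ≤ sweepBound W σ s := by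
  induction s with
  | zero => exact hW
  | succ s ih =>
    rw [sweepBound]
    linarith [min_le_left (sweepBound W σ s) (σ / 2)]

/-- The linear phase: above `σ / 2`, a sweep subtracts `σ / 4`. -/
theorem sweepBound_le_max {W σ : ℝ} (hσ : 0 < σ) (s : ℕ) :
    sweepBound W σ s ≤ max (σ / 2) (W - s * (σ / 4)) := by
  induction s with
  | zero => simp [sweepBound]
  | succ s ih =>
    rw [sweepBound, le_max_iff]
    push_cast
    rw [le_max_iff] at ih
    rcases le_total (sweepBound W σ s) (σ / 2) with h | h
    · rw [min_eq_left h]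
      left
      linarith
    · rw [min_eq_right h]
      rcases ih with ih | ih
      · left; linarith
      · right; linarith

/-- The geometric phase: below `σ / 2`, a sweep halves the bound. -/
theorem sweepBound_add_le {W σ : ℝ} (hσ : 0 < σ) {s : ℕ} (hs : sweepBound W σ s ≤ σ / 2)
    (j : ℕ) : sweepBound W σ (s + j) ≤ σ / 2 * (1 / 2) ^ j := by
  induction j with
  | zero => simpa using hs
  | succ j ih =>
    have h1 : σ / 2 * (1 / 2) ^ j ≤ σ / 2 :=
      mul_le_of_le_one_right (by linarith) (pow_le_one₀ (by norm_num) (by norm_num))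
    rw [← add_assoc, sweepBound, min_eq_left (ih.trans h1), pow_succ]
    linarith

/-- The linear phase takes `4 W / σ` sweeps and the geometric one `2 log (1 + σ / ε)`, because `1 /
2 ≤ exp (-1 / 2)`. The two roundings are absorbed by `2 ≤ W / σ`. -/
theorem exists_sweepBound_le {W σ ε : ℝ} (hσ : 0 < σ) (hε : 0 < ε) (hW : 2 * σ ≤ W) :
    ∃ s : ℕ, (s : ℝ) ≤ 5 * (W / σ + Real.log (1 + σ / ε)) ∧ sweepBound W σ s ≤ ε := by
  have hlog : 0 ≤ Real.log (1 + σ / ε) := Real.log_nonneg (by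
    have : 0 ≤ σ / ε := by positivity
    linarith)
  have hWσ : 2 ≤ W / σ := by rwa [le_div_iff₀ hσ]
  set s := ⌈4 * (W / σ)⌉₊
  set j := ⌈2 * Real.log (1 + σ / ε)⌉₊
  have hs1 : 4 * (W / σ) ≤ s := Nat.le_ceil _
  have hs2 : (s : ℝ) < 4 * (W / σ) + 1 := Nat.ceil_lt_add_one (by linarith)
  have hj1 : 2 * Real.log (1 + σ / ε) ≤ j := Nat.le_ceil _
  have hj2 : (j : ℝ) < 2 * Real.log (1 + σ / ε) + 1 := Nat.ceil_lt_add_one (by linarith)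
  refine ⟨s + j, by push_cast; linarith, ?_⟩
  have h1 : sweepBound W σ s ≤ σ / 2 := by
    refine (sweepBound_le_max hσ s).trans (max_le le_rfl ?_)
    have := mul_le_mul_of_nonneg_right hs1 hσ.le
    rw [mul_assoc, div_mul_cancel₀ _ hσ.ne'] at this
    linarith
  refine (sweepBound_add_le hσ h1 j).trans ?_
  have h2 : (1 / 2 : ℝ) ≤ Real.exp (-(1 / 2)) := by
    have := Real.add_one_le_exp (-(1 / 2) : ℝ)
    linarith
  have h3 : (1 / 2 : ℝ) ^ j ≤ Real.exp (- Real.log (1 + σ / ε)) := by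
    have h4 : (1 / 2 : ℝ) ≤ Real.exp (-(1 / 2)) := h2
    calc (1 / 2 : ℝ) ^ j ≤ Real.exp (-(1 / 2)) ^ j := by gcongr
      _ = Real.exp (j * -(1 / 2)) := (Real.exp_nat_mul _ _).symm
      _ ≤ _ := Real.exp_le_exp.2 (by linarith)
  have h5 : (0 : ℝ) < 1 + σ / ε := by positivity
  rw [Real.exp_neg, Real.exp_log h5] at h3
  have h6 : σ * (1 + σ / ε)⁻¹ ≤ ε := by
    rw [← div_eq_mul_inv, div_le_iff₀ h5]
    have : ε * (1 + σ / ε) = ε + σ := by field_simp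
    linarith
  have h7 := mul_le_mul_of_nonneg_left h3 hσ.le
  have h8 : 0 ≤ σ * (1 / 2 : ℝ) ^ j := by positivity
  linarith

end

/-- Convergence of the natural dynamics for a layered solution whose levels are charted. -/
theorem convergence_of_layering {V : Type*} [Fintype V] {N : ExchangeNetwork V}
    {M : N.graph.Subgraph} {γ : V → ℝ} {σ : ℝ}
    {lev : V → ℕ} {τ : ℕ → ℝ} {κ : ℝ} (h0 : 0 < κ) (h1 : κ < 1) {A : ℕ} (hA : IsRate κ A)
    (L : Layering N M γ σ lev τ)
    (hch : ∀ q, q ≠ 0 → (∃ i, lev i = q) →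
      IsCharted N M γ lev τ q (2 * Fintype.card {i // lev i = q}))
    {ε : ℝ} (hε : 0 < ε) {α₀ : V → V → ℝ} (hα₀ : IsValid N α₀) {t : ℕ}
    (ht : 10 * (A : ℝ) ^ 2 * (Fintype.card V : ℝ) ^ 7 *
      (N.maxWeight / σ + Real.log (1 + σ / ε)) ≤ t) (i : V) :
    |earning N (messages N κ α₀ t) i - γ i| ≤ ε := by
  have hσ := L.sigma_pos
  have hα := messages_nonneg N h0 h1 (fun i j hij => (hα₀ i j hij).1)
  -- Without edges there are no errors to bound; with an edge, `2 * σ ≤ W` is available.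
  by_cases hedge : ∃ i j, N.graph.Adj i j
  swap
  · exact L.abs_earning_sub_le (hα t) hε.le (fun i j hij => (hedge ⟨i, j, hij⟩).elim) i
  obtain ⟨i₁, j₁, hij₁⟩ := hedge
  have hW := L.two_sigma_le_maxWeight hij₁
  obtain ⟨s, hs1, hs2⟩ := exists_sweepBound_le hσ hε hW
  set n := Fintype.card V with hn
  have hn0 : 0 < n := Fintype.card_pos_iff.2 ⟨i⟩
  set S := A ^ 2 * n ^ 6 * (n + 1) with hS
  have claim : ∀ s t : ℕ, s * S ≤ t → ∀ i j, N.graph.Adj i j →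
      |err N M γ lev τ (messages N κ α₀ t) i j| ≤ sweepBound N.maxWeight σ s := by
    intro s
    induction s with
    | zero =>
      intro t _
      induction t with
      | zero =>
        intro i j hij
        have h2 := hα₀ i j hij
        have h3 := L.target_nonneg i j
        have h4 := L.target_le_maxWeight i j (by linarith)
        simp only [messages, sweepBound, err]
        rw [abs_le]
        constructor <;> linarith
      | succ t ih =>
        intro i j hij
        have ih' := ih (by omega)
        rw [messages, err_step]
        exact abs_damped_le h0.le h1.le
          (L.abs_update_all (hα t) (by rw [sweepBound]; linarith) ih' i j) (ih' i j hij)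
    | succ s ih =>
      intro t ht i j hij
      rw [Nat.succ_mul] at ht
      have := sweep L h0 h1 hA hch (sweepBound_nonneg (by linarith) s)
        (a := fun t => messages N κ α₀ (s * S + t)) (fun t => rfl) (fun t => hα _)
        (fun t => ih _ (by omega)) (t := t - s * S)
        (show S ≤ t - s * S by omega) i j hij
      rw [show s * S + (t - s * S) = t by omega] at this
      exact this
  refine L.abs_earning_sub_le (hα t) hε.le (fun i j hij => (claim s t ?_ i j hij).trans hs2) i
  have hn1 : (1 : ℝ) ≤ n := by exact_mod_cast hn0
  have : ((s * S : ℕ) : ℝ) ≤ t := by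
    refine le_trans ?_ ht
    rw [hS]
    push_cast
    have h2 : (A : ℝ) ^ 2 * (n : ℝ) ^ 6 * (n + 1) ≤ 2 * A ^ 2 * n ^ 7 := by
      calc (A : ℝ) ^ 2 * (n : ℝ) ^ 6 * (n + 1) ≤ (A : ℝ) ^ 2 * (n : ℝ) ^ 6 * (2 * n) := by
            gcongr; linarith
        _ = _ := by ring
    calc (s : ℝ) * ((A : ℝ) ^ 2 * (n : ℝ) ^ 6 * (n + 1))
        ≤ 5 * (N.maxWeight / σ + Real.log (1 + σ / ε)) * (2 * A ^ 2 * n ^ 7) :=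
          mul_le_mul hs1 h2 (by positivity) ((Nat.cast_nonneg s).trans hs1)
      _ = _ := by ring
  exact_mod_cast this

/-! ### A second solution from a fixed point: how uniqueness is used. -/

/-- A nonexpansive self-map of a compact convex set has a fixed point. -/
theorem exists_fixedPoint_of_nonexpansive {E : Type*} [NormedAddCommGroup E] [NormedSpace ℝ E]
    {K : Set E} (hK : IsCompact K) (hc : Convex ℝ K) (hne : K.Nonempty) {T : E → E}
    (hT : Set.MapsTo T K K) (hl : ∀ x ∈ K, ∀ y ∈ K, dist (T x) (T y) ≤ dist x y) :
    ∃ x ∈ K, T x = x := by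
  have hcont : ContinuousOn T K :=
    (LipschitzOnWith.of_dist_le_mul (K := 1) (fun x hx y hy => by
      simpa using hl x hx y hy)).continuousOn
  -- The displacement attains its minimum at `z`. Fixed points of nearby contractions have
  -- arbitrarily small displacement, so this minimum is 0.
  obtain ⟨z, hz, hmin⟩ := hK.exists_isMinOn hne (f := fun x => dist (T x) x)
    (continuous_dist.comp_continuousOn (hcont.prodMk continuousOn_id))
  refine ⟨z, hz, dist_le_zero.1 ?_⟩
  obtain ⟨x₀, hx₀⟩ := hne
  refine le_of_forall_pos_le_add fun r hr => ?_
  obtain ⟨R, hR⟩ := hK.isBounded.subset_closedBall x₀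
  have hR0 : 0 ≤ R := by
    have := hR hx₀
    simpa using this
  -- a contraction that is close to `T`
  set η : ℝ := min (1 / 2) (r / (R + 1)) with hη
  have hη0 : 0 < η := by positivity
  have hη1 : η ≤ 1 / 2 := min_le_left _ _
  have hηr : η * R ≤ r := by
    have h1 : η ≤ r / (R + 1) := min_le_right _ _
    rw [le_div_iff₀ (by linarith)] at h1
    nlinarith
  let f : E → E := fun x => (1 - η) • T x + η • x₀
  have hf : Set.MapsTo f K K := fun x hx =>
    hc (hT hx) hx₀ (by linarith) hη0.le (by ring)
  have hcontr : ContractingWith (Real.toNNReal (1 - η)) (hf.restrict f K K) := by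
    refine ⟨by rw [← NNReal.coe_lt_coe, Real.coe_toNNReal _ (by linarith)]; simpa using hη0,
      LipschitzWith.of_dist_le_mul fun x y => ?_⟩
    rw [Real.coe_toNNReal _ (by linarith), Subtype.dist_eq, Subtype.dist_eq]
    simp only [Set.MapsTo.val_restrict_apply, f]
    rw [dist_add_right, dist_smul₀, Real.norm_of_nonneg (by linarith)]
    exact mul_le_mul_of_nonneg_left (hl _ x.2 _ y.2) (by linarith)
  obtain ⟨x, hx, hfix, -⟩ := hcontr.exists_fixedPoint' hK.isComplete hf hx₀ (edist_ne_top _ _)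
  have h1 : dist (T z) z ≤ dist (T x) x := hmin hx
  have h2 : dist (T x) x = η * dist (T x) x₀ := by
    nth_rewrite 2 [← hfix.eq]
    simp only [f]
    rw [dist_eq_norm, dist_eq_norm, show T x - ((1 - η) • T x + η • x₀) = η • (T x - x₀) by
      module, norm_smul, Real.norm_of_nonneg hη0.le]
  have h3 : dist (T x) x₀ ≤ R := hR (hT hx)
  have h4 := mul_le_mul_of_nonneg_left h3 hη0.le
  linarith

section

variable {V : Type*} {N : ExchangeNetwork V} {M : N.graph.Subgraph} {γ : V → ℝ} {σ : ℝ}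
  {lev : V → ℕ} {τ : ℕ → ℝ}

local notation "Err" => err N M γ lev τ
local notation "Tgt" => target N M γ lev τ

open Filter Topology in
theorem exists_small_pos [Finite V] {σ : ℝ} (hσ : 0 < σ) {g : V → ℝ} {P : V → Prop}
    (hg : ∀ i, P i → 0 < g i) {g' : V → V → ℝ} {P' : V → V → Prop}
    (hg' : ∀ i j, P' i j → 0 < g' i j) :
    ∃ δ, 0 < δ ∧ 4 * δ ≤ σ ∧ (∀ i, P i → δ ≤ g i) ∧ ∀ i j, P' i j → δ ≤ g' i j := by
  have h0 : ∀ᶠ δ in 𝓝[>] (0 : ℝ), 0 < δ := eventually_mem_nhdsWithin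
  have small : ∀ c : ℝ, 0 < c → ∀ᶠ δ in 𝓝[>] (0 : ℝ), δ ≤ c := fun c hc =>
    nhdsWithin_le_nhds (Iic_mem_nhds hc)
  have h1 := small (σ / 4) (by linarith)
  have h2 : ∀ᶠ δ in 𝓝[>] (0 : ℝ), ∀ i, P i → δ ≤ g i := by
    refine eventually_all.2 fun i => ?_
    by_cases h : P i
    · filter_upwards [small _ (hg i h)] with δ hδ _ using hδ
    · exact Eventually.of_forall fun δ h' => absurd h' h
  have h3 : ∀ᶠ δ in 𝓝[>] (0 : ℝ), ∀ i j, P' i j → δ ≤ g' i j := by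
    refine eventually_all.2 fun i => eventually_all.2 fun j => ?_
    by_cases h : P' i j
    · filter_upwards [small _ (hg' i j h)] with δ hδ _ using hδ
    · exact Eventually.of_forall fun δ h' => absurd h' h
  obtain ⟨δ, a, b, c, d⟩ := (h0.and (h1.and (h2.and h3))).exists
  exact ⟨δ, a, by linarith, c, d⟩

/-- The messages whose errors vanish below level `q`, are `± δ` on level `q`, and are at most `δ` above. -/
def perturbed (N : ExchangeNetwork V) (M : N.graph.Subgraph) (γ : V → ℝ)
    (lev : V → ℕ) (τ : ℕ → ℝ) (q : ℕ) (s : V → ℝ) (δ : ℝ) : Set (V → V → ℝ) :=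
  {α | ∀ i j, (¬ N.graph.Adj i j → α i j = 0) ∧ (N.graph.Adj i j → 0 ≤ α i j ∧
    |err N M γ lev τ α i j| ≤ δ ∧ (lev i < q → err N M γ lev τ α i j = 0) ∧
    (lev i = q → err N M γ lev τ α i j = δ * s i))}

/-- A sign for the nodes of level `q` that alternates along matched edges and tight edges. -/
structure IsAlternatingSign (N : ExchangeNetwork V) (M : N.graph.Subgraph) (γ : V → ℝ)
    (lev : V → ℕ) (τ : ℕ → ℝ) (q : ℕ) (s : V → ℝ) : Prop where
  sign : ∀ i, lev i = q → s i = 1 ∨ s i = -1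
  partner : ∀ i j, lev i = q → M.Adj i j → s j = - s i
  tight : ∀ i k, lev i = q → Tight N M γ lev τ i k → s k = - s i
  exists_tight : ∀ i, lev i = q → ∃ k, Tight N M γ lev τ i k

theorem IsAlternatingSign.neg {q : ℕ} {s : V → ℝ} (h : IsAlternatingSign N M γ lev τ q s) :
    IsAlternatingSign N M γ lev τ q (fun i => - s i) where
  sign i hi := by rcases h.sign i hi with h | h <;> simp [h]
  partner i j hi hij := by rw [h.partner i j hi hij]
  tight i k hi hik := by rw [h.tight i k hi hik]
  exists_tight := h.exists_tight

/-- The targets of level `q` are shifted by `δ * s`. At negative nodes `hx` leaves the room that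
keeps the messages nonnegative. -/
theorem Layering.exists_mem_perturbed [Finite V] (L : Layering N M γ σ lev τ) {q : ℕ} (hq : q ≠ 0)
    {s : V → ℝ} (hs : ∀ i, lev i = q → s i = 1 ∨ s i = -1) {δ : ℝ} (hδ : 0 < δ) (hδσ : 4 * δ ≤ σ)
    (hx : ∀ i, lev i = q ∧ s i = -1 → δ ≤ γ i - τ q) : (perturbed N M γ lev τ q s δ).Nonempty := by
  classical
  refine ⟨fun i j => if N.graph.Adj i j then Tgt i j + (if lev i = q then δ * s i else 0) else 0,
    fun i j => ⟨fun h => if_neg h, fun h => ?_⟩⟩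
  simp only [err, if_pos h, add_sub_cancel_left]
  have h0 := L.target_nonneg i j
  refine ⟨?_, ?_, ?_, ?_⟩
  · split_ifs with hi
    · rcases hs i hi with h1 | h1
      · rw [h1]; linarith
      · have h2 := hx i ⟨hi, h1⟩
        have h3 := L.sigma_le i (hi ▸ hq)
        rw [hi] at h3
        have : δ ≤ Tgt i j := by
          by_cases hM : M.Adj i j
          · rw [target_of_adj hM, hi]; exact h2
          · rw [target_of_not_adj hM]; linarith
        rw [h1]; linarith
    · linarith
  · split_ifs with hi
    · rcases hs i hi with h1 | h1 <;> rw [h1] <;> simp [abs_of_pos hδ]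
    · simpa using hδ.le
  · intro hi; rw [if_neg hi.ne]
  · intro hi; rw [if_pos hi]

/-- Tight edges reverse the sign of the error, and so does the sign `s`; half the difference along a
matched edge reproduces `δ * s i`. A positive node is raised by one tight neighbour. A negative node
can be lowered only if no other alternative holds it up: `hx` rules out the alternative 0, `hx'`
those on lower levels, and the gap the remaining ones. -/
theorem Layering.update_mem_perturbed [Finite V] (L : Layering N M γ σ lev τ) {q : ℕ} (hq : q ≠ 0)
    {s : V → ℝ} (hs : IsAlternatingSign N M γ lev τ q s) {δ : ℝ} (hδ : 0 < δ) (hδσ : 4 * δ ≤ σ)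
    (hx : ∀ i, lev i = q ∧ s i = -1 → δ ≤ γ i - τ q)
    (hx' : ∀ i k, (lev i = q ∧ s i = -1) ∧ N.graph.Adj i k ∧ ¬ M.Adj i k ∧ lev k < q →
      δ ≤ N.slack γ i k - τ q) {α : V → V → ℝ} (hα : α ∈ perturbed N M γ lev τ q s δ)
    (i j : V) :
    0 ≤ update N α i j ∧ |update N α i j - Tgt i j| ≤ δ ∧ (lev i < q → update N α i j - Tgt i j = 0) ∧
      (lev i = q → update N α i j - Tgt i j = δ * s i) := by
  have hσ := L.sigma_pos
  have nonneg : ∀ i j, N.graph.Adj i j → 0 ≤ α i j := fun i j h => ((hα i j).2 h).1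
  have all : ∀ i j, N.graph.Adj i j → |Err α i j| ≤ δ := fun i j h => ((hα i j).2 h).2.1
  have low : ∀ i j, N.graph.Adj i j → lev i < q → Err α i j = 0 := fun i j h => ((hα i j).2 h).2.2.1
  have mid : ∀ i j, N.graph.Adj i j → lev i = q → Err α i j = δ * s i :=
    fun i j h => ((hα i j).2 h).2.2.2
  have bound : ∀ r ≤ q, ErrBound N M γ σ lev τ δ 0 r α := fun r hr =>
    ErrBound.of_all nonneg all le_rfl (by linarith) fun i j hi hij => by
      rw [low i j hij (by omega), abs_zero]
  refine ⟨update_nonneg N nonneg i j, L.abs_update_all nonneg hδ.le all i j, fun hi => ?_,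
    fun hi => ?_⟩
  · refine abs_nonpos_iff.1 ?_
    by_cases h0 : lev i = 0
    · exact L.abs_update_zero h0 (bound 0 (by omega))
    · exact L.abs_update_level h0 (bound _ hi.le) le_rfl
        (fun k l hk hkl => by rw [low k l hkl (by omega), abs_zero])
  · have h0 : lev i ≠ 0 := hi ▸ hq
    have hb := bound (lev i) hi.le
    have hτ := L.sigma_le i h0
    have hγ := L.le_gamma i h0
    obtain ⟨p, hp⟩ := L.exists_partner h0
    have hlp : lev p = q := (L.lev_partner i p hp).symm.trans hi
    have ep := mid p i (M.adj_sub hp).symm hlp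
    have ei := mid i p (M.adj_sub hp) hi
    rw [hs.partner i p hi hp] at ep
    obtain ⟨k, hk⟩ := hs.exists_tight i hi
    have ek := mid k i hk.1.symm (hk.2.2.1.trans hi)
    have eik := mid i k hk.1 hi
    rw [hs.tight i k hi hk] at ek
    rcases hs.sign i hi with h1 | h1
    · rw [h1] at ep ei ek eik ⊢
      refine le_antisymm ?_ ?_
      · by_cases hM : M.Adj i j
        · refine L.signed_update_true_adj hM hb (by linarith) fun k hk => ?_
          rw [mid k i hk.1.symm (hk.2.2.1.trans hi), hs.tight i k hi hk, h1]
          linarith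
        · refine L.signed_update_not_adj true hp hM hb (by linarith) ?_
          simp only [signed, Bool.not_true, if_true, Bool.false_eq_true, if_false]
          linarith
      · by_cases hM : M.Adj i j
        · exact le_update_adj hM hk.1 hk.2.1 hk.2.2.2 (by linarith) (by linarith)
        · exact L.le_update_not_adj hp hM (by linarith) (by linarith)
    · rw [h1] at ep ei ek eik ⊢
      refine le_antisymm ?_ ?_
      · by_cases hM : M.Adj i j
        · refine L.update_adj_le hM ?_ fun k hk hk' => ?_
          · have := hx i ⟨hi, h1⟩
            rw [hi]
            linarith
          · have hD := neg_le_of_abs_le (all k i hk.symm)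
            rcases lt_trichotomy (lev k) (lev i) with h2 | h2 | h2
            · have h3 := hx' i k ⟨⟨hi, h1⟩, hk, hk', by omega⟩
              rw [low k i hk.symm (by omega), hi]
              linarith
            · rcases L.slack_same i k hk hk' h0 h2 with h3 | h3
              · rw [mid k i hk.symm (h2.trans hi), hs.tight i k hi ⟨hk, hk', h2, h3⟩, h1]
                linarith
              · linarith
            · have := L.slack_up i k hk h0 h2
              linarith
        · refine L.update_not_adj_le hp hM (by linarith) (by linarith) fun k hk hk' => ?_
          have hD := neg_le_of_abs_le (all k i hk.symm)
          have := L.sigma_le_slack hk hk'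
          linarith
      · by_cases hM : M.Adj i j
        · exact le_update_adj hM hk.1 hk.2.1 hk.2.2.2 (by linarith) (by linarith)
        · exact L.le_update_not_adj hp hM (by linarith) (by linarith)

/-- A fixed point of the update near the messages of `(M, γ)` comes from a Nash bargaining solution. -/
theorem Layering.isNashBargaining_of_fixedPoint [Finite V] (L : Layering N M γ σ lev τ) {δ : ℝ}
    (hδ : 0 < δ) (hδσ : 4 * δ ≤ σ) {α : V → V → ℝ} (nonneg : ∀ i j, N.graph.Adj i j → 0 ≤ α i j)
    (all : ∀ i j, N.graph.Adj i j → |Err α i j| ≤ δ)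
    (hfix : ∀ i j, N.graph.Adj i j → update N α i j = α i j) :
    IsNashBargaining N M (earning N α) ∧
      ∀ i k, N.graph.Adj i k → ¬ M.Adj i k → α i k = earning N α i := by
  have hσ := L.sigma_pos
  have near := L.abs_earning_sub_le nonneg hδ.le all
  have off_nonneg : ∀ i k, N.graph.Adj i k → 0 ≤ offer N α k i := fun i k h =>
    offer_nonneg N (nonneg i k h)
  -- With errors at most `σ / 4` the partner's offer is at least `γ i - δ`, while a positive offer
  -- of anyone else is at most `γ i - σ + δ`.
  have hpart : ∀ i p, M.Adj i p → earning N α i = offer N α p i := by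
    intro i p hp
    refine le_antisymm (N.nbrMax_le (off_nonneg i p (M.adj_sub hp)) fun k hk => ?_)
      (N.le_nbrMax (fun k => offer N α k i) (M.adj_sub hp))
    by_cases hk' : M.Adj i k
    · rw [L.partner_unique hp hk']
    · have h1 := abs_le.1 (all i p (M.adj_sub hp))
      have h2 := abs_le.1 (all p i (M.adj_sub hp).symm)
      have h3 := abs_le.1 (all k i hk.symm)
      have h4 := L.sigma_le i (L.lev_ne_zero_of_adj hp)
      have h5 := L.le_offer_partner (α := α) (c := -δ) hp (by linarith) (by linarith)
      have h6 := L.sigma_le_slack hk hk'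
      have h7 := L.le_gamma i (L.lev_ne_zero_of_adj hp)
      exact ((offer_other_le (γ := γ) (lev := lev) (τ := τ) α hk').trans
        (max_le (by linarith) (by linarith))).trans h5
  have hun : ∀ i, lev i = 0 → ∀ k, N.graph.Adj i k → offer N α k i = 0 := by
    intro i hi k hk
    have hk' : ¬ M.Adj i k := fun h => L.lev_ne_zero_of_adj h hi
    refine le_antisymm ?_ (off_nonneg i k hk)
    have h3 := abs_le.1 (all k i hk.symm)
    have h6 := L.sigma_le_slack hk hk'
    exact (offer_other_le (γ := γ) (lev := lev) (τ := τ) α hk').trans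
      (max_le (by linarith [L.gamma_zero i hi]) le_rfl)
  have hun' : ∀ i, lev i = 0 → earning N α i = 0 := fun i hi =>
    le_antisymm (N.nbrMax_le le_rfl fun k hk => (hun i hi k hk).le)
      (N.nbrMax_nonneg fun k hk => off_nonneg i k hk)
  have exact_offer : ∀ i p, M.Adj i p →
      offer N α p i = (N.weight s(i, p) - α p i + α i p) / 2 := by
    intro i p hp
    have h1 := abs_le.1 (all i p (M.adj_sub hp))
    have h2 := abs_le.1 (all p i (M.adj_sub hp).symm)
    have e1 := eq_err_add (N := N) (M := M) (γ := γ) (lev := lev) (τ := τ) α p i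
    have e2 := eq_err_add (N := N) (M := M) (γ := γ) (lev := lev) (τ := τ) α i p
    rw [target_of_adj hp.symm] at e1
    rw [target_of_adj hp] at e2
    have e3 := L.traded i p hp
    have e4 := L.sigma_le i (L.lev_ne_zero_of_adj hp)
    rw [← L.lev_partner i p hp] at e1
    have e5 := nonneg i p (M.adj_sub hp)
    have : 0 ≤ N.weight s(i, p) - α p i - α i p := by linarith
    unfold offer
    rw [Sym2.eq_swap, max_eq_left this, max_eq_left (by linarith)]
    ring
  have hout : ∀ i k, N.graph.Adj i k → ¬ M.Adj i k → α i k = earning N α i := by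
    intro i k hk hk'
    rw [← hfix i k hk]
    refine le_antisymm ?_ ?_
    · exact N.nbrMaxExcept_le (N.nbrMax_nonneg fun k hk => off_nonneg i k hk)
        fun l hl _ => N.le_nbrMax (fun k => offer N α k i) hl
    · by_cases h0 : lev i = 0
      · rw [hun' i h0]
        exact update_nonneg N nonneg i k
      · obtain ⟨p, hp⟩ := L.exists_partner h0
        rw [hpart i p hp]
        exact N.le_nbrMaxExcept (fun k => offer N α k i) (M.adj_sub hp)
          (by rintro rfl; exact hk' hp)
  have hbest : ∀ i p, M.Adj i p → bestAlternative N (earning N α) i p = α i p := by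
    intro i p hp
    rw [← hfix i p (M.adj_sub hp)]
    refine iSup_congr fun ⟨k, hk, hkp⟩ => ?_
    have hk' := L.not_adj_of_ne hp hkp
    have h1 := abs_le.1 (near i)
    have h2 := abs_le.1 (near k)
    have h3 := L.sigma_le_slack hk hk'
    have h4 := weight_eq_slack N γ i k
    -- Both messages along an unmatched edge are earnings. Their sum is at least the weight, since
    -- the slack `σ` exceeds twice the error, so the second term of the offer vanishes and the
    -- truncated alternative is left.
    simp only [offer]
    rw [hout i k hk hk', hout k i hk.symm (fun h => hk' h.symm), Sym2.eq_swap (a := k),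
      max_eq_right (a := N.weight s(i, k) - earning N α k - earning N α i) (by linarith)]
    ring
  refine ⟨⟨L.matching, fun i => N.nbrMax_nonneg fun k hk => off_nonneg i k hk,
    fun i hi => hun' i ((L.lev_eq_zero i).2 hi), fun i p hp => ?_, fun i k hk hk' => ?_,
    fun i p hp => ?_⟩, hout⟩
  · rw [hpart i p hp, hpart p i hp.symm, exact_offer i p hp, exact_offer p i hp.symm,
      Sym2.eq_swap (a := p)]
    ring
  · have h1 := abs_le.1 (near i)
    have h2 := abs_le.1 (near k)
    have h3 := L.sigma_le_slack hk hk'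
    have h4 := weight_eq_slack N γ i k
    linarith
  · rw [hbest i p hp, hbest p i hp.symm, hpart i p hp, hpart p i hp.symm, exact_offer i p hp,
      exact_offer p i hp.symm, Sym2.eq_swap (a := p)]
    ring

theorem isCompact_perturbed [Fintype V] (q : ℕ) (s : V → ℝ) (δ : ℝ) :
    IsCompact (perturbed N M γ lev τ q s δ) := by
  classical
  refine Metric.isCompact_of_isClosed_isBounded ?_ ?_
  · have c1 : ∀ i j : V, Continuous fun α : V → V → ℝ => α i j := fun i j => by fun_prop
    have c2 : ∀ i j : V, Continuous fun α : V → V → ℝ => Err α i j := fun i j => by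
      unfold err; fun_prop
    simp only [perturbed, Set.ofPred_forall, Set.ofPred_and]
    refine isClosed_iInter fun i => isClosed_iInter fun j => IsClosed.inter ?_ ?_
    · exact isClosed_iInter fun _ => isClosed_eq (c1 i j) continuous_const
    · refine isClosed_iInter fun _ => IsClosed.inter ?_ (IsClosed.inter ?_ (IsClosed.inter ?_ ?_))
      · exact isClosed_le continuous_const (c1 i j)
      · exact isClosed_le (c2 i j).abs continuous_const
      · exact isClosed_iInter fun _ => isClosed_eq (c2 i j) continuous_const
      · exact isClosed_iInter fun _ => isClosed_eq (c2 i j) continuous_const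
  · refine (Metric.isBounded_closedBall (x := fun i j => if N.graph.Adj i j then Tgt i j else 0)
      (r := max δ 0)).subset fun α hα => ?_
    rw [Metric.mem_closedBall, dist_pi_le_iff (le_max_right _ _)]
    refine fun i => (dist_pi_le_iff (le_max_right _ _)).2 fun j => ?_
    rw [Real.dist_eq]
    by_cases h : N.graph.Adj i j
    · rw [if_pos h]
      exact ((hα i j).2 h).2.1.trans (le_max_left _ _)
    · rw [if_neg h, (hα i j).1 h, sub_zero, abs_zero]
      exact le_max_right _ _

theorem convex_perturbed (q : ℕ) (s : V → ℝ) (δ : ℝ) :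
    Convex ℝ (perturbed N M γ lev τ q s δ) := by
  intro α hα β hβ a b ha hb hab i j
  have e : Err (a • α + b • β) i j = a * Err α i j + b * Err β i j := by
    simp only [err, Pi.add_apply, Pi.smul_apply, smul_eq_mul]
    linear_combination (Tgt i j) * hab
  have h1 := hα i j
  have h2 := hβ i j
  refine ⟨fun h => ?_, fun h => ⟨?_, ?_, fun hi => ?_, fun hi => ?_⟩⟩
  · simp [h1.1 h, h2.1 h]
  · have := (h1.2 h).1
    have := (h2.2 h).1
    simp only [Pi.add_apply, Pi.smul_apply, smul_eq_mul]
    positivity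
  · have h3 := (h1.2 h).2.1
    have h4 := (h2.2 h).2.1
    rw [e]
    refine (abs_add_le _ _).trans ?_
    rw [abs_mul, abs_mul, abs_of_nonneg ha, abs_of_nonneg hb]
    calc a * |Err α i j| + b * |Err β i j| ≤ a * δ + b * δ := by gcongr
      _ = δ := by rw [← add_mul, hab, one_mul]
  · rw [e, (h1.2 h).2.2.1 hi, (h2.2 h).2.2.1 hi]; ring
  · rw [e, (h1.2 h).2.2.2 hi, (h2.2 h).2.2.2 hi]
    linear_combination (δ * s i) * hab

/-- If the solution is unique, then an alternating sign cannot be used to perturb it, so that there is an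
exit at a negative node. -/
theorem Layering.exists_exit [Fintype V] (L : Layering N M γ σ lev τ)
    (huniq : ∀ (M' : N.graph.Subgraph) (γ' : V → ℝ), IsNashBargaining N M' γ' → M' = M ∧ γ' = γ)
    {q : ℕ} (hq : q ≠ 0) {s : V → ℝ} (hs : IsAlternatingSign N M γ lev τ q s) {i₀ : V}
    (hi₀ : lev i₀ = q) : ∃ o, lev o = q ∧ s o = -1 ∧ Exit N M γ lev τ o := by
  classical
  by_contra! hno
  obtain ⟨δ, hδ, hδσ, hx, hx'⟩ := exists_small_pos L.sigma_pos
    (P := fun i => lev i = q ∧ s i = -1) (g := fun i => γ i - τ q)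
    (P' := fun i k => (lev i = q ∧ s i = -1) ∧ N.graph.Adj i k ∧ ¬ M.Adj i k ∧ lev k < q)
    (g' := fun i k => N.slack γ i k - τ q)
    (fun i ⟨hi, h1⟩ => by
      have h2 := L.le_gamma i (hi ▸ hq)
      rw [hi] at h2
      refine sub_pos.2 (lt_of_le_of_ne h2 fun h3 => hno i hi h1 (Or.inl ?_))
      rw [hi, h3])
    (fun i k ⟨⟨hi, h1⟩, hk, hk', hl⟩ => by
      have h2 := L.slack_down i k hk hk' (hi ▸ hq) (by omega)
      rw [hi] at h2
      refine sub_pos.2 (lt_of_le_of_ne h2 fun h3 =>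
        hno i hi h1 (Or.inr ⟨k, hk, hk', by omega, ?_⟩))
      rw [hi, h3])
  -- Entries off the edges are set to 0; `perturbed` requires this in order to be bounded.
  let T : (V → V → ℝ) → V → V → ℝ := fun α i j => if N.graph.Adj i j then update N α i j else 0
  obtain ⟨α, hα, hfix⟩ := exists_fixedPoint_of_nonexpansive (T := T)
    (isCompact_perturbed (N := N) (M := M) (γ := γ) (lev := lev) (τ := τ) q s δ)
    (convex_perturbed q s δ) (L.exists_mem_perturbed hq hs.sign hδ hδσ hx)
    (fun α hα i j => ⟨fun h => if_neg h, fun h => by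
      have := L.update_mem_perturbed hq hs hδ hδσ hx hx' hα i j
      simpa only [T, err, if_pos h] using this⟩)
    (fun α hα β hβ => by
      rw [dist_pi_le_iff dist_nonneg]
      refine fun i => (dist_pi_le_iff dist_nonneg).2 fun j => ?_
      simp only [T]
      split_ifs with h
      · rw [Real.dist_eq]
        refine abs_update_sub_le N (fun i j h => ((hα i j).2 h).1) (fun i j h => ((hβ i j).2 h).1)
          dist_nonneg (fun i j _ => ?_) i j
        rw [← Real.dist_eq]
        exact (dist_le_pi_dist (α i) (β i) j).trans (dist_le_pi_dist α β i)
      · simp)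
  have hfix' : ∀ i j, N.graph.Adj i j → update N α i j = α i j := fun i j h => by
    have := congrFun (congrFun hfix i) j
    simpa only [T, if_pos h] using this
  obtain ⟨hNB, hout⟩ := L.isNashBargaining_of_fixedPoint hδ hδσ (fun i j h => ((hα i j).2 h).1)
    (fun i j h => ((hα i j).2 h).2.1) hfix'
  have hγ := (huniq M _ hNB).2
  obtain ⟨k, hk⟩ := hs.exists_tight i₀ hi₀
  have h1 := hout i₀ k hk.1 hk.2.1
  have h2 := ((hα i₀ k).2 hk.1).2.2.2 hi₀
  -- By uniqueness the fixed point has error 0 at `i₀`, whereas membership in `perturbed` makes it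
  -- `δ` or `-δ`.
  rw [err, target_of_not_adj hk.2.1, h1, hγ, sub_self] at h2
  rcases hs.sign i₀ hi₀ with h3 | h3 <;> rw [h3] at h2 <;> linarith

end

/-! ### Charts from folded lines and folded cycles. -/

section

variable {V : Type*} {N : ExchangeNetwork V} {M : N.graph.Subgraph} {γ : V → ℝ} {σ : ℝ}
  {lev : V → ℕ} {τ : ℕ → ℝ} {q : ℕ}

theorem Tight.symm {i k : V} (h : Tight N M γ lev τ i k) : Tight N M γ lev τ k i :=
  ⟨h.1.symm, fun h' => h.2.1 h'.symm, h.2.2.1.symm, by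
    rw [N.slack_comm, h.2.2.2, h.2.2.1]⟩

/-- The sequences `p` and `p'` list the nodes of level `q` on a line that is folded at site `n - 1`. -/
structure IsFoldedLine (N : ExchangeNetwork V) (M : N.graph.Subgraph) (γ : V → ℝ)
    (lev : V → ℕ) (τ : ℕ → ℝ) (q n : ℕ) (p p' : ℕ → V) : Prop where
  lev_eq : ∀ y < n, lev (p y) = q
  adj : ∀ y, Even y → y + 1 < n → M.Adj (p y) (p (y + 1))
  adj_last : Odd n → M.Adj (p (n - 1)) (p' (n - 1))
  tight : ∀ y, Odd y → y + 1 < n → Tight N M γ lev τ (p y) (p (y + 1))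
  tight_last : Even n → Exit N M γ lev τ (p (n - 1)) ∨ Tight N M γ lev τ (p (n - 1)) (p' (n - 1))
  exit : Exit N M γ lev τ (p 0)
  not_tight : ∀ k, ¬ Tight N M γ lev τ (p 0) k
  of_tight : ∀ y < n, ∀ k, Tight N M γ lev τ (p y) k →
    k = p (pairing 1 n y) ∨ k = p' (pairing 1 n y)

/-- The chart of a folded line. -/
theorem IsFoldedLine.isChart (hM : M.IsMatching) {n : ℕ} {p p' : ℕ → V}
    (h : IsFoldedLine N M γ lev τ q n p p') (h' : IsFoldedLine N M γ lev τ q n p' p) :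
    IsChart N M γ lev τ q 0 n (fun _ i y => y < n ∧ (i = p y ∨ i = p' y)) := by
  have key : ∀ {p p' : ℕ → V}, IsFoldedLine N M γ lev τ q n p p' → ∀ y < n, ∀ x, M.Adj (p y) x →
      x = p (pairing 0 n y) ∨ x = p' (pairing 0 n y) := by
    intro p p' h y hy x hx
    unfold pairing
    rcases Nat.even_or_odd y with he | ho
    · rw [if_pos (by simpa using Nat.even_iff.1 he)]
      split_ifs with h1
      · exact Or.inl (hM.eq_of_adj_left hx (h.adj y he h1))
      · obtain rfl : n = y + 1 := by omega
        exact Or.inr (hM.eq_of_adj_left hx (h.adj_last he.add_one))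
    · have h2 := Nat.odd_iff.1 ho
      rw [if_neg (by omega)]
      have h3 := h.adj (y - 1) (Nat.even_iff.2 (by omega)) (by omega)
      rw [show y - 1 + 1 = y by omega] at h3
      exact Or.inl (hM.eq_of_adj_left hx h3.symm)
  have key' : ∀ {p p' : ℕ → V}, IsFoldedLine N M γ lev τ q n p p' → ∀ y < n,
      Exit N M γ lev τ (p y) ∨ Tight N M γ lev τ (p y) (p (pairing 1 n y)) ∨
        Tight N M γ lev τ (p y) (p' (pairing 1 n y)) := by
    intro p p' h y hy
    unfold pairing
    rcases Nat.even_or_odd y with he | ho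
    · have h2 := Nat.even_iff.1 he
      rw [if_neg (by omega)]
      rcases Nat.eq_zero_or_pos y with rfl | h0
      · exact Or.inl h.exit
      · have h3 := h.tight (y - 1) (Nat.odd_iff.2 (by omega)) (by omega)
        rw [show y - 1 + 1 = y by omega] at h3
        exact Or.inr (Or.inl h3.symm)
    · have h2 := Nat.odd_iff.1 ho
      rw [if_pos (by omega)]
      split_ifs with h1
      · exact Or.inr (Or.inl (h.tight y ho h1))
      · obtain rfl : n = y + 1 := by omega
        rcases h.tight_last ho.add_one with h3 | h3
        · exact Or.inl h3
        · exact Or.inr (Or.inr h3)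
  refine ⟨zero_le_one, ?_, ?_, ?_, ?_⟩
  · rintro _ i y ⟨hy, rfl | rfl⟩
    · exact ⟨h.lev_eq y hy, hy⟩
    · exact ⟨h'.lev_eq y hy, hy⟩
  · rintro _ i y x ⟨hy, rfl | rfl⟩ hx
    · exact ⟨pairing_lt hy, key h y hy x hx⟩
    · exact ⟨pairing_lt hy, (key h' y hy x hx).symm⟩
  · rintro i y k ⟨hy, rfl | rfl⟩ hk
    · exact ⟨pairing_lt hy, h.of_tight y hy k hk⟩
    · exact ⟨pairing_lt hy, (h'.of_tight y hy k hk).symm⟩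
  · rintro i y ⟨hy, rfl | rfl⟩
    · rcases key' h y hy with h1 | h1 | h1
      · exact Or.inl h1
      · exact Or.inr ⟨_, h1, pairing_lt hy, Or.inl rfl⟩
      · exact Or.inr ⟨_, h1, pairing_lt hy, Or.inr rfl⟩
    · rcases key' h' y hy with h1 | h1 | h1
      · exact Or.inl h1
      · exact Or.inr ⟨_, h1, pairing_lt hy, Or.inr rfl⟩
      · exact Or.inr ⟨_, h1, pairing_lt hy, Or.inl rfl⟩

/-- The node at site 0 has an exit and no tight edge, so its message to the partner is dead in both
modes, and one chart serves both. -/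
theorem IsFoldedLine.isCharted (hM : M.IsMatching) {n b : ℕ} (hn : 0 < n) (hb : n ≤ b)
    {p p' : ℕ → V} (h : IsFoldedLine N M γ lev τ q n p p')
    (h' : IsFoldedLine N M γ lev τ q n p' p)
    (hcover : ∀ i, lev i = q → ∃ y < n, i = p y ∨ i = p' y) : IsCharted N M γ lev τ q b := by
  refine Or.inl fun m i hi => ?_
  obtain ⟨y, hy, hiy⟩ := hcover i hi
  refine ⟨0, n, _, y, hn, hb, h.isChart hM h', ⟨hy, hiy⟩, ?_⟩
  rintro m' i' x ⟨-, rfl | rfl⟩ -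
  · cases m'
    · exact Or.inl h.exit
    · exact Or.inl h.not_tight
  · cases m'
    · exact Or.inl h'.exit
    · exact Or.inl h'.not_tight

/-- The sequences `p` and `p'` list the nodes of level `q` on two closed walks of even length `L`, which
share the matched edge that joins their last and first nodes. -/
structure IsFoldedCycle (N : ExchangeNetwork V) (M : N.graph.Subgraph) (γ : V → ℝ)
    (lev : V → ℕ) (τ : ℕ → ℝ) (q L : ℕ) (p p' : ℕ → V) : Prop where
  lev_eq : ∀ j < L, lev (p j) = q
  adj : ∀ j, Odd j → j + 1 < L → M.Adj (p j) (p (j + 1))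
  adj_last : M.Adj (p (L - 1)) (p 0)
  tight : ∀ j, Even j → j + 1 < L → Tight N M γ lev τ (p j) (p (j + 1))
  of_tight : ∀ j < L, ∀ k, Tight N M γ lev τ (p j) k →
    k = p (if j % 2 = 0 then j + 1 else j - 1) ∨ k = p' (if j % 2 = 0 then j + 1 else j - 1)

/-- The mode in which the closed walks visit the position `j`. -/
def walkMode (m₀ : Bool) (j : ℕ) : Bool := if j % 2 = 0 then m₀ else !m₀

/-- The chart of a folded cycle: the positions `j` and `L - 1 - j` are at the same site. -/
theorem IsFoldedCycle.isChart (hM : M.IsMatching) {n : ℕ} {p p' : ℕ → V}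
    (h : IsFoldedCycle N M γ lev τ q (2 * n) p p') (h' : IsFoldedCycle N M γ lev τ q (2 * n) p' p)
    (m₀ : Bool) :
    IsChart N M γ lev τ q 1 n (fun m i y => ∃ j < 2 * n, m = walkMode m₀ j ∧
      (i = p j ∨ i = p' j) ∧ y = min j (2 * n - 1 - j)) := by
  have key : ∀ {p p' : ℕ → V}, IsFoldedCycle N M γ lev τ q (2 * n) p p' → ∀ j < 2 * n, ∀ x,
      M.Adj (p j) x → ∃ j' < 2 * n, (!walkMode m₀ j) = walkMode m₀ j' ∧ x = p j' ∧
        pairing 1 n (min j (2 * n - 1 - j)) = min j' (2 * n - 1 - j') := by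
    intro p p' h j hj x hx
    rcases Nat.even_or_odd j with he | ho
    · have h2 := Nat.even_iff.1 he
      rcases Nat.eq_zero_or_pos j with rfl | h0
      · refine ⟨2 * n - 1, by omega, ?_, hM.eq_of_adj_left hx h.adj_last.symm, ?_⟩
        · unfold walkMode
          rw [if_pos rfl, if_neg (by omega)]
        · unfold pairing; split_ifs <;> omega
      · have h3 := h.adj (j - 1) (Nat.odd_iff.2 (by omega)) (by omega)
        rw [show j - 1 + 1 = j by omega] at h3
        refine ⟨j - 1, by omega, ?_, hM.eq_of_adj_left hx h3.symm, ?_⟩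
        · unfold walkMode
          rw [if_pos h2, if_neg (by omega)]
        · unfold pairing; split_ifs <;> omega
    · have h2 := Nat.odd_iff.1 ho
      by_cases h1 : j + 1 < 2 * n
      · refine ⟨j + 1, h1, ?_, hM.eq_of_adj_left hx (h.adj j ho h1), ?_⟩
        · unfold walkMode
          rw [if_neg (by omega), if_pos (by omega), Bool.not_not]
        · unfold pairing; split_ifs <;> omega
      · obtain rfl : j = 2 * n - 1 := by omega
        refine ⟨0, by omega, ?_, hM.eq_of_adj_left hx h.adj_last, ?_⟩
        · unfold walkMode
          rw [if_neg (by omega), if_pos (by omega), Bool.not_not]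
        · unfold pairing; split_ifs <;> omega
  have site : ∀ j < 2 * n, pairing (1 + 1) n (min j (2 * n - 1 - j)) =
      min (if j % 2 = 0 then j + 1 else j - 1)
        (2 * n - 1 - (if j % 2 = 0 then j + 1 else j - 1)) := by
    intro j hj
    unfold pairing; split_ifs <;> omega
  have lt : ∀ j < 2 * n, (if j % 2 = 0 then j + 1 else j - 1) < 2 * n := by
    intro j hj
    split_ifs <;> omega
  have mode : ∀ j < 2 * n, (!walkMode m₀ j) = walkMode m₀ (if j % 2 = 0 then j + 1 else j - 1) := by
    intro j hj
    unfold walkMode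
    rcases Nat.mod_two_eq_zero_or_one j with h2 | h2
    · rw [if_pos h2, if_pos h2, if_neg (by omega)]
    · have h3 : ¬ j % 2 = 0 := by omega
      simp only [if_neg h3, if_pos (show (j - 1) % 2 = 0 by omega), Bool.not_not]
  have key' : ∀ {p p' : ℕ → V}, IsFoldedCycle N M γ lev τ q (2 * n) p p' → ∀ j < 2 * n,
      Tight N M γ lev τ (p j) (p (if j % 2 = 0 then j + 1 else j - 1)) := by
    intro p p' h j hj
    split_ifs with h1
    · exact h.tight j (Nat.even_iff.2 h1) (by omega)
    · have h3 := h.tight (j - 1) (Nat.even_iff.2 (by omega)) (by omega)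
      rw [show j - 1 + 1 = j by omega] at h3
      exact h3.symm
  refine ⟨le_rfl, ?_, ?_, ?_, ?_⟩
  · rintro _ i y ⟨j, hj, -, rfl | rfl, rfl⟩
    · exact ⟨h.lev_eq j hj, by omega⟩
    · exact ⟨h'.lev_eq j hj, by omega⟩
  · rintro _ i y x ⟨j, hj, rfl, rfl | rfl, rfl⟩ hx
    · obtain ⟨j', h1, h2, h3, h4⟩ := key h j hj x hx
      exact ⟨j', h1, h2, Or.inl h3, h4⟩
    · obtain ⟨j', h1, h2, h3, h4⟩ := key h' j hj x hx
      exact ⟨j', h1, h2, Or.inr h3, h4⟩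
  · rintro i y k ⟨j, hj, h0, rfl | rfl, rfl⟩ hk
    · exact ⟨_, lt j hj, by rw [← mode j hj, ← h0]; rfl, h.of_tight j hj k hk, site j hj⟩
    · exact ⟨_, lt j hj, by rw [← mode j hj, ← h0]; rfl, (h'.of_tight j hj k hk).symm, site j hj⟩
  · rintro i y ⟨j, hj, h0, rfl | rfl, rfl⟩
    · exact Or.inr ⟨_, key' h j hj, _, lt j hj, by rw [← mode j hj, ← h0]; rfl, Or.inl rfl,
        site j hj⟩
    · exact Or.inr ⟨_, key' h' j hj, _, lt j hj, by rw [← mode j hj, ← h0]; rfl, Or.inr rfl,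
        site j hj⟩

/-- `c 0, …, c ℓ = c 0` is an odd loop of tight edges and matched edges in level `q`, and the nodes
other than `c 0` have no other tight edges. -/
structure IsTightLoop (N : ExchangeNetwork V) (M : N.graph.Subgraph) (γ : V → ℝ)
    (lev : V → ℕ) (τ : ℕ → ℝ) (q ℓ : ℕ) (c : ℕ → V) : Prop where
  three_le : 3 ≤ ℓ
  odd : Odd ℓ
  closed : c ℓ = c 0
  injOn : Set.InjOn c (Set.Iio ℓ)
  lev_eq : ∀ r < ℓ, lev (c r) = q
  adj : ∀ r, Odd r → r < ℓ → M.Adj (c r) (c (r + 1))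
  tight : ∀ r, Even r → r < ℓ → Tight N M γ lev τ (c r) (c (r + 1))
  of_tight_odd : ∀ r, Odd r → r < ℓ → ∀ k, Tight N M γ lev τ (c r) k → k = c (r - 1)
  of_tight_even : ∀ r, Even r → 0 < r → r < ℓ → ∀ k, Tight N M γ lev τ (c r) k → k = c (r + 1)
  of_tight_zero : ∀ k, Tight N M γ lev τ (c 0) k → k = c 1 ∨ k = c (ℓ - 1)

theorem IsTightLoop.lev_eq' {ℓ : ℕ} {c : ℕ → V} (h : IsTightLoop N M γ lev τ q ℓ c) {r : ℕ}
    (hr : r ≤ ℓ) : lev (c r) = q := by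
  rcases hr.lt_or_eq with h1 | rfl
  · exact h.lev_eq r h1
  · rw [h.closed]
    exact h.lev_eq 0 (by have := h.three_le; omega)

/-- Reversal takes edge `r` to edge `ℓ - 1 - r`, which has the same parity because `ℓ` is odd. -/
theorem IsTightLoop.reverse {ℓ : ℕ} {c : ℕ → V} (h : IsTightLoop N M γ lev τ q ℓ c) :
    IsTightLoop N M γ lev τ q ℓ (fun r => c (ℓ - r)) := by
  have h3 := h.three_le
  have ho := Nat.odd_iff.1 h.odd
  have hz : ∀ k, Tight N M γ lev τ (c ℓ) k → k = c 1 ∨ k = c (ℓ - 1) := by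
    rw [h.closed]; exact h.of_tight_zero
  refine ⟨h3, h.odd, ?_, ?_, fun r hr => h.lev_eq' (Nat.sub_le _ _), ?_, ?_, ?_, ?_, ?_⟩
  · simp [h.closed]
  · intro a ha b hb hab
    simp only [Set.mem_Iio] at ha hb
    rcases Nat.eq_zero_or_pos a with rfl | ha' <;> rcases Nat.eq_zero_or_pos b with rfl | hb'
    · rfl
    · simp only [Nat.sub_zero, h.closed] at hab
      have := h.injOn (x₁ := 0) (by simp; omega) (by simp; omega) hab
      omega
    · simp only [Nat.sub_zero, h.closed] at hab
      have := h.injOn (x₂ := 0) (by simp; omega) (by simp; omega) hab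
      omega
    · have := h.injOn (by simp; omega) (by simp; omega) hab
      omega
  · intro r hr hrl
    have h1 := Nat.odd_iff.1 hr
    have h2 := h.adj (ℓ - r - 1) (Nat.odd_iff.2 (by omega)) (by omega)
    rw [show ℓ - r - 1 + 1 = ℓ - r by omega] at h2
    exact h2.symm
  · intro r hr hrl
    have h1 := Nat.even_iff.1 hr
    have h2 := h.tight (ℓ - r - 1) (Nat.even_iff.2 (by omega)) (by omega)
    rw [show ℓ - r - 1 + 1 = ℓ - r by omega] at h2
    exact h2.symm
  · intro r hr hrl k hk
    have h1 := Nat.odd_iff.1 hr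
    rw [h.of_tight_even (ℓ - r) (Nat.even_iff.2 (by omega)) (by omega) (by omega) k hk]
    congr 1
    omega
  · intro r hr h0 hrl k hk
    have h1 := Nat.even_iff.1 hr
    rw [h.of_tight_odd (ℓ - r) (Nat.odd_iff.2 (by omega)) (by omega) k hk]
    congr 1
  · intro k hk
    simp only [Nat.sub_zero] at hk
    rw [show ℓ - (ℓ - 1) = 1 by omega]
    exact (hz k hk).symm

/-- `s 0, …, s ℓ` is a path of matched edges and tight edges in level `q`, and the inner nodes have no
other tight edges. -/
structure IsTightStem (N : ExchangeNetwork V) (M : N.graph.Subgraph) (γ : V → ℝ)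
    (lev : V → ℕ) (τ : ℕ → ℝ) (q ℓ : ℕ) (s : ℕ → V) : Prop where
  odd : Odd ℓ
  injOn : Set.InjOn s (Set.Iic ℓ)
  lev_eq : ∀ a ≤ ℓ, lev (s a) = q
  adj : ∀ a, Even a → a < ℓ → M.Adj (s a) (s (a + 1))
  tight : ∀ a, Odd a → a < ℓ → Tight N M γ lev τ (s a) (s (a + 1))
  of_tight_odd : ∀ a, Odd a → a < ℓ → ∀ k, Tight N M γ lev τ (s a) k → k = s (a + 1)
  of_tight_even : ∀ a, Even a → 0 < a → a < ℓ → ∀ k, Tight N M γ lev τ (s a) k → k = s (a - 1)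

theorem le_card_level [Fintype {i // lev i = q}] {n : ℕ} {f : ℕ → V} (h : ∀ a < n, lev (f a) = q)
    (hf : Set.InjOn f (Set.Iio n)) : n ≤ Fintype.card {i // lev i = q} := by
  have := Fintype.card_le_of_injective (fun a : Fin n => (⟨f a, h a a.2⟩ : {i // lev i = q}))
    (fun a b hab => Fin.ext (hf a.2 b.2 (congrArg Subtype.val hab)))
  simpa using this

end

/-! ### Charts of paths, blossoms and bicycles. -/

section

variable {V : Type*} {N : ExchangeNetwork V} {M : N.graph.Subgraph} {γ : V → ℝ} {σ : ℝ}
  {lev : V → ℕ} {τ : ℕ → ℝ} {q : ℕ}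

/-- A level that consists of an alternating path. -/
theorem IsTightStem.isCharted [Fintype {i // lev i = q}] (hM : M.IsMatching) {ℓ : ℕ} {s : ℕ → V}
    (hs : IsTightStem N M γ lev τ q ℓ s) (h0 : Exit N M γ lev τ (s 0))
    (h0' : ∀ k, ¬ Tight N M γ lev τ (s 0) k) (h1 : Exit N M γ lev τ (s ℓ))
    (h1' : ∀ k, ¬ Tight N M γ lev τ (s ℓ) k) (hcover : ∀ i, lev i = q → ∃ a ≤ ℓ, i = s a) :
    IsCharted N M γ lev τ q (2 * Fintype.card {i // lev i = q}) := by
  have hodd := Nat.odd_iff.1 hs.odd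
  have hl : IsFoldedLine N M γ lev τ q (ℓ + 1) s s := by
    refine ⟨fun y hy => hs.lev_eq y (by omega), fun y he hy => hs.adj y he (by omega), fun h => ?_,
      fun y ho hy => hs.tight y ho (by omega), fun _ => Or.inl h1, h0, h0', fun y hy k hk => ?_⟩
    · have := Nat.odd_iff.1 h
      omega
    · refine Or.inl ?_
      unfold pairing
      rcases Nat.even_or_odd y with he | ho
      · have h2 := Nat.even_iff.1 he
        rw [if_neg (by omega)]
        rcases Nat.eq_zero_or_pos y with rfl | hpos
        · exact absurd hk (h0' k)
        · exact hs.of_tight_even y he hpos (by omega) k hk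
      · have h2 := Nat.odd_iff.1 ho
        rw [if_pos (by omega)]
        rcases (Nat.lt_succ_iff.1 hy).lt_or_eq with h3 | rfl
        · rw [if_pos (by omega)]
          exact hs.of_tight_odd y ho h3 k hk
        · exact absurd hk (h1' k)
  have hcard := le_card_level (n := ℓ + 1) (fun a ha => hs.lev_eq a (by omega))
    (hs.injOn.mono fun a ha => by simp at ha ⊢; omega)
  refine hl.isCharted hM (Nat.succ_pos _) (by omega) hl fun i hi => ?_
  obtain ⟨a, ha, rfl⟩ := hcover i hi
  exact ⟨a, by omega, Or.inl rfl⟩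

/-- The stem from its end to the loop, followed by the loop. -/
def blossomWalk (s c : ℕ → V) (ℓ y : ℕ) : V := if y ≤ ℓ then s (ℓ - y) else c (y - ℓ)

theorem blossomWalk_of_le {s c : ℕ → V} {ℓ y : ℕ} (h : y ≤ ℓ) :
    blossomWalk s c ℓ y = s (ℓ - y) := if_pos h

theorem blossomWalk_of_ge {s c : ℕ → V} {ℓ y : ℕ} (hsc : s 0 = c 0) (h : ℓ ≤ y) :
    blossomWalk s c ℓ y = c (y - ℓ) := by
  rcases h.lt_or_eq with h | rfl
  · exact if_neg (by omega)
  · simp [blossomWalk, hsc]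

/-- The two directions around the loop run in parallel on the same sites. The last sites of the two
sequences are the ends of the middle edge of the loop, which is matched or tight according to
parity; this is where the line is folded. -/
theorem isFoldedLine_blossomWalk {ℓ ℓc : ℕ} {s c c' : ℕ → V}
    (hs : IsTightStem N M γ lev τ q ℓ s) (h1 : Exit N M γ lev τ (s ℓ))
    (h1' : ∀ k, ¬ Tight N M γ lev τ (s ℓ) k)
    (hc : IsTightLoop N M γ lev τ q ℓc c) (hsc : s 0 = c 0)
    (hcc : ∀ r ≤ ℓc, c' r = c (ℓc - r)) :
    IsFoldedLine N M γ lev τ q (ℓ + (ℓc + 1) / 2) (blossomWalk s c ℓ) (blossomWalk s c' ℓ) := by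
  have hso := Nat.odd_iff.1 hs.odd
  have hco := Nat.odd_iff.1 hc.odd
  have h3 := hc.three_le
  have hsc' : s 0 = c' 0 := by rw [hcc 0 (by omega), Nat.sub_zero, hc.closed, hsc]
  have lo : ∀ {c : ℕ → V} {y : ℕ}, y ≤ ℓ → blossomWalk s c ℓ y = s (ℓ - y) := blossomWalk_of_le
  have hi : ∀ {y : ℕ}, ℓ ≤ y → blossomWalk s c ℓ y = c (y - ℓ) := blossomWalk_of_ge hsc
  have hi' : ∀ {y : ℕ}, ℓ ≤ y → blossomWalk s c' ℓ y = c' (y - ℓ) := blossomWalk_of_ge hsc'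
  have last : c' (ℓ + (ℓc + 1) / 2 - 1 - ℓ) = c (ℓ + (ℓc + 1) / 2 - 1 - ℓ + 1) := by
    rw [hcc _ (by omega)]
    congr 1
    omega
  refine ⟨fun y hy => ?_, fun y he hy => ?_, fun h => ?_, fun y ho hy => ?_, fun h => Or.inr ?_,
    ?_, ?_, fun y hy k hk => ?_⟩
  · rcases le_total y ℓ with h | h
    · rw [lo h]; exact hs.lev_eq _ (by omega)
    · rw [hi h]; exact hc.lev_eq _ (by omega)
  · have h2 := Nat.even_iff.1 he
    rcases lt_or_ge y ℓ with h | h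
    · rw [lo h.le, lo h, show ℓ - y = ℓ - (y + 1) + 1 by omega]
      exact (hs.adj _ (Nat.even_iff.2 (by omega)) (by omega)).symm
    · rw [hi h, hi (by omega), show y + 1 - ℓ = y - ℓ + 1 by omega]
      exact hc.adj _ (Nat.odd_iff.2 (by omega)) (by omega)
  · have h2 := Nat.odd_iff.1 h
    rw [hi (by omega), hi' (by omega), last]
    exact hc.adj _ (Nat.odd_iff.2 (by omega)) (by omega)
  · have h2 := Nat.odd_iff.1 ho
    rcases lt_or_ge y ℓ with h | h
    · rw [lo h.le, lo h, show ℓ - y = ℓ - (y + 1) + 1 by omega]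
      exact (hs.tight _ (Nat.odd_iff.2 (by omega)) (by omega)).symm
    · rw [hi h, hi (by omega), show y + 1 - ℓ = y - ℓ + 1 by omega]
      exact hc.tight _ (Nat.even_iff.2 (by omega)) (by omega)
  · have h2 := Nat.even_iff.1 h
    rw [hi (by omega), hi' (by omega), last]
    exact hc.tight _ (Nat.even_iff.2 (by omega)) (by omega)
  · rw [lo (Nat.zero_le _)]; exact h1
  · rw [lo (Nat.zero_le _)]; exact h1'
  · unfold pairing
    rcases Nat.even_or_odd y with he | ho
    · have h2 := Nat.even_iff.1 he
      rw [if_neg (by omega)]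
      rcases Nat.eq_zero_or_pos y with rfl | hpos
      · rw [lo (Nat.zero_le _)] at hk
        exact absurd hk (h1' k)
      rcases lt_or_ge y ℓ with h | h
      · rw [lo h.le] at hk
        rw [lo (c := c) (by omega), show ℓ - (y - 1) = ℓ - y + 1 by omega]
        exact Or.inl (hs.of_tight_odd _ (Nat.odd_iff.2 (by omega)) (by omega) k hk)
      · rw [hi h] at hk
        rw [hi (y := y - 1) (by omega), show y - 1 - ℓ = y - ℓ - 1 by omega]
        exact Or.inl (hc.of_tight_odd _ (Nat.odd_iff.2 (by omega)) (by omega) k hk)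
    · have h2 := Nat.odd_iff.1 ho
      rw [if_pos (by omega)]
      rcases lt_trichotomy y ℓ with h | rfl | h
      · rw [lo h.le] at hk
        rw [if_pos (by omega), lo (c := c) (by omega), show ℓ - (y + 1) = ℓ - y - 1 by omega]
        exact Or.inl (hs.of_tight_even _ (Nat.even_iff.2 (by omega)) (by omega) (by omega) k hk)
      · rw [hi le_rfl, Nat.sub_self] at hk
        rw [if_pos (by omega), hi (by omega), hi' (by omega), hcc _ (by omega),
          show y + 1 - y = 1 by omega]
        exact hc.of_tight_zero k hk
      · rw [hi h.le] at hk
        have := hc.of_tight_even _ (Nat.even_iff.2 (by omega)) (by omega) (by omega) k hk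
        split_ifs with hn
        · rw [hi (by omega), show y + 1 - ℓ = y - ℓ + 1 by omega]
          exact Or.inl this
        · obtain rfl : y = ℓ + (ℓc + 1) / 2 - 1 := by omega
          rw [hi' h.le, last]
          exact Or.inr this

/-- A level that consists of a blossom. -/
theorem IsTightLoop.isCharted_of_stem [Fintype {i // lev i = q}] (hM : M.IsMatching) {ℓ ℓc : ℕ}
    {s c : ℕ → V} (hs : IsTightStem N M γ lev τ q ℓ s) (h1 : Exit N M γ lev τ (s ℓ))
    (h1' : ∀ k, ¬ Tight N M γ lev τ (s ℓ) k)
    (hc : IsTightLoop N M γ lev τ q ℓc c) (hsc : s 0 = c 0)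
    (hcover : ∀ i, lev i = q → (∃ a ≤ ℓ, i = s a) ∨ ∃ r < ℓc, i = c r) :
    IsCharted N M γ lev τ q (2 * Fintype.card {i // lev i = q}) := by
  have hco := Nat.odd_iff.1 hc.odd
  have h3 := hc.three_le
  have hcard := le_card_level (n := ℓ + 1) (fun a ha => hs.lev_eq a (by omega))
    (hs.injOn.mono fun a ha => by simp at ha ⊢; omega)
  have hcard' := le_card_level hc.lev_eq hc.injOn
  have hsc' : s 0 = c (ℓc - 0) := by rw [Nat.sub_zero, hc.closed, hsc]
  refine (isFoldedLine_blossomWalk hs h1 h1' hc hsc fun r _ => rfl).isCharted hM (by omega)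
    (by omega) (isFoldedLine_blossomWalk hs h1 h1' hc.reverse hsc' fun r hr => ?_) fun i hi => ?_
  · congr 1
    omega
  · rcases hcover i hi with ⟨a, ha, rfl⟩ | ⟨r, hr, rfl⟩
    · refine ⟨ℓ - a, by omega, Or.inl ?_⟩
      rw [blossomWalk_of_le (by omega)]
      congr 1
      omega
    · by_cases h : r < (ℓc + 1) / 2
      · refine ⟨ℓ + r, by omega, Or.inl ?_⟩
        rw [blossomWalk_of_ge hsc (by omega)]
        congr 1
        omega
      · refine ⟨ℓ + (ℓc - r), by omega, Or.inr ?_⟩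
        rw [blossomWalk_of_ge hsc' (by omega)]
        congr 1
        omega

/-- The closed walk along a bicycle: the stem from `s 1` to its end, the loop `d`, the stem back to `s 0`,
and the loop `c`. -/
def bicycleWalk (s c d : ℕ → V) (ℓ ℓd j : ℕ) : V :=
  if j < ℓ then s (j + 1) else if j < ℓ + ℓd then d (j + 1 - ℓ) else
    if j < 2 * ℓ + ℓd then s (2 * ℓ + ℓd - 1 - j) else c (j + 1 - (2 * ℓ + ℓd))

section

variable {ℓ ℓc ℓd j : ℕ} {s c d : ℕ → V}

theorem bicycleWalk_stem (h : j < ℓ) : bicycleWalk s c d ℓ ℓd j = s (j + 1) := if_pos h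

theorem bicycleWalk_loop (hsd : s ℓ = d 0) (h1 : ℓ ≤ j + 1) (h2 : j < ℓ + ℓd) :
    bicycleWalk s c d ℓ ℓd j = d (j + 1 - ℓ) := by
  unfold bicycleWalk
  by_cases h : j < ℓ
  · obtain rfl : ℓ = j + 1 := by omega
    rw [if_pos h, hsd, Nat.sub_self]
  · rw [if_neg h, if_pos h2]

theorem bicycleWalk_back (hℓ : 0 < ℓd) (hsd : s ℓ = d 0) (hd : d ℓd = d 0) (h1 : ℓ + ℓd ≤ j + 1)
    (h2 : j < 2 * ℓ + ℓd) : bicycleWalk s c d ℓ ℓd j = s (2 * ℓ + ℓd - 1 - j) := by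
  unfold bicycleWalk
  rw [if_neg (by omega)]
  by_cases h : j < ℓ + ℓd
  · rw [if_pos h, show j + 1 - ℓ = ℓd by omega, hd, ← hsd]
    congr 1
    omega
  · rw [if_neg h, if_pos h2]

theorem bicycleWalk_end (hℓ : 0 < ℓd) (hℓ' : 0 < ℓ) (hsc : s 0 = c 0) (h1 : 2 * ℓ + ℓd ≤ j + 1) :
    bicycleWalk s c d ℓ ℓd j = c (j + 1 - (2 * ℓ + ℓd)) := by
  unfold bicycleWalk
  rw [if_neg (by omega), if_neg (by omega)]
  by_cases h : j < 2 * ℓ + ℓd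
  · rw [if_pos h, show j + 1 - (2 * ℓ + ℓd) = 0 by omega, ← hsc]
    congr 1
    omega
  · rw [if_neg h]

end

/-- Only the base of a loop can have two tight neighbours, and the two walks, which go around the
loops in opposite directions, take one each. Every other node has one tight edge, followed by both
walks. -/
theorem isFoldedCycle_bicycleWalk {ℓ ℓc ℓd : ℕ} {s c d c' d' : ℕ → V}
    (hs : IsTightStem N M γ lev τ q ℓ s) (hc : IsTightLoop N M γ lev τ q ℓc c)
    (hd : IsTightLoop N M γ lev τ q ℓd d) (hsc : s 0 = c 0) (hsd : s ℓ = d 0)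
    (hcc : ∀ r ≤ ℓc, c' r = c (ℓc - r)) (hdd : ∀ r ≤ ℓd, d' r = d (ℓd - r)) :
    IsFoldedCycle N M γ lev τ q (2 * ℓ + ℓc + ℓd) (bicycleWalk s c d ℓ ℓd)
      (bicycleWalk s c' d' ℓ ℓd) := by
  have hso := Nat.odd_iff.1 hs.odd
  have hco := Nat.odd_iff.1 hc.odd
  have hdo := Nat.odd_iff.1 hd.odd
  have h3 := hc.three_le
  have h4 := hd.three_le
  have hsc' : s 0 = c' 0 := by rw [hcc 0 (by omega), Nat.sub_zero, hc.closed, hsc]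
  have hsd' : s ℓ = d' 0 := by rw [hdd 0 (by omega), Nat.sub_zero, hd.closed, hsd]
  have w1 : ∀ {j : ℕ}, j < ℓ → bicycleWalk s c d ℓ ℓd j = s (j + 1) := bicycleWalk_stem
  have w2 : ∀ {j : ℕ}, ℓ ≤ j + 1 → j < ℓ + ℓd → bicycleWalk s c d ℓ ℓd j = d (j + 1 - ℓ) :=
    bicycleWalk_loop hsd
  have w2' : ∀ {j : ℕ}, ℓ ≤ j + 1 → j < ℓ + ℓd → bicycleWalk s c' d' ℓ ℓd j = d' (j + 1 - ℓ) :=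
    bicycleWalk_loop hsd'
  have w3 : ∀ {j : ℕ}, ℓ + ℓd ≤ j + 1 → j < 2 * ℓ + ℓd →
      bicycleWalk s c d ℓ ℓd j = s (2 * ℓ + ℓd - 1 - j) :=
    bicycleWalk_back (by omega) hsd hd.closed
  have w4 : ∀ {j : ℕ}, 2 * ℓ + ℓd ≤ j + 1 →
      bicycleWalk s c d ℓ ℓd j = c (j + 1 - (2 * ℓ + ℓd)) :=
    bicycleWalk_end (by omega) (by omega) hsc
  have w4' : ∀ {j : ℕ}, 2 * ℓ + ℓd ≤ j + 1 →
      bicycleWalk s c' d' ℓ ℓd j = c' (j + 1 - (2 * ℓ + ℓd)) :=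
    bicycleWalk_end (by omega) (by omega) hsc'
  refine ⟨fun j hj => ?_, fun j ho hj => ?_, ?_, fun j he hj => ?_, fun j hj k hk => ?_⟩
  · by_cases h1 : j < ℓ
    · rw [w1 h1]; exact hs.lev_eq _ (by omega)
    by_cases h2 : j < ℓ + ℓd
    · rw [w2 (by omega) h2]; exact hd.lev_eq' (by omega)
    by_cases h5 : j < 2 * ℓ + ℓd
    · rw [w3 (by omega) h5]; exact hs.lev_eq _ (by omega)
    · rw [w4 (by omega)]; exact hc.lev_eq' (by omega)
  · have h0 := Nat.odd_iff.1 ho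
    by_cases h1 : j + 1 < ℓ
    · rw [w1 h1, w1 (by omega)]
      exact hs.adj _ (Nat.even_iff.2 (by omega)) (by omega)
    by_cases h2 : j + 1 < ℓ + ℓd
    · rw [w2 (by omega) h2, w2 (by omega) (by omega), show j + 1 + 1 - ℓ = j + 1 - ℓ + 1 by omega]
      exact hd.adj _ (Nat.odd_iff.2 (by omega)) (by omega)
    by_cases h5 : j + 1 < 2 * ℓ + ℓd
    · rw [w3 (by omega) h5, w3 (by omega) (by omega),
        show 2 * ℓ + ℓd - 1 - j = 2 * ℓ + ℓd - 1 - (j + 1) + 1 by omega]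
      exact (hs.adj _ (Nat.even_iff.2 (by omega)) (by omega)).symm
    · rw [w4 (by omega), w4 (by omega),
        show j + 1 + 1 - (2 * ℓ + ℓd) = j + 1 - (2 * ℓ + ℓd) + 1 by omega]
      exact hc.adj _ (Nat.odd_iff.2 (by omega)) (by omega)
  · rw [w1 (j := 0) (by omega), w4 (by omega), show 2 * ℓ + ℓc + ℓd - 1 + 1 - (2 * ℓ + ℓd) = ℓc by omega,
      hc.closed, ← hsc]
    exact hs.adj 0 (by simp) (by omega)
  · have h0 := Nat.even_iff.1 he
    by_cases h1 : j + 1 < ℓ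
    · rw [w1 h1, w1 (by omega)]
      exact hs.tight _ (Nat.odd_iff.2 (by omega)) (by omega)
    by_cases h2 : j + 1 < ℓ + ℓd
    · rw [w2 (by omega) h2, w2 (by omega) (by omega), show j + 1 + 1 - ℓ = j + 1 - ℓ + 1 by omega]
      exact hd.tight _ (Nat.even_iff.2 (by omega)) (by omega)
    by_cases h5 : j + 1 < 2 * ℓ + ℓd
    · rw [w3 (by omega) h5, w3 (by omega) (by omega),
        show 2 * ℓ + ℓd - 1 - j = 2 * ℓ + ℓd - 1 - (j + 1) + 1 by omega]
      exact (hs.tight _ (Nat.odd_iff.2 (by omega)) (by omega)).symm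
    · rw [w4 (by omega), w4 (by omega),
        show j + 1 + 1 - (2 * ℓ + ℓd) = j + 1 - (2 * ℓ + ℓd) + 1 by omega]
      exact hc.tight _ (Nat.even_iff.2 (by omega)) (by omega)
  · split_ifs with h0
    · by_cases h1 : j + 1 < ℓ
      · rw [w1 (by omega)] at hk
        rw [w1 h1]
        exact Or.inl (hs.of_tight_odd _ (Nat.odd_iff.2 (by omega)) (by omega) k hk)
      by_cases h2 : j + 1 = ℓ
      · rw [w2 (by omega) (by omega), h2, Nat.sub_self] at hk
        rw [w2 (by omega) (by omega), w2' (by omega) (by omega), hdd _ (by omega),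
          show j + 1 + 1 - ℓ = 1 by omega]
        exact hd.of_tight_zero k hk
      by_cases h5 : j + 1 < ℓ + ℓd
      · rw [w2 (by omega) (by omega)] at hk
        rw [w2 (by omega) (by omega), show j + 1 + 1 - ℓ = j + 1 - ℓ + 1 by omega]
        exact Or.inl (hd.of_tight_even _ (Nat.even_iff.2 (by omega)) (by omega) (by omega) k hk)
      by_cases h6 : j + 1 < 2 * ℓ + ℓd
      · rw [w3 (by omega) (by omega)] at hk
        rw [w3 (by omega) (by omega), show 2 * ℓ + ℓd - 1 - (j + 1) = 2 * ℓ + ℓd - 1 - j - 1 by omega]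
        exact Or.inl (hs.of_tight_even _ (Nat.even_iff.2 (by omega)) (by omega) (by omega) k hk)
      by_cases h7 : j + 1 = 2 * ℓ + ℓd
      · rw [w4 (by omega), h7, Nat.sub_self] at hk
        rw [w4 (by omega), w4' (by omega), hcc _ (by omega),
          show j + 1 + 1 - (2 * ℓ + ℓd) = 1 by omega]
        exact hc.of_tight_zero k hk
      · rw [w4 (by omega)] at hk
        rw [w4 (by omega), show j + 1 + 1 - (2 * ℓ + ℓd) = j + 1 - (2 * ℓ + ℓd) + 1 by omega]
        exact Or.inl (hc.of_tight_even _ (Nat.even_iff.2 (by omega)) (by omega) (by omega) k hk)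
    · by_cases h1 : j < ℓ
      · rw [w1 (by omega)] at hk
        rw [w1 (by omega), show j - 1 + 1 = j + 1 - 1 by omega]
        exact Or.inl (hs.of_tight_even _ (Nat.even_iff.2 (by omega)) (by omega) (by omega) k hk)
      by_cases h5 : j + 1 < ℓ + ℓd
      · rw [w2 (by omega) (by omega)] at hk
        rw [w2 (by omega) (by omega), show j - 1 + 1 - ℓ = j + 1 - ℓ - 1 by omega]
        exact Or.inl (hd.of_tight_odd _ (Nat.odd_iff.2 (by omega)) (by omega) k hk)
      by_cases h2 : j + 1 = ℓ + ℓd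
      · rw [w2 (by omega) (by omega), show j + 1 - ℓ = ℓd by omega, hd.closed] at hk
        rw [w2 (by omega) (by omega), w2' (by omega) (by omega), hdd _ (by omega),
          show j - 1 + 1 - ℓ = ℓd - 1 by omega, show ℓd - (ℓd - 1) = 1 by omega]
        exact (hd.of_tight_zero k hk).symm
      by_cases h6 : j < 2 * ℓ + ℓd
      · rw [w3 (by omega) (by omega)] at hk
        rw [w3 (by omega) (by omega), show 2 * ℓ + ℓd - 1 - (j - 1) = 2 * ℓ + ℓd - 1 - j + 1 by omega]
        exact Or.inl (hs.of_tight_odd _ (Nat.odd_iff.2 (by omega)) (by omega) k hk)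
      by_cases h7 : j + 1 = 2 * ℓ + ℓc + ℓd
      · rw [w4 (by omega), show j + 1 - (2 * ℓ + ℓd) = ℓc by omega, hc.closed] at hk
        rw [w4 (by omega), w4' (by omega), hcc _ (by omega),
          show j - 1 + 1 - (2 * ℓ + ℓd) = ℓc - 1 by omega, show ℓc - (ℓc - 1) = 1 by omega]
        exact (hc.of_tight_zero k hk).symm
      · rw [w4 (by omega)] at hk
        rw [w4 (by omega), show j - 1 + 1 - (2 * ℓ + ℓd) = j + 1 - (2 * ℓ + ℓd) - 1 by omega]
        exact Or.inl (hc.of_tight_odd _ (Nat.odd_iff.2 (by omega)) (by omega) k hk)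

/-- A level that consists of a bicycle. -/
theorem IsTightStem.isCharted_of_loops [Fintype {i // lev i = q}] (hM : M.IsMatching)
    {ℓ ℓc ℓd : ℕ} {s c d : ℕ → V} (hs : IsTightStem N M γ lev τ q ℓ s)
    (hc : IsTightLoop N M γ lev τ q ℓc c) (hd : IsTightLoop N M γ lev τ q ℓd d)
    (hsc : s 0 = c 0) (hsd : s ℓ = d 0)
    (hcover : ∀ i, lev i = q → (∃ a ≤ ℓ, i = s a) ∨ (∃ r < ℓc, i = c r) ∨ ∃ r < ℓd, i = d r) :
    IsCharted N M γ lev τ q (2 * Fintype.card {i // lev i = q}) := by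
  have hso := Nat.odd_iff.1 hs.odd
  have hco := Nat.odd_iff.1 hc.odd
  have hdo := Nat.odd_iff.1 hd.odd
  have h3 := hc.three_le
  have h4 := hd.three_le
  have hcard := le_card_level (n := ℓ + 1) (fun a ha => hs.lev_eq a (by omega))
    (hs.injOn.mono fun a ha => by simp at ha ⊢; omega)
  have hcard' := le_card_level hc.lev_eq hc.injOn
  have hcard'' := le_card_level hd.lev_eq hd.injOn
  have hsc' : s 0 = c (ℓc - 0) := by rw [Nat.sub_zero, hc.closed, hsc]
  have hsd' : s ℓ = d (ℓd - 0) := by rw [Nat.sub_zero, hd.closed, hsd]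
  obtain ⟨n, hn⟩ : ∃ n, 2 * ℓ + ℓc + ℓd = 2 * n := ⟨(2 * ℓ + ℓc + ℓd) / 2, by omega⟩
  have f1 := isFoldedCycle_bicycleWalk hs hc hd hsc hsd (fun r _ => rfl) (fun r _ => rfl)
  have f2 := isFoldedCycle_bicycleWalk (c' := c) (d' := d) hs hc.reverse hd.reverse hsc' hsd'
    (fun r hr => by congr 1; omega) (fun r hr => by congr 1; omega)
  have first : ∀ c d : ℕ → V, bicycleWalk s c d ℓ ℓd 0 = s 1 := fun c d =>
    bicycleWalk_stem (by omega)
  have last : bicycleWalk s c d ℓ ℓd (2 * n - 1) = s 0 := by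
    rw [bicycleWalk_end (by omega) (by omega) hsc (by omega),
      show 2 * n - 1 + 1 - (2 * ℓ + ℓd) = ℓc by omega, hc.closed, hsc]
  have last' : bicycleWalk s (fun r => c (ℓc - r)) (fun r => d (ℓd - r)) ℓ ℓd (2 * n - 1) =
      s 0 := by
    rw [bicycleWalk_end (by omega) (by omega) hsc' (by omega),
      show ℓc - (2 * n - 1 + 1 - (2 * ℓ + ℓd)) = 0 by omega, hsc]
  rw [hn] at f1 f2
  -- Each node is needed in both modes, hence at positions of both parities. A stem node is passed
  -- in each direction, a loop node by each of the two walks, and the parities differ because the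
  -- loops are odd.
  have cover : ∀ (b : Bool) i, lev i = q → ∃ j < 2 * n, decide (j % 2 = 0) = b ∧
      (i = bicycleWalk s c d ℓ ℓd j ∨
        i = bicycleWalk s (fun r => c (ℓc - r)) (fun r => d (ℓd - r)) ℓ ℓd j) := by
    intro b i hi
    have pick : ∀ j₁ j₂ : ℕ, (j₁ + j₂) % 2 = 1 →
        decide (j₁ % 2 = 0) = b ∨ decide (j₂ % 2 = 0) = b := by
      intro j₁ j₂ h
      cases b <;> simp <;> omega
    rcases hcover i hi with ⟨a, ha, rfl⟩ | ⟨r, hr, rfl⟩ | ⟨r, hr, rfl⟩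
    · have back : s a = bicycleWalk s c d ℓ ℓd (2 * ℓ + ℓd - 1 - a) := by
        rw [bicycleWalk_back (by omega) hsd hd.closed (by omega) (by omega)]
        congr 1
        omega
      rcases Nat.eq_zero_or_pos a with rfl | h0
      · rcases pick (2 * ℓ + ℓd - 1 - 0) (2 * n - 1) (by omega) with h | h
        · exact ⟨_, by omega, h, Or.inl back⟩
        · exact ⟨_, by omega, h, Or.inl last.symm⟩
      · rcases pick (2 * ℓ + ℓd - 1 - a) (a - 1) (by omega) with h | h
        · exact ⟨_, by omega, h, Or.inl back⟩
        · refine ⟨_, by omega, h, Or.inl ?_⟩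
          rw [bicycleWalk_stem (by omega), show a - 1 + 1 = a by omega]
    · rcases pick (2 * ℓ + ℓd - 1 + r) (2 * ℓ + ℓd - 1 + (ℓc - r)) (by omega) with h | h
      · refine ⟨_, by omega, h, Or.inl ?_⟩
        rw [bicycleWalk_end (by omega) (by omega) hsc (by omega)]
        congr 1
        omega
      · refine ⟨_, by omega, h, Or.inr ?_⟩
        rw [bicycleWalk_end (by omega) (by omega) hsc' (by omega)]
        congr 1
        omega
    · rcases pick (ℓ - 1 + r) (ℓ - 1 + (ℓd - r)) (by omega) with h | h
      · refine ⟨_, by omega, h, Or.inl ?_⟩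
        rw [bicycleWalk_loop hsd (by omega) (by omega)]
        congr 1
        omega
      · refine ⟨_, by omega, h, Or.inr ?_⟩
        rw [bicycleWalk_loop hsd' (by omega) (by omega)]
        congr 1
        omega
  -- The walks begin at `s 1` and end at `s 0`, so site 0 holds exactly the ends of this matched
  -- edge, in opposite modes.
  refine Or.inr ⟨s 1, s 0, (hs.adj 0 (by simp) (by omega)).symm, hs.lev_eq 1 (by omega),
    fun m₀ m i hi => ?_⟩
  obtain ⟨j, hj, hb, hij⟩ := cover (m == m₀) i hi
  refine ⟨1, n, _, _, by omega, by omega, f1.isChart hM f2 m₀, ⟨j, hj, ?_, hij, rfl⟩, ?_⟩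
  · unfold walkMode
    cases m <;> cases m₀ <;> simp_all
  · rintro m' i' ⟨j, hj, rfl, h, h0⟩
    obtain rfl | rfl : j = 0 ∨ j = 2 * n - 1 := by omega
    · rw [first, first, or_self] at h
      exact Or.inl ⟨rfl, h⟩
    · rw [last, last', or_self] at h
      refine Or.inr ⟨?_, h⟩
      unfold walkMode
      rw [if_neg (by omega)]

end

/-! ### Charts of alternating cycles. -/

section

variable {V : Type*} {N : ExchangeNetwork V} {M : N.graph.Subgraph} {γ : V → ℝ} {σ : ℝ}
  {lev : V → ℕ} {τ : ℕ → ℝ} {q : ℕ}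

/-- The level `q` consists of an alternating cycle of even length `ℓ`, described by an `ℓ`-periodic
sequence. -/
structure IsTightCycle (N : ExchangeNetwork V) (M : N.graph.Subgraph) (γ : V → ℝ)
    (lev : V → ℕ) (τ : ℕ → ℝ) (q ℓ : ℕ) (c : ℤ → V) : Prop where
  two_le : 2 ≤ ℓ
  even : Even ℓ
  eq_iff : ∀ a b, c a = c b ↔ (ℓ : ℤ) ∣ a - b
  lev_iff : ∀ i, lev i = q ↔ ∃ a, i = c a
  adj : ∀ a, Odd a → M.Adj (c a) (c (a + 1))
  tight : ∀ a, Even a → Tight N M γ lev τ (c a) (c (a + 1))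
  of_tight_even : ∀ a, Even a → ∀ k, Tight N M γ lev τ (c a) k → k = c (a + 1)
  of_tight_odd : ∀ a, Odd a → ∀ k, Tight N M γ lev τ (c a) k → k = c (a - 1)

namespace IsTightCycle

variable {ℓ : ℕ} {c : ℤ → V} (hc : IsTightCycle N M γ lev τ q ℓ c)
include hc

theorem even_iff {a b : ℤ} (h : c a = c b) : Even a ↔ Even b := by
  have h1 := (even_iff_two_dvd.1 ((Int.even_coe_nat ℓ).2 hc.even)).trans ((hc.eq_iff a b).1 h)
  exact Int.even_sub.1 (even_iff_two_dvd.2 h1)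

/-- The parity of the index of a node is well defined because `ℓ` is even, and both kinds of edges
change it. -/
theorem exists_sign (hM : M.IsMatching) : ∃ s : V → ℝ, IsAlternatingSign N M γ lev τ q s ∧
    ∀ a, (Even a → s (c a) = 1) ∧ (Odd a → s (c a) = -1) := by
  classical
  obtain ⟨s, hs⟩ : ∃ s : V → ℝ, ∀ a, (Even a → s (c a) = 1) ∧ (Odd a → s (c a) = -1) := by
    refine ⟨fun i => if ∃ a, Even a ∧ i = c a then 1 else -1, fun a => ⟨fun h => ?_, fun h => ?_⟩⟩
    · exact if_pos ⟨a, h, rfl⟩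
    · refine if_neg ?_
      rintro ⟨b, hb, hab⟩
      exact Int.not_even_iff_odd.2 h ((hc.even_iff hab).2 hb)
  have flip : ∀ a, s (c (a + 1)) = - s (c a) := by
    intro a
    rcases Int.even_or_odd a with h | h
    · rw [(hs a).1 h, (hs _).2 h.add_one]
    · rw [(hs a).2 h, (hs _).1 h.add_one, neg_neg]
  have flip' : ∀ a, s (c (a - 1)) = - s (c a) := by
    intro a
    have := flip (a - 1)
    rw [sub_add_cancel] at this
    rw [this, neg_neg]
  refine ⟨s, ⟨fun i hi => ?_, fun i j hi hij => ?_, fun i k hi hk => ?_, fun i hi => ?_⟩, hs⟩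
  all_goals obtain ⟨a, rfl⟩ := (hc.lev_iff i).1 hi
  · rcases Int.even_or_odd a with h | h
    · exact Or.inl ((hs a).1 h)
    · exact Or.inr ((hs a).2 h)
  · rcases Int.even_or_odd a with h | h
    · have h1 := hc.adj (a - 1) (h.sub_odd odd_one)
      rw [sub_add_cancel] at h1
      rw [hM.eq_of_adj_left hij h1.symm, flip']
    · rw [hM.eq_of_adj_left hij (hc.adj a h), flip]
  · rcases Int.even_or_odd a with h | h
    · rw [hc.of_tight_even a h k hk, flip]
    · rw [hc.of_tight_odd a h k hk, flip']
  · rcases Int.even_or_odd a with h | h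
    · exact ⟨_, hc.tight a h⟩
    · have h1 := hc.tight (a - 1) (h.sub_odd odd_one)
      rw [sub_add_cancel] at h1
      exact ⟨_, h1.symm⟩

/-- The walk starts at the partner of `c b`, runs away from `c b`, and ends there. The direction `ε`
reflects on which side of `c b` its matched edge lies. -/
theorem isFoldedCycle {b ε : ℤ} (hε : ε = 1 ∧ Odd b ∨ ε = -1 ∧ Even b) :
    IsFoldedCycle N M γ lev τ q ℓ (fun j => c (b + ε * (1 + j))) (fun j => c (b + ε * (1 + j))) := by
  have h2 := hc.two_le
  have he := Nat.even_iff.1 hc.even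
  have last : c (b + ε * (1 + ((ℓ - 1 : ℕ) : ℤ))) = c b := by
    rw [hc.eq_iff, Nat.cast_sub (by omega)]
    exact ⟨ε, by push_cast; ring⟩
  rcases hε with ⟨rfl, hb⟩ | ⟨rfl, hb⟩
  · have hb' := Int.odd_iff.1 hb
    refine ⟨fun j _ => (hc.lev_iff _).2 ⟨_, rfl⟩, fun j ho _ => ?_, ?_, fun j he _ => ?_,
      fun j _ k hk => Or.inl ?_⟩
    · have h0 := Nat.odd_iff.1 ho
      convert hc.adj (b + 1 * (1 + j)) (Int.odd_iff.2 (by omega)) using 2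
      push_cast; ring
    · rw [last]
      simpa using hc.adj b hb
    · have h0 := Nat.even_iff.1 he
      convert hc.tight (b + 1 * (1 + j)) (Int.even_iff.2 (by omega)) using 2
      push_cast; ring
    · split_ifs with h0
      · rw [hc.of_tight_even _ (Int.even_iff.2 (by omega)) k hk]
        congr 1
        push_cast; ring
      · rw [hc.of_tight_odd _ (Int.odd_iff.2 (by omega)) k hk]
        congr 1
        rw [Nat.cast_sub (by omega)]
        push_cast; ring
  · have hb' := Int.even_iff.1 hb
    refine ⟨fun j _ => (hc.lev_iff _).2 ⟨_, rfl⟩, fun j ho _ => ?_, ?_, fun j he _ => ?_,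
      fun j _ k hk => Or.inl ?_⟩
    · have h0 := Nat.odd_iff.1 ho
      refine SimpleGraph.Subgraph.Adj.symm ?_
      convert hc.adj (b + -1 * (1 + (j + 1 : ℕ))) (Int.odd_iff.2 (by push_cast; omega)) using 2
      push_cast; ring
    · rw [last]
      refine SimpleGraph.Subgraph.Adj.symm ?_
      convert hc.adj (b - 1) (hb.sub_odd odd_one) using 2
      all_goals ring
    · have h0 := Nat.even_iff.1 he
      refine Tight.symm ?_
      convert hc.tight (b + -1 * (1 + (j + 1 : ℕ))) (Int.even_iff.2 (by push_cast; omega)) using 2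
      push_cast; ring
    · split_ifs with h0
      · rw [hc.of_tight_odd _ (Int.odd_iff.2 (by omega)) k hk]
        congr 1
        push_cast; ring
      · rw [hc.of_tight_even _ (Int.even_iff.2 (by omega)) k hk]
        congr 1
        rw [Nat.cast_sub (by omega)]
        push_cast; ring

/-- A level that consists of an alternating cycle. -/
theorem isCharted [Fintype V] [Fintype {i // lev i = q}] (L : Layering N M γ σ lev τ)
    (huniq : ∀ (M' : N.graph.Subgraph) (γ' : V → ℝ), IsNashBargaining N M' γ' → M' = M ∧ γ' = γ)
    (hq : q ≠ 0) : IsCharted N M γ lev τ q (2 * Fintype.card {i // lev i = q}) := by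
  have h2 := hc.two_le
  obtain ⟨s, hs, hsc⟩ := hc.exists_sign L.matching
  have hcard : ℓ ≤ Fintype.card {i // lev i = q} := by
    refine le_card_level (f := fun a : ℕ => c a) (fun a _ => (hc.lev_iff _).2 ⟨_, rfl⟩) ?_
    intro a ha b hb hab
    simp only [Set.mem_Iio] at ha hb
    have := Int.eq_zero_of_abs_lt_dvd ((hc.eq_iff _ _).1 hab) (by rw [abs_lt]; omega)
    omega
  -- `exists_exit` for a sign and for its negative gives exits at positions of both parities.
  have exit : ∀ b : Bool, ∃ a, decide (Odd a) = b ∧ Exit N M γ lev τ (c a) := by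
    intro b
    have h0 : lev (c 0) = q := (hc.lev_iff _).2 ⟨_, rfl⟩
    cases b
    · obtain ⟨o, ho, h1, h3⟩ := L.exists_exit huniq hq hs.neg h0
      obtain ⟨a, rfl⟩ := (hc.lev_iff o).1 ho
      refine ⟨a, decide_eq_false fun h => ?_, h3⟩
      rw [(hsc a).2 h] at h1
      norm_num at h1
    · obtain ⟨o, ho, h1, h3⟩ := L.exists_exit huniq hq hs h0
      obtain ⟨a, rfl⟩ := (hc.lev_iff o).1 ho
      refine ⟨a, decide_eq_true (Int.not_even_iff_odd.1 fun h => ?_), h3⟩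
      rw [(hsc a).1 h] at h1
      norm_num at h1
  obtain ⟨n, rfl⟩ : ∃ n, ℓ = 2 * n := hc.even.two_dvd
  refine Or.inl fun m i hi => ?_
  obtain ⟨a, rfl⟩ := (hc.lev_iff i).1 hi
  -- The walk ends at `c b` in mode `false`, in which an exit is dead. The parity of `b` is chosen
  -- so that the walk meets `c a` in mode `m`.
  obtain ⟨b, hb, hexit⟩ := exit (decide (Odd a) != m)
  obtain ⟨ε, hε⟩ : ∃ ε : ℤ, ε = 1 ∧ Odd b ∨ ε = -1 ∧ Even b := by
    rcases Int.even_or_odd b with h | h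
    · exact ⟨-1, Or.inr ⟨rfl, h⟩⟩
    · exact ⟨1, Or.inl ⟨rfl, h⟩⟩
  have hε2 : ε * ε = 1 := by rcases hε with ⟨rfl, -⟩ | ⟨rfl, -⟩ <;> norm_num
  have hf := hc.isFoldedCycle hε
  set p : ℕ → V := fun j => c (b + ε * (1 + j)) with hp
  have last : p (2 * n - 1) = c b := by
    simp only [hp]
    rw [hc.eq_iff, Nat.cast_sub (by omega)]
    exact ⟨ε, by push_cast; ring⟩
  obtain ⟨j, hj, hmod⟩ : ∃ j : ℕ, j < 2 * n ∧ ((2 * n : ℕ) : ℤ) ∣ (ε * (a - b) - 1) - j := by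
    have hpos : (0 : ℤ) < ((2 * n : ℕ) : ℤ) := by omega
    refine ⟨((ε * (a - b) - 1) % ((2 * n : ℕ) : ℤ)).toNat, ?_, ?_⟩
    · have := Int.emod_lt_of_pos (ε * (a - b) - 1) hpos
      omega
    · rw [Int.toNat_of_nonneg (Int.emod_nonneg _ hpos.ne')]
      exact Int.dvd_self_sub_emod
  have hpj : c a = p j := by
    simp only [hp]
    rw [hc.eq_iff]
    rw [show a - (b + ε * (1 + j)) = ε * (ε * (a - b) - 1 - j) by
      linear_combination (b - a) * hε2]
    exact hmod.mul_left ε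
  refine ⟨1, n, _, _, by omega, by omega, hf.isChart L.matching hf true,
    ⟨j, hj, ?_, Or.inl hpj, rfl⟩, ?_⟩
  · have hpar : (Odd a ↔ Odd b) ↔ j % 2 = 1 := by
      obtain ⟨x, hx⟩ := hmod
      push_cast at hx
      rw [mul_assoc] at hx
      simp only [Int.odd_iff]
      rcases hε with ⟨rfl, -⟩ | ⟨rfl, -⟩ <;> omega
    have hm : m = true ↔ ¬ (Odd a ↔ Odd b) := by
      by_cases h1 : Odd a <;> by_cases h3 : Odd b <;> cases m <;> simp [h1, h3] at hb ⊢
    unfold walkMode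
    rw [hpar] at hm
    split_ifs with h1
    · exact hm.2 (by omega)
    · exact Bool.eq_false_iff.2 fun h => hm.1 h (by omega)
  · rintro m' i' x ⟨j, hj, rfl, h, h0⟩ hx
    rw [or_self] at h
    obtain rfl | rfl : j = 0 ∨ j = 2 * n - 1 := by omega
    · refine Or.inr ?_
      obtain rfl := L.partner_unique (h ▸ hx) hf.adj_last.symm
      rw [last]
      exact hexit
    · refine Or.inl ?_
      rw [h, last, walkMode, if_neg (by omega)]
      exact hexit

end IsTightCycle

end

/-! ### From the structures of a KT sequence to charts. -/

section

variable {V : Type*} {N : ExchangeNetwork V} {M : N.graph.Subgraph} {γ : V → ℝ} {σ : ℝ}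
  {lev : V → ℕ} {τ : ℕ → ℝ} {q : ℕ} {F : Set V} {E : Set (Sym2 V)}

theorem mk_mem_walkEdges {v : ℕ → V} {ℓ : ℕ} {x y : V} :
    s(x, y) ∈ walkEdges v ℓ ↔
      ∃ i < ℓ, (x = v i ∧ y = v (i + 1)) ∨ (x = v (i + 1) ∧ y = v i) := by
  simp only [walkEdges, Set.mem_ofPred_eq, Sym2.eq_iff]

theorem mk_notMem_walkEdges {v : ℕ → V} {ℓ : ℕ} {x y : V} (h : ∀ i ≤ ℓ, x ≠ v i) :
    s(x, y) ∉ walkEdges v ℓ := by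
  rw [mk_mem_walkEdges]
  rintro ⟨i, hi, ⟨h1, -⟩ | ⟨h1, -⟩⟩
  · exact h i hi.le h1
  · exact h (i + 1) hi h1

theorem mem_endpoints_walkEdges {v : ℕ → V} {ℓ : ℕ} {x : V} :
    x ∈ endpoints (walkEdges v ℓ) ↔ ∃ i < ℓ, x = v i ∨ x = v (i + 1) := by
  constructor
  · rintro ⟨_, ⟨i, hi, rfl⟩, hx⟩
    exact ⟨i, hi, Sym2.mem_iff.1 hx⟩
  · rintro ⟨i, hi, hx⟩
    exact ⟨_, ⟨i, hi, rfl⟩, Sym2.mem_iff.2 hx⟩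

theorem endpoints_union (E E' : Set (Sym2 V)) :
    endpoints (E ∪ E') = endpoints E ∪ endpoints E' := by
  ext x
  simp only [endpoints, Set.mem_union, Set.mem_ofPred_eq, or_and_right, exists_or]

/-- The set `E` of edges carries the level `q`, and the nodes in `F` have lower levels. -/
structure IsStage (N : ExchangeNetwork V) (M : N.graph.Subgraph) (γ : V → ℝ)
    (lev : V → ℕ) (τ : ℕ → ℝ) (q : ℕ) (F : Set V) (E : Set (Sym2 V)) : Prop where
  matching : M.IsMatching
  below : ∀ i ∈ F, lev i < q
  level : ∀ i, lev i = q ↔ i ∈ endpoints E ∧ i ∉ F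
  slack : ∀ i k, s(i, k) ∈ E → ¬ M.Adj i k → N.slack γ i k = τ q
  edge : ∀ i k, Tight N M γ lev τ i k → lev i = q → s(i, k) ∈ E

namespace IsStage

variable (S : IsStage N M γ lev τ q F E)
include S

theorem lev_eq {x y : V} (h : s(x, y) ∈ E) (hx : x ∉ F) : lev x = q :=
  (S.level x).2 ⟨⟨_, h, Sym2.mem_mk_left x y⟩, hx⟩

theorem lev_eq_right {x y : V} (h : s(x, y) ∈ E) (hy : y ∉ F) : lev y = q :=
  (S.level y).2 ⟨⟨_, h, Sym2.mem_mk_right x y⟩, hy⟩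

theorem tight {x y : V} (h : s(x, y) ∈ E) (ha : N.graph.Adj x y) (hM : ¬ M.Adj x y) (hx : x ∉ F)
    (hy : y ∉ F) : Tight N M γ lev τ x y :=
  ⟨ha, hM, by rw [S.lev_eq h hx, S.lev_eq_right h hy], by rw [S.slack x y h hM, S.lev_eq h hx]⟩

theorem exit {x y : V} (h : s(x, y) ∈ E) (ha : N.graph.Adj x y) (hM : ¬ M.Adj x y) (hx : x ∉ F)
    (hy : y ∈ F) : Exit N M γ lev τ x :=
  Or.inr ⟨y, ha, hM, by rw [S.lev_eq h hx]; exact S.below y hy,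
    by rw [S.slack x y h hM, S.lev_eq h hx]⟩

theorem notMem_of_tight {x y : V} (h : Tight N M γ lev τ x y) (hx : lev x = q) : y ∉ F := by
  intro hy
  have := S.below y hy
  have := h.2.2.1
  omega

theorem isTightStem {ℓ : ℕ} {u : ℕ → V} (hodd : Odd ℓ) (hinj : Set.InjOn u (Set.Iic ℓ))
    (hF : ∀ a ≤ ℓ, u a ∉ F) (hadj : ∀ a < ℓ, N.graph.Adj (u a) (u (a + 1)))
    (hM : ∀ a < ℓ, (M.Adj (u a) (u (a + 1)) ↔ Even a))
    (hE : ∀ a < ℓ, s(u a, u (a + 1)) ∈ E)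
    (hin : ∀ a, 0 < a → a < ℓ → ∀ k, s(u a, k) ∈ E → k = u (a + 1) ∨ k = u (a - 1)) :
    IsTightStem N M γ lev τ q ℓ u := by
  have hlev : ∀ a ≤ ℓ, lev (u a) = q := by
    intro a ha
    rcases ha.lt_or_eq with h | rfl
    · exact S.lev_eq (hE a h) (hF a ha)
    · have h1 := Nat.odd_iff.1 hodd
      have h2 := hE (a - 1) (by omega)
      rw [show a - 1 + 1 = a by omega] at h2
      exact S.lev_eq_right h2 (hF a le_rfl)
  refine ⟨hodd, hinj, hlev, fun a he ha => (hM a ha).2 he, fun a ho ha => ?_,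
    fun a ho ha k hk => ?_, fun a he h0 ha k hk => ?_⟩
  · exact S.tight (hE a ha) (hadj a ha) (fun h => Nat.not_even_iff_odd.2 ho ((hM a ha).1 h))
      (hF a ha.le) (hF (a + 1) ha)
  · have h0 := Nat.odd_iff.1 ho
    rcases hin a (by omega) ha k (S.edge _ _ hk (hlev a ha.le)) with h | rfl
    · exact h
    · have h1 := (hM (a - 1) (by omega)).2 (Nat.even_iff.2 (by omega))
      rw [show a - 1 + 1 = a by omega] at h1
      exact absurd h1.symm hk.2.1
  · rcases hin a h0 ha k (S.edge _ _ hk (hlev a ha.le)) with rfl | h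
    · exact absurd ((hM a ha).2 he) hk.2.1
    · exact h

theorem isTightLoop {ℓ : ℕ} {c : ℕ → V} (hl : IsOddLoop N M F ℓ c)
    (hE : walkEdges c ℓ ⊆ E)
    (hin : ∀ r < ℓ, ∀ k, s(c r, k) ∈ E → ¬ M.Adj (c r) k → s(c r, k) ∈ walkEdges c ℓ) :
    IsTightLoop N M γ lev τ q ℓ c := by
  obtain ⟨h3, hodd, hclosed, hadj, hM, hinj, hF⟩ := hl
  have hE' : ∀ r < ℓ, s(c r, c (r + 1)) ∈ E := fun r hr => hE ⟨r, hr, rfl⟩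
  have hF' : ∀ r ≤ ℓ, c r ∉ F := by
    intro r hr
    rcases hr.lt_or_eq with h | rfl
    · exact hF r h
    · rw [hclosed]; exact hF 0 (by omega)
  have hlev : ∀ r < ℓ, lev (c r) = q := fun r hr => S.lev_eq (hE' r hr) (hF r hr)
  have nbr : ∀ r < ℓ, ∀ k, Tight N M γ lev τ (c r) k →
      k = c (r + 1) ∨ (0 < r ∧ k = c (r - 1)) ∨ r = 0 ∧ k = c (ℓ - 1) := by
    intro r hr k hk
    obtain ⟨i, hi, ⟨h1, rfl⟩ | ⟨h1, rfl⟩⟩ :=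
      mk_mem_walkEdges.1 (hin r hr k (S.edge _ _ hk (hlev r hr)) hk.2.1)
    · rw [hinj hr hi h1]
      exact Or.inl rfl
    · rcases (Nat.succ_le_of_lt hi).lt_or_eq with h | h
      · obtain rfl := hinj hr h h1
        exact Or.inr (Or.inl ⟨Nat.succ_pos _, rfl⟩)
      · rw [show i + 1 = ℓ from h, hclosed] at h1
        have h2 : r = 0 := hinj hr (show 0 < ℓ by omega) h1
        exact Or.inr (Or.inr ⟨h2, by congr 1; omega⟩)
  refine ⟨h3, hodd, hclosed, hinj, hlev, fun r ho hr => (hM r hr).2 ho, fun r he hr => ?_,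
    fun r ho hr k hk => ?_, fun r he h0 hr k hk => ?_, fun k hk => ?_⟩
  · exact S.tight (hE' r hr) (hadj r hr) (fun h => Nat.not_odd_iff_even.2 he ((hM r hr).1 h))
      (hF r hr) (hF' (r + 1) hr)
  · have h0 := Nat.odd_iff.1 ho
    rcases nbr r hr k hk with rfl | h | h
    · exact absurd ((hM r hr).2 ho) hk.2.1
    · exact h.2
    · omega
  · have h1 := Nat.even_iff.1 he
    rcases nbr r hr k hk with h | ⟨-, rfl⟩ | h
    · exact h
    · have h2 := (hM (r - 1) (by omega)).2 (Nat.odd_iff.2 (by omega))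
      rw [show r - 1 + 1 = r by omega] at h2
      exact absurd h2.symm hk.2.1
    · omega
  · rcases nbr 0 (by omega) k hk with h | h | h
    · exact Or.inl h
    · omega
    · exact Or.inr h.2

end IsStage

theorem IsStem.mk_mem {ℓ : ℕ} {s : ℕ → V} (hs : IsStem N M ℓ s) {a : ℕ} (ha : a ≤ ℓ) {k : V}
    (h : s(s a, k) ∈ walkEdges s ℓ) : (a < ℓ ∧ k = s (a + 1)) ∨ (0 < a ∧ k = s (a - 1)) := by
  obtain ⟨i, hi, ⟨h1, rfl⟩ | ⟨h1, rfl⟩⟩ := mk_mem_walkEdges.1 h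
  · obtain rfl := hs.2.2.2 ha hi.le h1
    exact Or.inl ⟨hi, rfl⟩
  · obtain rfl := hs.2.2.2 ha (show i + 1 ≤ ℓ from hi) h1
    exact Or.inr ⟨Nat.succ_pos _, rfl⟩

theorem IsOddLoop.ne_of_ne {ℓ : ℕ} {c : ℕ → V} (hc : IsOddLoop N M F ℓ c) {x : V}
    (h : ∀ j < ℓ, x ≠ c j) : ∀ j ≤ ℓ, x ≠ c j := by
  intro j hj
  rcases hj.lt_or_eq with h1 | rfl
  · exact h j h1
  · rw [hc.2.2.1]
    exact h 0 (by have := hc.1; omega)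

theorem IsStage.isCharted_of_blossom [Fintype {i // lev i = q}] (S : IsStage N M γ lev τ q F E)
    (h : IsBlossom N M γ F (τ q) E) :
    IsCharted N M γ lev τ q (2 * Fintype.card {i // lev i = q}) := by
  obtain ⟨ℓs, ℓc, s, c, hs, hc, hsc, hdisj, hF, hanch, rfl⟩ := h
  have h3 := hc.1
  have hℓs := hs.1
  -- edges at the nodes of the stem and of the loop
  have edge_s : ∀ a, 0 < a → a ≤ ℓs → ∀ k, s(s a, k) ∈ walkEdges s ℓs ∪ walkEdges c ℓc →
      (a < ℓs ∧ k = s (a + 1)) ∨ (0 < a ∧ k = s (a - 1)) := by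
    rintro a h0 ha k (hk | hk)
    · exact hs.mk_mem ha hk
    · exact absurd hk (mk_notMem_walkEdges (hc.ne_of_ne fun j hj => hdisj a j h0 ha hj))
  -- At the base of the loop, the only further edge of the structure is the first edge of the stem,
  -- and it is matched.
  have edge_c : ∀ r < ℓc, ∀ k, s(c r, k) ∈ walkEdges s ℓs ∪ walkEdges c ℓc → ¬ M.Adj (c r) k →
      s(c r, k) ∈ walkEdges c ℓc := by
    rintro r hr k (hk | hk) hM
    · rcases Nat.eq_zero_or_pos r with rfl | h0
      · rw [← hsc] at hk hM
        rcases hs.mk_mem (Nat.zero_le _) hk with ⟨-, rfl⟩ | h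
        · exact absurd ((hs.2.2.1 0 (by omega)).2 (by simp)) hM
        · omega
      · refine absurd hk (mk_notMem_walkEdges fun i hi => ?_)
        rcases Nat.eq_zero_or_pos i with rfl | h1
        · rw [hsc]
          intro h2
          have := hc.2.2.2.2.2.1 hr (show 0 < ℓc by omega) h2
          omega
        · exact (hdisj i r h1 hi hr).symm
    · exact hk
  have loop := S.isTightLoop hc Set.subset_union_right edge_c
  have hE : ∀ a < ℓs, s(s a, s (a + 1)) ∈ walkEdges s ℓs ∪ walkEdges c ℓc :=
    fun a ha => Or.inl ⟨a, ha, rfl⟩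
  have stem : ∀ st ≤ ℓs, Odd st → s st ∉ F → IsTightStem N M γ lev τ q st s := by
    intro st hst hodd hst'
    refine S.isTightStem hodd (hs.2.2.2.mono (Set.Iic_subset_Iic.2 hst)) (fun a ha => ?_)
      (fun a ha => hs.2.1 a (by omega)) (fun a ha => hs.2.2.1 a (by omega))
      (fun a ha => hE a (by omega)) (fun a h0 ha k hk => ?_)
    · rcases ha.lt_or_eq with h | rfl
      · exact hF a (by omega)
      · exact hst'
    · exact (edge_s a h0 (by omega) k hk).imp (fun h => h.2) (fun h => h.2)
  have cover : ∀ i, lev i = q → (∃ a ≤ ℓs, i = s a) ∨ ∃ r < ℓc, i = c r := by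
    intro i hi
    have h1 := ((S.level i).1 hi).1
    rw [endpoints_union, Set.mem_union, mem_endpoints_walkEdges, mem_endpoints_walkEdges] at h1
    rcases h1 with ⟨a, ha, rfl | rfl⟩ | ⟨r, hr, rfl | rfl⟩
    · exact Or.inl ⟨a, ha.le, rfl⟩
    · exact Or.inl ⟨a + 1, ha, rfl⟩
    · exact Or.inr ⟨r, hr, rfl⟩
    · rcases (Nat.succ_le_of_lt hr).lt_or_eq with h | h
      · exact Or.inr ⟨r + 1, h, rfl⟩
      · exact Or.inr ⟨0, by omega, by rw [← hc.2.2.1, ← h]⟩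
  have hlast := hs.2.2.1 (ℓs - 1) (by omega)
  have hElast := hE (ℓs - 1) (by omega)
  have hadj := hs.2.1 (ℓs - 1) (by omega)
  rw [show ℓs - 1 + 1 = ℓs by omega] at hlast hElast hadj
  -- An end in `F` belongs to a lower level: the stem of the level then stops one node earlier, and
  -- that node exits through `F`. Otherwise the whole stem is in the level, and the exit at its end
  -- is `γ = τ`.
  rcases hanch with ⟨hx, hy, hM⟩ | ⟨hx, hM, hγ⟩
  · have hodd : Odd (ℓs - 1) := Nat.not_even_iff_odd.1 fun h => hM (hlast.2 h).symm
    have h1 := Nat.odd_iff.1 hodd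
    have hM' : ¬ M.Adj (s (ℓs - 1)) (s ℓs) := fun h => hM h.symm
    have st := stem (ℓs - 1) (by omega) hodd hy
    refine loop.isCharted_of_stem S.matching st (S.exit hElast hadj hM' hy hx) (fun k hk => ?_) hsc
      fun i hi => ?_
    · have h2 := st.lev_eq _ le_rfl
      rcases edge_s (ℓs - 1) (by omega) (by omega) k (S.edge _ _ hk h2) with ⟨-, rfl⟩ | ⟨-, rfl⟩
      · rw [show ℓs - 1 + 1 = ℓs by omega] at hk
        exact S.notMem_of_tight hk h2 hx
      · have h4 := st.adj (ℓs - 1 - 1) (Nat.even_iff.2 (by omega)) (by omega)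
        rw [show ℓs - 1 - 1 + 1 = ℓs - 1 by omega] at h4
        exact hk.2.1 h4.symm
    · rcases cover i hi with ⟨a, ha, rfl⟩ | h
      · refine Or.inl ⟨a, ?_, rfl⟩
        by_contra h2
        obtain rfl : a = ℓs := by omega
        exact ((S.level _).1 hi).2 hx
      · exact Or.inr h
  · have heven : Even (ℓs - 1) := hlast.1 hM.symm
    have h1 := Nat.even_iff.1 heven
    have st := stem ℓs le_rfl (Nat.odd_iff.2 (by omega)) hx
    have h2 := st.lev_eq _ le_rfl
    refine loop.isCharted_of_stem S.matching st (Or.inl (by rw [hγ, h2])) (fun k hk => ?_) hsc cover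
    rcases edge_s ℓs (by omega) le_rfl k (S.edge _ _ hk h2) with ⟨h, -⟩ | ⟨-, rfl⟩
    · omega
    · exact hk.2.1 hM

theorem IsStage.isCharted_of_bicycle [Fintype {i // lev i = q}] (S : IsStage N M γ lev τ q F E)
    (h : IsBicycle N M F E) :
    IsCharted N M γ lev τ q (2 * Fintype.card {i // lev i = q}) := by
  obtain ⟨ℓs, ℓc, ℓd, s, c, d, hs, hso, hc, hd, hsc, hsd, hdisj, hdisj', hdisj'', hF, rfl⟩ := h
  have h3 := hc.1
  have h4 := hd.1
  have hℓs := hs.1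
  have edge_s : ∀ a, 0 < a → a < ℓs → ∀ k,
      s(s a, k) ∈ walkEdges s ℓs ∪ walkEdges c ℓc ∪ walkEdges d ℓd →
      k = s (a + 1) ∨ k = s (a - 1) := by
    rintro a h0 ha k ((hk | hk) | hk)
    · exact (hs.mk_mem ha.le hk).imp (fun h => h.2) (fun h => h.2)
    · exact absurd hk (mk_notMem_walkEdges (hc.ne_of_ne fun j hj => hdisj a j h0 ha.le hj))
    · exact absurd hk (mk_notMem_walkEdges (hd.ne_of_ne fun j hj => hdisj' a j ha hj))
  have edge_c : ∀ r < ℓc, ∀ k, s(c r, k) ∈ walkEdges s ℓs ∪ walkEdges c ℓc ∪ walkEdges d ℓd →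
      ¬ M.Adj (c r) k → s(c r, k) ∈ walkEdges c ℓc := by
    rintro r hr k ((hk | hk) | hk) hM
    · rcases Nat.eq_zero_or_pos r with rfl | h0
      · rw [← hsc] at hk hM
        rcases hs.mk_mem (Nat.zero_le _) hk with ⟨-, rfl⟩ | h
        · exact absurd ((hs.2.2.1 0 (by omega)).2 (by simp)) hM
        · omega
      · refine absurd hk (mk_notMem_walkEdges fun i hi => ?_)
        rcases Nat.eq_zero_or_pos i with rfl | h1
        · rw [hsc]
          intro h2
          have := hc.2.2.2.2.2.1 hr (show 0 < ℓc by omega) h2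
          omega
        · exact (hdisj i r h1 hi hr).symm
    · exact hk
    · exact absurd hk (mk_notMem_walkEdges (hd.ne_of_ne fun j hj => hdisj'' r j hr hj))
  have edge_d : ∀ r < ℓd, ∀ k, s(d r, k) ∈ walkEdges s ℓs ∪ walkEdges c ℓc ∪ walkEdges d ℓd →
      ¬ M.Adj (d r) k → s(d r, k) ∈ walkEdges d ℓd := by
    rintro r hr k ((hk | hk) | hk) hM
    · have h1 := Nat.odd_iff.1 hso
      rcases Nat.eq_zero_or_pos r with rfl | h0
      · rw [← hsd] at hk hM
        rcases hs.mk_mem le_rfl hk with h | ⟨-, rfl⟩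
        · omega
        · have h2 := (hs.2.2.1 (ℓs - 1) (by omega)).2 (Nat.even_iff.2 (by omega))
          rw [show ℓs - 1 + 1 = ℓs by omega] at h2
          exact absurd h2.symm hM
      · refine absurd hk (mk_notMem_walkEdges fun i hi => ?_)
        rcases hi.lt_or_eq with h2 | rfl
        · exact (hdisj' i r h2 hr).symm
        · rw [hsd]
          intro h2
          have := hd.2.2.2.2.2.1 hr (show 0 < ℓd by omega) h2
          omega
    · exact absurd hk (mk_notMem_walkEdges (hc.ne_of_ne fun j hj => (hdisj'' j r hj hr).symm))
    · exact hk
  have stem := S.isTightStem hso hs.2.2.2 hF hs.2.1 hs.2.2.1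
    (fun a ha => Or.inl (Or.inl ⟨a, ha, rfl⟩)) edge_s
  refine stem.isCharted_of_loops S.matching
    (S.isTightLoop hc (fun e he => Or.inl (Or.inr he)) edge_c)
    (S.isTightLoop hd Set.subset_union_right edge_d) hsc hsd fun i hi => ?_
  have h1 := ((S.level i).1 hi).1
  rw [endpoints_union, endpoints_union, Set.mem_union, Set.mem_union, mem_endpoints_walkEdges,
    mem_endpoints_walkEdges, mem_endpoints_walkEdges] at h1
  rcases h1 with (⟨a, ha, rfl | rfl⟩ | ⟨r, hr, rfl | rfl⟩) | ⟨r, hr, rfl | rfl⟩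
  · exact Or.inl ⟨a, ha.le, rfl⟩
  · exact Or.inl ⟨a + 1, ha, rfl⟩
  · exact Or.inr (Or.inl ⟨r, hr, rfl⟩)
  · rcases (Nat.succ_le_of_lt hr).lt_or_eq with h | h
    · exact Or.inr (Or.inl ⟨r + 1, h, rfl⟩)
    · exact Or.inr (Or.inl ⟨0, by omega, by rw [← hc.2.2.1, ← h]⟩)
  · exact Or.inr (Or.inr ⟨r, hr, rfl⟩)
  · rcases (Nat.succ_le_of_lt hr).lt_or_eq with h | h
    · exact Or.inr (Or.inr ⟨r + 1, h, rfl⟩)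
    · exact Or.inr (Or.inr ⟨0, by omega, by rw [← hd.2.2.1, ← h]⟩)

/-- A periodic sequence over the integers has no seam, so charts may start at any node and run in
either direction. -/
theorem IsStage.isTightCycle (S : IsStage N M γ lev τ q F E) {ℓ : ℕ} {c : ℕ → V} (h3 : 3 ≤ ℓ)
    (heven : Even ℓ) (hclosed : c ℓ = c 0) (hadj : ∀ i < ℓ, N.graph.Adj (c i) (c (i + 1)))
    (hM : ∀ i < ℓ, (M.Adj (c i) (c (i + 1)) ↔ Odd i)) (hinj : Set.InjOn c (Set.Iio ℓ))
    (hF : ∀ i < ℓ, c i ∉ F) (hE : E = walkEdges c ℓ) :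
    IsTightCycle N M γ lev τ q ℓ (fun a => c (a % ℓ).toNat) := by
  subst hE
  set c' : ℤ → V := fun a => c (a % ℓ).toNat with hc'
  have hpos : (0 : ℤ) < ℓ := by omega
  have he := Nat.even_iff.1 heven
  have lt : ∀ a : ℤ, (a % ℓ).toNat < ℓ := fun a => by
    have := Int.emod_lt_of_pos a hpos
    omega
  have eq_iff : ∀ a b, c' a = c' b ↔ (ℓ : ℤ) ∣ a - b := by
    intro a b
    rw [← Int.modEq_iff_dvd]
    have ha := Int.emod_nonneg a hpos.ne'
    have hb := Int.emod_nonneg b hpos.ne'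
    refine ⟨fun h => ?_, fun h => ?_⟩
    · have h1 := hinj (lt a) (lt b) h
      exact (show b % ℓ = a % ℓ by omega)
    · simp only [hc', show a % ℓ = b % ℓ from h.symm]
  have nat : ∀ i ≤ ℓ, c i = c' i := by
    intro i hi
    rcases hi.lt_or_eq with h | rfl
    · simp only [hc']
      rw [Int.emod_eq_of_lt (by omega) (by omega), Int.toNat_natCast]
    · simp [hc', hclosed]
  have repr : ∀ a : ℤ, ∃ r < ℓ, c' a = c r ∧ c' (a + 1) = c (r + 1) ∧ (Odd a ↔ Odd r) := by
    intro a
    refine ⟨(a % ℓ).toNat, lt a, rfl, ?_, ?_⟩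
    · rw [nat _ (lt a), eq_iff]
      have := Int.emod_nonneg a hpos.ne'
      push_cast
      rw [Int.toNat_of_nonneg this, show a + 1 - (a % ℓ + 1) = a - a % ℓ by ring]
      exact Int.dvd_self_sub_emod
    · have h1 := Int.emod_nonneg a hpos.ne'
      have h2 : a % ℓ % 2 = a % 2 :=
        Int.emod_emod_of_dvd a (Int.natCast_dvd_natCast.2 heven.two_dvd)
      rw [Int.odd_iff, Nat.odd_iff]
      omega
  have hlev : ∀ i, lev i = q ↔ ∃ a, i = c' a := by
    intro i
    rw [S.level]
    constructor
    · rintro ⟨h, -⟩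
      obtain ⟨r, hr, rfl | rfl⟩ := mem_endpoints_walkEdges.1 h
      · exact ⟨r, nat r hr.le⟩
      · exact ⟨(r + 1 : ℕ), nat (r + 1) hr⟩
    · rintro ⟨a, rfl⟩
      obtain ⟨r, hr, h1, -⟩ := repr a
      rw [h1]
      exact ⟨mem_endpoints_walkEdges.2 ⟨r, hr, Or.inl rfl⟩, hF r hr⟩
  have matched : ∀ a, M.Adj (c' a) (c' (a + 1)) ↔ Odd a := by
    intro a
    obtain ⟨r, hr, h1, h2, h4⟩ := repr a
    rw [h1, h2, h4, hM r hr]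
  have nbr : ∀ a k, Tight N M γ lev τ (c' a) k → k = c' (a + 1) ∨ k = c' (a - 1) := by
    intro a k hk
    have shift : ∀ {a b : ℤ} (x : ℤ), c' a = c' b → c' (a + x) = c' (b + x) := by
      intro a b x h
      rw [eq_iff] at h ⊢
      rwa [add_sub_add_right_eq_sub]
    obtain ⟨i, hi, ⟨h1, rfl⟩ | ⟨h1, rfl⟩⟩ :=
      mk_mem_walkEdges.1 (S.edge _ _ hk ((hlev _).2 ⟨a, rfl⟩))
    · rw [nat i hi.le] at h1
      rw [nat (i + 1) hi, shift 1 h1]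
      exact Or.inl (by push_cast; rfl)
    · rw [nat (i + 1) hi] at h1
      have := shift (-1) h1
      rw [nat i hi.le, sub_eq_add_neg, this]
      exact Or.inr (by congr 1; push_cast; ring)
  refine ⟨by omega, heven, eq_iff, hlev, fun a ha => (matched a).2 ha, fun a ha => ?_,
    fun a ha k hk => ?_, fun a ha k hk => ?_⟩
  · have hna := fun h => Int.not_odd_iff_even.2 ha ((matched a).1 h)
    obtain ⟨r, hr, h1, h2, h4⟩ := repr a
    rw [h1, h2] at hna ⊢
    refine S.tight ⟨r, hr, rfl⟩ (hadj r hr) hna (hF r hr) ?_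
    rw [← h2]
    exact hF _ (lt _)
  · rcases nbr a k hk with h | rfl
    · exact h
    · have h1 := (matched (a - 1)).2 (ha.sub_odd odd_one)
      rw [sub_add_cancel] at h1
      exact absurd h1.symm hk.2.1
  · rcases nbr a k hk with rfl | h
    · exact absurd ((matched a).2 ha) hk.2.1
    · exact h

theorem IsStage.isCharted_of_cycle [Fintype V] [Fintype {i // lev i = q}]
    (S : IsStage N M γ lev τ q F E) (L : Layering N M γ σ lev τ)
    (huniq : ∀ (M' : N.graph.Subgraph) (γ' : V → ℝ), IsNashBargaining N M' γ' → M' = M ∧ γ' = γ)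
    (hq : q ≠ 0) (h : IsAlternatingCycle N M F E) :
    IsCharted N M γ lev τ q (2 * Fintype.card {i // lev i = q}) := by
  obtain ⟨ℓ, c, h3, heven, hclosed, hadj, hM, hinj, hF, hE⟩ := h
  exact (S.isTightCycle h3 heven hclosed hadj hM hinj hF hE).isCharted L huniq hq

/-- An alternating walk whose ends are anchored, and whose nodes are distinct, except that the ends may
agree. -/
structure IsAnchoredWalk (N : ExchangeNetwork V) (M : N.graph.Subgraph) (γ : V → ℝ)
    (F : Set V) (t : ℝ) (ℓ : ℕ) (v : ℕ → V) : Prop where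
  one_le : 1 ≤ ℓ
  adj : ∀ i < ℓ, N.graph.Adj (v i) (v (i + 1))
  alternating : ∀ i, i + 1 < ℓ → (M.Adj (v i) (v (i + 1)) ↔ ¬ M.Adj (v (i + 1)) (v (i + 2)))
  injOn_left : Set.InjOn v (Set.Iio ℓ)
  injOn_right : Set.InjOn v (Set.Ioc 0 ℓ)
  notMem : ∀ i, 0 < i → i < ℓ → v i ∉ F
  anchor : IsAnchored N M γ F t (v 0) (v 1)
  anchor_last : IsAnchored N M γ F t (v ℓ) (v (ℓ - 1))

namespace IsAnchoredWalk

variable {t : ℝ} {ℓ : ℕ} {v : ℕ → V} (h : IsAnchoredWalk N M γ F t ℓ v)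
include h

theorem reverse : IsAnchoredWalk N M γ F t ℓ (fun i => v (ℓ - i)) := by
  have h1 := h.one_le
  refine ⟨h1, fun i hi => ?_, fun i hi => ?_, ?_, ?_, fun i h0 hi => h.notMem _ (by omega) (by omega),
    by simpa using h.anchor_last, ?_⟩
  · have := h.adj (ℓ - (i + 1)) (by omega)
    rw [show ℓ - (i + 1) + 1 = ℓ - i by omega] at this
    exact this.symm
  · have := h.alternating (ℓ - (i + 2)) (by omega)
    rw [show ℓ - (i + 2) + 1 = ℓ - (i + 1) by omega, show ℓ - (i + 2) + 2 = ℓ - i by omega] at this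
    rw [M.adj_comm (v (ℓ - i)), M.adj_comm (v (ℓ - (i + 1))) (v (ℓ - (i + 2))), this, not_not]
  · intro a ha b hb hab
    simp only [Set.mem_Iio] at ha hb
    have := h.injOn_right (x₁ := ℓ - a) (x₂ := ℓ - b) ⟨by omega, by omega⟩ ⟨by omega, by omega⟩ hab
    omega
  · intro a ha b hb hab
    simp only [Set.mem_Ioc] at ha hb
    have := h.injOn_left (x₁ := ℓ - a) (x₂ := ℓ - b) (by simp; omega) (by simp; omega) hab
    omega
  · simpa [show ℓ - (ℓ - 1) = 1 by omega] using h.anchor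

/-- If the common end were outside `F`, both of its path edges would be matched, hence equal.
Injectivity then forces `ℓ = 2`, and two consecutive matched edges contradict alternation. -/
theorem closed_mem (hM : M.IsMatching) (hv : v 0 = v ℓ) : v 0 ∈ F := by
  by_contra h0
  have h1 := h.one_le
  have a1 : M.Adj (v 0) (v 1) := by
    rcases h.anchor with h2 | h2
    · exact absurd h2.1 h0
    · exact h2.2.1
  have a2 : M.Adj (v ℓ) (v (ℓ - 1)) := by
    rcases h.anchor_last with h2 | h2
    · exact absurd (hv ▸ h2.1) h0
    · exact h2.2.1
  rw [← hv] at a2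
  have h3 := hM.eq_of_adj_left a1 a2
  have h4 : ℓ ≠ 1 := by
    rintro rfl
    exact (M.adj_sub a1).ne hv
  have h5 : 1 = ℓ - 1 := h.injOn_left (show 1 < ℓ by omega) (show ℓ - 1 < ℓ by omega) h3
  obtain rfl : ℓ = 2 := by omega
  refine (h.alternating 0 (by omega)).1 a1 ?_
  rw [show 0 + 2 = 2 from rfl, ← hv]
  exact a2.symm

theorem mk_mem {i : ℕ} (h0 : 0 < i) (hi : i < ℓ) {k : V} (hk : s(v i, k) ∈ walkEdges v ℓ) :
    k = v (i + 1) ∨ k = v (i - 1) := by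
  obtain ⟨j, hj, ⟨h1, rfl⟩ | ⟨h1, rfl⟩⟩ := mk_mem_walkEdges.1 hk
  · obtain rfl := h.injOn_left hi hj h1
    exact Or.inl rfl
  · obtain rfl := h.injOn_right (x₂ := j + 1) ⟨h0, hi.le⟩ ⟨by omega, hj⟩ h1
    exact Or.inr rfl

theorem mk_mem_zero (h0 : v 0 ≠ v ℓ) {k : V} (hk : s(v 0, k) ∈ walkEdges v ℓ) : k = v 1 := by
  obtain ⟨j, hj, ⟨h1, rfl⟩ | ⟨h1, rfl⟩⟩ := mk_mem_walkEdges.1 hk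
  · obtain rfl := h.injOn_left (x₁ := 0) (show 0 < ℓ by omega) hj h1
    rfl
  · rcases (Nat.succ_le_of_lt hj).lt_or_eq with h2 | h2
    · have := h.injOn_left (x₁ := 0) (x₂ := j + 1) (show 0 < ℓ by omega) h2 h1
      omega
    · exact absurd (by rw [h1, ← h2]) h0

/-- The first node of the path outside of `F`. -/
theorem exists_first (S : IsStage N M γ lev τ q F (walkEdges v ℓ)) (ht : t = τ q) :
    ∃ lo, (lo = 0 ∧ v 0 ∉ F ∨ lo = 1 ∧ v 0 ∈ F ∧ 1 < ℓ) ∧ (M.Adj (v 0) (v 1) ↔ lo = 0) ∧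
      Exit N M γ lev τ (v lo) ∧ ∀ k, ¬ Tight N M γ lev τ (v lo) k := by
  have h1 := h.one_le
  have hE : s(v 0, v 1) ∈ walkEdges v ℓ := ⟨0, h1, rfl⟩
  rcases h.anchor with ⟨hx, hy, hM⟩ | ⟨hx, hM, hγ⟩
  · have h2 : 1 < ℓ := by
      by_contra h3
      obtain rfl : ℓ = 1 := by omega
      rcases h.anchor_last with h4 | h4
      · exact hy h4.1
      · exact hM h4.2.1.symm
    have hE' : s(v 1, v 0) ∈ walkEdges v ℓ := by rwa [Sym2.eq_swap]
    have hM' : ¬ M.Adj (v 1) (v 0) := fun h => hM h.symm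
    have hlev := S.lev_eq hE' hy
    refine ⟨1, Or.inr ⟨rfl, hx, h2⟩, iff_of_false hM one_ne_zero,
      S.exit hE' (h.adj 0 h1).symm hM' hy hx, fun k hk => ?_⟩
    rcases h.mk_mem one_pos h2 (S.edge _ _ hk hlev) with rfl | rfl
    · exact hk.2.1 (not_not.1 fun h3 => hM ((h.alternating 0 h2).2 h3))
    · exact S.notMem_of_tight hk hlev hx
  · have hlev := S.lev_eq hE hx
    refine ⟨0, Or.inl ⟨rfl, hx⟩, iff_of_true hM rfl, Or.inl (by rw [hγ, hlev, ht]), fun k hk => ?_⟩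
    obtain rfl := h.mk_mem_zero (fun h3 => hx (h.closed_mem S.matching h3)) (S.edge _ _ hk hlev)
    exact hk.2.1 hM

end IsAnchoredWalk

theorem IsStage.isCharted_of_path [Fintype {i // lev i = q}] (S : IsStage N M γ lev τ q F E)
    (h : IsAlternatingPath N M γ F (τ q) E) :
    IsCharted N M γ lev τ q (2 * Fintype.card {i // lev i = q}) := by
  obtain ⟨ℓ, v, h1, h2, h3, h4, h5, h6, h7, h8, rfl⟩ := h
  have h : IsAnchoredWalk N M γ F (τ q) ℓ v := ⟨h1, h2, h3, h4, h5, h6, h7, h8⟩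
  have hrev : walkEdges (fun i => v (ℓ - i)) ℓ = walkEdges v ℓ := by
    ext e
    constructor
    · rintro ⟨i, hi, rfl⟩
      refine ⟨ℓ - (i + 1), by omega, ?_⟩
      rw [Sym2.eq_swap, show ℓ - (i + 1) + 1 = ℓ - i by omega]
    · rintro ⟨i, hi, rfl⟩
      refine ⟨ℓ - (i + 1), by omega, ?_⟩
      simp only
      rw [Sym2.eq_swap, show ℓ - (ℓ - (i + 1)) = i + 1 by omega,
        show ℓ - (ℓ - (i + 1) + 1) = i by omega]
  obtain ⟨lo, hlo, hlo', hexit, hdead⟩ := h.exists_first S rfl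
  obtain ⟨x, hx, hx', hexit', hdead'⟩ := h.reverse.exists_first (by rw [hrev]; exact S) rfl
  simp only [Nat.sub_zero] at hx hx' hexit' hdead'
  have hM : ∀ i < ℓ, (M.Adj (v i) (v (i + 1)) ↔ (i + lo) % 2 = 0) := by
    intro i
    induction i with
    | zero =>
      intro _
      rw [hlo']
      omega
    | succ i ih =>
      intro hi
      have h9 := h.alternating i hi
      rw [ih (by omega)] at h9
      rw [show i + 1 + 1 = i + 2 from rfl]
      have : M.Adj (v (i + 1)) (v (i + 2)) ↔ ¬ (i + lo) % 2 = 0 := by rw [h9, not_not]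
      rw [this]
      omega
  have hlast := hM (ℓ - 1) (by omega)
  rw [show ℓ - 1 + 1 = ℓ by omega, M.adj_comm, hx'] at hlast
  have hF : ∀ i, lo ≤ i → i ≤ ℓ - x → v i ∉ F := by
    intro i hi hi'
    rcases Nat.eq_zero_or_pos i with rfl | h0
    · rcases hlo with h9 | h9
      · exact h9.2
      · omega
    · rcases (show i ≤ ℓ by omega).lt_or_eq with h9 | rfl
      · exact h.notMem i h0 h9
      · rcases hx with h9 | h9
        · exact h9.2
        · omega
  have hinj : ∀ a b, lo ≤ a → a ≤ ℓ - x → lo ≤ b → b ≤ ℓ - x → v a = v b → a = b := by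
    intro a b ha ha' hb hb' hab
    by_cases h9 : a < ℓ ∧ b < ℓ
    · exact h.injOn_left h9.1 h9.2 hab
    by_cases h10 : 0 < a ∧ 0 < b
    · exact h.injOn_right ⟨h10.1, by omega⟩ ⟨h10.2, by omega⟩ hab
    have h11 : v 0 = v ℓ := by
      obtain ⟨rfl, rfl⟩ | ⟨rfl, rfl⟩ : (a = 0 ∧ b = ℓ) ∨ (a = ℓ ∧ b = 0) := by omega
      · exact hab
      · exact hab.symm
    exact absurd (h.closed_mem S.matching h11) (hF 0 (by omega) (by omega))
  -- Dropping the ends in `F` leaves a path that begins and ends with a matched edge, hence has odd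
  -- length.
  have stem : IsTightStem N M γ lev τ q (ℓ - x - lo) (fun a => v (lo + a)) := by
    refine S.isTightStem (Nat.odd_iff.2 (by omega)) (fun a ha b hb hab => ?_)
      (fun a ha => hF _ (by omega) (by omega)) (fun a ha => h.adj _ (by omega)) (fun a ha => ?_)
      (fun a ha => ⟨lo + a, by omega, rfl⟩) (fun a h0 ha k hk => ?_)
    · simp only [Set.mem_Iic] at ha hb
      have := hinj _ _ (by omega) (by omega) (by omega) (by omega) hab
      omega
    · rw [← add_assoc, hM _ (by omega), Nat.even_iff]
      omega
    · have := h.mk_mem (by omega) (by omega) hk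
      rwa [show lo + a - 1 = lo + (a - 1) by omega] at this
  have hend : lo + (ℓ - x - lo) = ℓ - x := by omega
  refine stem.isCharted S.matching hexit hdead (by rw [hend]; exact hexit')
    (by rw [hend]; exact hdead') fun i hi => ?_
  obtain ⟨hi1, hi2⟩ := (S.level i).1 hi
  have : ∃ a ≤ ℓ, i = v a := by
    obtain ⟨a, ha, rfl | rfl⟩ := mem_endpoints_walkEdges.1 hi1
    · exact ⟨a, ha.le, rfl⟩
    · exact ⟨a + 1, ha, rfl⟩
  obtain ⟨a, ha, rfl⟩ := this
  have ha1 : lo ≤ a := by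
    by_contra h9
    obtain rfl : a = 0 := by omega
    rcases hlo with h10 | h10
    · omega
    · exact hi2 h10.2.1
  have ha2 : a ≤ ℓ - x := by
    by_contra h9
    rcases hx with h10 | h10
    · omega
    · obtain rfl : a = ℓ := by omega
      exact hi2 h10.2.1
  exact ⟨a - lo, by omega, by rw [show lo + (a - lo) = a by omega]⟩

end

/-! ### Levels and their properties from a KT sequence with gap. -/

section

variable {V : Type*} {N : ExchangeNetwork V} {M : N.graph.Subgraph} {γ : V → ℝ} {σ : ℝ}
  {lev : V → ℕ} {τ : ℕ → ℝ} {q : ℕ}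

theorem IsChart.lev_partner {e n : ℕ} {ρ : Bool → V → ℕ → Prop}
    (h : IsChart N M γ lev τ q e n ρ) {m : Bool} {i j : V} {y : ℕ} (hi : ρ m i y)
    (hij : M.Adj i j) : lev j = q :=
  (h.mem _ _ _ (h.partner m i y j hi hij)).1

theorem IsChart.exit_or_tight {e n : ℕ} {ρ : Bool → V → ℕ → Prop}
    (h : IsChart N M γ lev τ q e n ρ) {i : V} {y : ℕ} (hi : ρ false i y) :
    Exit N M γ lev τ i ∨ ∃ k, Tight N M γ lev τ i k :=
  (h.lower i y hi).imp_right fun ⟨k, hk, _⟩ => ⟨k, hk⟩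

theorem IsCharted.lev_partner {n : ℕ} (h : IsCharted N M γ lev τ q n) {i j : V} (hi : lev i = q)
    (hij : M.Adj i j) : lev j = q := by
  rcases h with h | ⟨_, _, _, _, h⟩
  · obtain ⟨_, _, _, _, _, _, h1, h2, _⟩ := h true i hi
    exact h1.lev_partner h2 hij
  · obtain ⟨_, _, _, _, _, _, h1, h2, _⟩ := h true true i hi
    exact h1.lev_partner h2 hij

theorem IsCharted.exit_or_tight {n : ℕ} (h : IsCharted N M γ lev τ q n) {i : V} (hi : lev i = q) :
    Exit N M γ lev τ i ∨ ∃ k, Tight N M γ lev τ i k := by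
  rcases h with h | ⟨_, _, _, _, h⟩
  · obtain ⟨_, _, _, _, _, _, h1, h2, _⟩ := h false i hi
    exact h1.exit_or_tight h2
  · obtain ⟨_, _, _, _, _, _, h1, h2, _⟩ := h true false i hi
    exact h1.exit_or_tight h2

theorem IsTightCycle.lev_partner {ℓ : ℕ} {c : ℤ → V} (hc : IsTightCycle N M γ lev τ q ℓ c)
    (hM : M.IsMatching) {i j : V} (hi : lev i = q) (hij : M.Adj i j) : lev j = q := by
  obtain ⟨a, rfl⟩ := (hc.lev_iff i).1 hi
  rw [hc.lev_iff]
  rcases Int.even_or_odd a with h | h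
  · have h1 := hc.adj (a - 1) (h.sub_odd odd_one)
    rw [sub_add_cancel] at h1
    exact ⟨_, hM.eq_of_adj_left hij h1.symm⟩
  · exact ⟨_, hM.eq_of_adj_left hij (hc.adj a h)⟩

theorem IsTightCycle.exists_tight {ℓ : ℕ} {c : ℤ → V} (hc : IsTightCycle N M γ lev τ q ℓ c)
    {i : V} (hi : lev i = q) : ∃ k, Tight N M γ lev τ i k := by
  obtain ⟨a, rfl⟩ := (hc.lev_iff i).1 hi
  rcases Int.even_or_odd a with h | h
  · exact ⟨_, hc.tight a h⟩
  · have h1 := hc.tight (a - 1) (h.sub_odd odd_one)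
    rw [sub_add_cancel] at h1
    exact ⟨_, h1.symm⟩

namespace IsKTSequence

variable {k : ℕ} {Vs : ℕ → Set V} {Es : ℕ → Set (Sym2 V)}

/-- The level of a node is the stage at which it is set. -/
theorem exists_level (K : IsKTSequence N M γ k Vs Es τ) : ∃ lev : V → ℕ,
    (∀ i, lev i = 0 ↔ i ∉ M.verts) ∧ (∀ i, lev i ≤ k) ∧
    (∀ q, 1 ≤ q → q ≤ k → ∀ i, lev i = q ↔ i ∈ Vs q) ∧
    ∀ q, 1 ≤ q → q ≤ k → ∀ i, i ∈ settledBefore N M Vs q ↔ lev i < q := by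
  have h : ∀ i, ∃ q, (q = 0 ↔ i ∉ M.verts) ∧ q ≤ k ∧ (1 ≤ q → i ∈ Vs q) := by
    intro i
    rcases K.exhaust i with h | ⟨r, h1, h2, h3⟩
    · exact ⟨0, iff_of_true rfl h, Nat.zero_le _, by omega⟩
    · by_cases hi : i ∈ M.verts
      · exact ⟨r, iff_of_false (by omega) (not_not.2 hi), by omega, fun _ => h3⟩
      · exact ⟨0, iff_of_true rfl hi, Nat.zero_le _, by omega⟩
  choose lev h0 h1 h2 using h
  have disj : ∀ q r, 1 ≤ q → q < r → r ≤ k → ∀ i, i ∈ Vs q → i ∉ Vs r := by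
    intro q r hq hqr hr i hi hi'
    rw [K.nodes r (by omega) hr] at hi'
    exact hi'.2 (Or.inr ⟨q, hq, hqr, hi⟩)
  have hV : ∀ q, 1 ≤ q → q ≤ k → ∀ i, lev i = q ↔ i ∈ Vs q := by
    intro q hq hqk i
    refine ⟨fun h => h ▸ h2 i (by omega), fun h => ?_⟩
    have hi : lev i ≠ 0 := by
      intro h3
      rw [K.nodes q hq hqk] at h
      exact h.2 (Or.inl ((h0 i).1 h3))
    have h4 := h2 i (by omega)
    rcases lt_trichotomy (lev i) q with h5 | h5 | h5
    · exact absurd h (disj _ _ (by omega) h5 hqk i h4)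
    · exact h5
    · exact absurd h4 (disj _ _ hq h5 (h1 i) i h)
  refine ⟨lev, h0, h1, hV, fun q hq hqk i => ⟨?_, fun h => ?_⟩⟩
  · rintro (h | ⟨r, hr, hrq, h⟩)
    · have := (h0 i).2 h
      omega
    · have := (hV r hr (by omega) i).2 h
      omega
  · rcases Nat.eq_zero_or_pos (lev i) with h3 | h3
    · exact Or.inl ((h0 i).1 h3)
    · exact Or.inr ⟨lev i, h3, h, h2 i h3⟩

theorem exists_layering [Fintype V] (hB : IsNashBargaining N M γ)
    (huniq : ∀ (M' : N.graph.Subgraph) (γ' : V → ℝ), IsNashBargaining N M' γ' → M' = M ∧ γ' = γ)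
    (hσ : 0 < σ) (K : IsKTSequence N M γ k Vs Es τ) (h1 : 1 ≤ k → σ ≤ τ 1)
    (h2 : ∀ q, 1 ≤ q → q < k → σ ≤ τ (q + 1) - τ q)
    (h3 : ∀ q, 1 ≤ q → q ≤ k → ∀ i j, N.graph.Adj i j → i ∈ endpoints (Es q) →
      j ∈ endpoints (Es q) → s(i, j) ∉ Es q → τ q + σ ≤ N.slack γ i j) :
    ∃ lev : V → ℕ, Layering N M γ σ lev τ ∧
      ∀ q, q ≠ 0 → (∃ i, lev i = q) →
        IsCharted N M γ lev τ q (2 * Fintype.card {i // lev i = q}) := by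
  obtain ⟨lev, lev0, levk, levV, levF⟩ := K.exists_level
  have tau_lt : ∀ q r, 1 ≤ q → q < r → r ≤ k → τ q + σ ≤ τ r := by
    intro q r hq hqr
    induction r, hqr using Nat.le_induction with
    | base => intro hr; linarith [h2 q hq hr]
    | succ r hqr ih =>
      intro hr
      linarith [ih (by omega), h2 r (by have := Nat.le_of_succ_le hqr; omega) hr]
  have tau_ge : ∀ q, 1 ≤ q → q ≤ k → σ ≤ τ q := by
    intro q hq hqk
    have h4 := h1 (hq.trans hqk)
    rcases hq.lt_or_eq with h5 | rfl
    · linarith [tau_lt 1 q le_rfl h5 hqk]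
    · exact h4
  have pos : ∀ i, lev i ≠ 0 → 1 ≤ lev i := fun i h => Nat.one_le_iff_ne_zero.2 h
  have slack : ∀ q, 1 ≤ q → q ≤ k → ∀ i j, N.graph.Adj i j → ¬ M.Adj i j → q ≤ lev i →
      τ q ≤ N.slack γ i j := fun q hq hqk i j hij hM hi =>
    (K.optimum q hq hqk).1.edge_slack i j hij hM fun h => by
      have := (levF q hq hqk i).1 h.1
      omega
  have stage : ∀ q, 1 ≤ q → q ≤ k →
      IsStage N M γ lev τ q (settledBefore N M Vs q) (Es q) := by
    intro q hq hqk
    have level : ∀ i, lev i = q ↔ i ∈ endpoints (Es q) ∧ i ∉ settledBefore N M Vs q := by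
      intro i
      rw [levV q hq hqk, K.nodes q hq hqk]
      rfl
    refine ⟨hB.matching, fun i hi => (levF q hq hqk i).1 hi, level,
      K.tight q hq hqk, fun i j hij hi => ?_⟩
    -- A tight edge joins endpoints of `Es q`; outside `Es q` the gap would give it slack at least
    -- `τ q + σ`.
    by_contra h
    have h4 := h3 q hq hqk i j hij.1 ((level i).1 hi).1 ((level j).1 (hij.2.2.1.trans hi)).1 h
    rw [hij.2.2.2, hi] at h4
    linarith
  -- These facts supply `lev_partner` and `support` and so must precede the layering. For cycles
  -- they are read off directly, since their charts depend on the layering.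
  have basic : ∀ q, 1 ≤ q → q ≤ k → (∀ i j, lev i = q → M.Adj i j → lev j = q) ∧
      ∀ i, lev i = q → Exit N M γ lev τ i ∨ ∃ j, Tight N M γ lev τ i j := by
    intro q hq hqk
    have S := stage q hq hqk
    rcases K.shape q hq hqk with h | h | h | ⟨ℓ, c, h3, heven, hcl, hadj, hM, hinj, hF, hE⟩
    · have hc := S.isCharted_of_path h
      exact ⟨fun i j => hc.lev_partner, fun i => hc.exit_or_tight⟩
    · have hc := S.isCharted_of_blossom h
      exact ⟨fun i j => hc.lev_partner, fun i => hc.exit_or_tight⟩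
    · have hc := S.isCharted_of_bicycle h
      exact ⟨fun i j => hc.lev_partner, fun i => hc.exit_or_tight⟩
    · have hc := S.isTightCycle h3 heven hcl hadj hM hinj hF hE
      exact ⟨fun i j => hc.lev_partner hB.matching, fun i hi => Or.inr (hc.exists_tight hi)⟩
  have partner : ∀ i j, M.Adj i j → lev i = lev j := by
    intro i j hij
    have hi : lev i ≠ 0 := fun h => (lev0 i).1 h (M.edge_vert hij)
    exact ((basic _ (pos i hi) (levk i)).1 i j rfl hij).symm
  have L : Layering N M γ σ lev τ := by
    refine ⟨hσ, hB.matching, lev0, partner, fun i hi => hB.unmatched i ((lev0 i).1 hi), hB.traded,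
      fun i hi => ?_, fun i hi => tau_ge _ (pos i hi) (levk i), fun i j hij => ?_,
      fun i j hij hM hi hl => slack _ (pos i hi) (levk i) i j hij hM le_rfl,
      fun i j hij hi hl => ?_, fun i j hij hM hi hl => ?_, fun i hi => ?_⟩
    · refine (K.optimum _ (pos i hi) (levk i)).1.node_slack i fun h => ?_
      have := (levF _ (pos i hi) (levk i) i).1 h
      omega
    · by_contra! h
      have hi := (lev0 i).1 h.1
      have h4 := hB.stable i j hij fun h' => hi (M.edge_vert h')
      rw [hB.unmatched i hi, hB.unmatched j ((lev0 j).1 h.2)] at h4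
      have h5 := N.weight_pos s(i, j) hij
      linarith
    -- An edge to a higher level is still constrained at the stage of its higher end, whose slack is
    -- larger by at least `σ`.
    · have hM : ¬ M.Adj j i := fun h => by
        have := partner j i h
        omega
      rw [N.slack_comm]
      exact (tau_lt _ _ (pos i hi) hl (levk j)).trans
        (slack _ (by omega) (levk j) j i hij.symm hM le_rfl)
    · have S := stage _ (pos i hi) (levk i)
      by_cases h : s(i, j) ∈ Es (lev i)
      · exact Or.inl (S.slack i j h hM)
      · exact Or.inr (h3 _ (pos i hi) (levk i) i j hij ((S.level i).1 rfl).1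
          ((S.level j).1 hl).1 h)
    · rcases (basic _ (pos i hi) (levk i)).2 i rfl with (h | ⟨j, h4, h5, h6, h7⟩) | ⟨j, h4⟩
      · exact Or.inl h
      · exact Or.inr ⟨j, h4, h5, h6.le, h7⟩
      · exact Or.inr ⟨j, h4.1, h4.2.1, h4.2.2.1.le, h4.2.2.2⟩
  refine ⟨lev, L, ?_⟩
  rintro q hq ⟨i, rfl⟩
  have S := stage _ (pos i hq) (levk i)
  rcases K.shape _ (pos i hq) (levk i) with h | h | h | h
  · exact S.isCharted_of_path h
  · exact S.isCharted_of_blossom h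
  · exact S.isCharted_of_bicycle h
  · exact S.isCharted_of_cycle L huniq hq h

end IsKTSequence

end

end Bargaining

theorem theorem2 (κ : ℝ) (hκ0 : 0 < κ) (hκ1 : κ < 1) :
    ∃ C : ℝ, 0 < C ∧
      ∀ (V : Type*) [Fintype V] (N : Bargaining.ExchangeNetwork V)
        (M : N.graph.Subgraph) (γNB : V → ℝ) (σ ε : ℝ),
        Bargaining.IsNashBargaining N M γNB →
        (∀ (M' : N.graph.Subgraph) (γ' : V → ℝ),
          Bargaining.IsNashBargaining N M' γ' → M' = M ∧ γ' = γNB) →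
        0 < σ → Bargaining.HasGap N M γNB σ → 0 < ε →
        ∀ α₀ : V → V → ℝ, Bargaining.IsValid N α₀ →
        ∀ t : ℕ,
          C * (Fintype.card V : ℝ) ^ 7 * (N.maxWeight / σ + Real.log (1 + σ / ε)) ≤ (t : ℝ) →
          ∀ i : V, |Bargaining.earning N (Bargaining.messages N κ α₀ t) i - γNB i| ≤ ε := by
  obtain ⟨A, hA⟩ := Bargaining.exists_isRate hκ0 hκ1
  have hA0 : (0 : ℝ) < A := by exact_mod_cast lt_of_lt_of_le two_pos hA.two_le
  refine ⟨10 * (A : ℝ) ^ 2, by positivity, ?_⟩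
  intro V _ N M γNB σ ε hB huniq hσ ⟨k, Vs, Es, τ, K, h1, h2, h3⟩ hε α₀ hα₀ t ht i
  obtain ⟨lev, L, hch⟩ := K.exists_layering hB huniq hσ h1 h2 h3
  exact Bargaining.convergence_of_layering hκ0 hκ1 hA L hch hε hα₀ ht i
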